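/- Let $d\in\mathbb N$, $\kappa>0$, $\sigma>0$, and let $\gamma$ be one of the following kernels on $\mathbb R^d$: (White) $\gamma=\sigma^2\delta_0$, with $\omega:=d$; (Riesz) $\gamma(x)=\sigma^2|x|^{-\omega}$ with $0<\omega<d$; (Fractional) $\gamma(x)=\sigma^2\prod_{i=1}^d|x_i|^{-\omega_i}$ with $\omega_i\in(0,1)$ for all $i$, and $\omega:=\sum_{i=1}^d\omega_i$. Suppose that $0<\omega<2$. For $\varepsilon>0$ let $p_\varepsilon(x)=(2\pi\varepsilon^2)^{-d/2}e^{-|x|^2/(2\varepsilon^2)}$ and $\gamma_\varepsilon:=\gamma*p_\varepsilon$. For $p,\mathfrak c>0$ define $$\mathbf M:=\sup_{f\in H^1(\mathbb R^d),\ \|f\|_2=1}\left(\frac12\iint_{(\mathbb R^d)^2}f(x)^2\gamma(x-y)f(y)^2\,dx\,dy-\kappa\int_{\mathbb R^d}|\nabla f(x)|^2\,dx\right),$$ $$\mathbf M_{\mathfrak c,p}:=\sup_{f\in H^1(\mathbb R^d),\ \|f\|_2=1}\left(\frac12\iint_{(\mathbb R^d)^2}f(x)^2\gamma_{p^{1/(2-\omega)}\mathfrak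 c}(x-y)f(y)^2\,dx\,dy-\kappa\int_{\mathbb R^d}|\nabla f(x)|^2\,dx\right),$$ where the functions $f$ are real-valued and, for white noise, $\iint f(x)^2\gamma(x-y)f(y)^2\,dx\,dy=\sigma^2\int f(x)^4\,dx$. A maximizer is an $f\in H^1(\mathbb R^d)$ with $\|f\|_2=1$ which attains the supremum. Then: 1. For every $p,\mathfrak c>0$, the constant $\mathbf M_{\mathfrak c,p}$ is finite and positive, and it has maximizers. 2. The constant $\mathbf M$ is finite, and for every fixed $p>0$, $\displaystyle\lim_{\mathfrak c\to0}\mathbf M_{\mathfrak c,p}=\mathbf M$. 3. Let $p>0$ be fixed, and let $(f_\star^{(\mathfrak c)})_{\mathfrak c>0}$ be such that $f_\star^{(\mathfrak c)}$ is a maximizer of $\mathbf M_{\mathfrak c,p}$ for all $\mathfrak c>0$. Then every sequence of positive numbers $\mathfrak c$ that converges to $0$ has a subsequence $(\mathfrak c_n)_{n\in\mathbb N}$ along which $$\lim_{n\to\infty}\big\|f_\star^{(\mathfrak c_n)}(\cdot-z_n)-f_\star\big\|_{H^1(\mathbb R^d)}=0$$ for some $z_n\in\mathbb R^d$ and some maximizer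 $f_\star$ of $\mathbf M$. -/

import Mathlib

open MeasureTheory Filter Topology
open scoped ENNReal ContDiff

namespace PAM

noncomputable section

/-- `ℝᵈ` with the Euclidean norm and Lebesgue measure. -/
abbrev Space (d : ℕ) : Type := EuclideanSpace ℝ (Fin d)

/-! ### The Sobolev space `H¹(ℝᵈ)` -/

/-- `g` is the weak gradient of `f`: `∫ f ∂ᵥφ = - ∫ ⟨g, v⟩ φ` for all test functions
`φ ∈ C_c^∞(ℝᵈ)` and all directions `v`. -/
def IsWeakGradient {d : ℕ} (f : Space d → ℝ) (g : Space d → Space d) : Prop :=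
  LocallyIntegrable f volume ∧ LocallyIntegrable g volume ∧
    ∀ φ : Space d → ℝ, ContDiff ℝ ∞ φ → HasCompactSupport φ →
      ∀ v : Space d, ∫ x, f x * fderiv ℝ φ x v = - ∫ x, inner ℝ (g x) v * φ x

/-- `f ∈ H¹(ℝᵈ)`: `f` is in `L²` and has a weak gradient in `L²`. -/
def MemH1 {d : ℕ} (f : Space d → ℝ) : Prop :=
  MemLp f 2 volume ∧ ∃ g : Space d → Space d, MemLp g 2 volume ∧ IsWeakGradient f g

open Classical in
/-- The weak gradient of `f` (unique up to null sets), and `0` if `f` has no weak gradient. -/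
def weakGrad {d : ℕ} (f : Space d → ℝ) : Space d → Space d :=
  if h : ∃ g : Space d → Space d, IsWeakGradient f g then h.choose else 0

/-- The norm of `H¹(ℝᵈ)`, `(‖f‖₂² + ‖∇f‖₂²)^{1/2}` for `f ∈ H¹(ℝᵈ)`. -/
def h1Norm {d : ℕ} (f : Space d → ℝ) : ℝ :=
  Real.sqrt ((∫ x, f x ^ 2) + ∫ x, ‖weakGrad f x‖ ^ 2)

/-! ### The covariance kernels -/

/-- The three types of noise on `ℝᵈ`, together with their exponents. -/
inductive NoiseKernel (d : ℕ) : Type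
  | white : NoiseKernel d
  | riesz (a : ℝ) : NoiseKernel d
  | fractional (w : Fin d → ℝ) : NoiseKernel d

/-- The constraints on the exponents: `0 < a < d` for Riesz noise (with kernel `σ² |x|^{-a}`) and `ωᵢ ∈ (0,1)` for
fractional noise. -/
def NoiseKernel.Admissible {d : ℕ} : NoiseKernel d → Prop
  | .white => True
  | .riesz a => 0 < a ∧ a < d
  | .fractional w => ∀ i, 0 < w i ∧ w i < 1

/-- The scaling exponent `ω`, for which `γ(c x) = c^{-ω} γ(x)`. -/
def NoiseKernel.exponent {d : ℕ} : NoiseKernel d → ℝ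
  | .white => d
  | .riesz a => a
  | .fractional w => ∑ i, w i

/-- The covariance `γ`, as the measure `γ(x) dx`: `σ² δ₀` for white noise, `σ² |x|^{-a} dx` for
Riesz noise and `σ² ∏ᵢ |xᵢ|^{-ωᵢ} dx` for fractional noise. -/
def NoiseKernel.cov {d : ℕ} (σ : ℝ) : NoiseKernel d → Measure (Space d)
  | .white => ENNReal.ofReal (σ ^ 2) • Measure.dirac 0
  | .riesz a => volume.withDensity fun x => ENNReal.ofReal (σ ^ 2 * ‖x‖ ^ (-a))
  | .fractional w => volume.withDensity fun x => ENNReal.ofReal (σ ^ 2 * ∏ i, |x i| ^ (-w i))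

/-- The Gaussian density `p_ε(x) = e^{-|x|²/(2ε²)} / (2πε²)^{d/2}`. -/
def gaussianKernel (d : ℕ) (ε : ℝ) (x : Space d) : ℝ :=
  Real.exp (-‖x‖ ^ 2 / (2 * ε ^ 2)) / (2 * Real.pi * ε ^ 2) ^ ((d : ℝ) / 2)

/-- The function `γ_ε = γ * p_ε`, that is `γ_ε(x) = ∫ p_ε(x - y) γ(dy)`. -/
def mollifiedKernel {d : ℕ} (γ : Measure (Space d)) (ε : ℝ) (x : Space d) : ℝ≥0∞ :=
  ∫⁻ y, ENNReal.ofReal (gaussianKernel d ε (x - y)) ∂γ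

/-- The mollified covariance, as the measure `γ_ε(x) dx`. -/
def mollifiedCov {d : ℕ} (γ : Measure (Space d)) (ε : ℝ) : Measure (Space d) :=
  volume.withDensity (mollifiedKernel γ ε)

/-! ### The variational problems -/

/-- `½ ∬ f(x)² γ(x - y) f(y)² dx dy`, written as `½ ∫ f(x)² (∫ f(x - z)² γ(dz)) dx` so that it
makes sense for every measure `γ`; for `γ = σ² δ₀` it is `½ σ² ∫ f⁴`. -/
def interaction {d : ℕ} (γ : Measure (Space d)) (f : Space d → ℝ) : ℝ≥0∞ :=
  2⁻¹ * ∫⁻ x, ENNReal.ofReal (f x ^ 2) * ∫⁻ z, ENNReal.ofReal (f (x - z) ^ 2) ∂γ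

/-- `½ ∬ f(x)² γ(x - y) f(y)² dx dy - κ ∫ |∇f(x)|² dx`. It is extended-real-valued: nothing is
presupposed about the finiteness of the double integral. -/
def energy {d : ℕ} (κ : ℝ) (γ : Measure (Space d)) (f : Space d → ℝ) : EReal :=
  (interaction γ f : EReal) - ((κ * ∫ x, ‖weakGrad f x‖ ^ 2 : ℝ) : EReal)

/-- The supremum of the energy over `f ∈ H¹(ℝᵈ)` with `‖f‖₂ = 1`. -/
def varConst {d : ℕ} (κ : ℝ) (γ : Measure (Space d)) : EReal :=
  sSup {e : EReal | ∃ f : Space d → ℝ, MemH1 f ∧ eLpNorm f 2 volume = 1 ∧ e = energy κ γ f}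

/-- `f` attains the supremum `varConst κ γ`. -/
def IsMaximizer {d : ℕ} (κ : ℝ) (γ : Measure (Space d)) (f : Space d → ℝ) : Prop :=
  MemH1 f ∧ eLpNorm f 2 volume = 1 ∧ energy κ γ f = varConst κ γ

/-- The covariance `γ_{p^{1/(2-ω)} 𝔠}` which enters the definition of `M_{𝔠,p}`. -/
def NoiseKernel.covAt {d : ℕ} (k : NoiseKernel d) (σ p c : ℝ) : Measure (Space d) :=
  mollifiedCov (k.cov σ) (p ^ (1 / (2 - k.exponent)) * c)

end

end PAM

namespace PAM

/-!
Write `γ_ε = γ * p_ε`. The potential `γ_ε * u²` at `x` is the square of an `L²` norm of `u` with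
weight `γ_ε(x - ·)`. Since `γ_{ε'} = γ_ε * p_δ` with `δ² = ε'² - ε²`, and translating `u` by `h`
costs at most `|h| ‖∇u‖`, this norm varies with the scale in a Hölder fashion: the bound
`γ_ε ≤ A ε^{-ω}` with `ω < 2` makes the increments over dyadic scales a geometric series of ratio
`2^{-(1 - ω/2)}`. Hence the interactions at scales `0` and `ε` differ by `O(ε^{1 - ω/2})` on sets
bounded in `H¹`, which gives coercivity, finiteness and the convergence of the constants.

Spreading trial functions, whose interaction decays like `R^{-ω}` against a kinetic energy `R^{-2}`,
show that the constants are positive. A maximizing sequence therefore does not vanish, and suitable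
translates have a non-zero weak limit. The energy splits asymptotically into that of the limit and
that of the remainder; as the interaction is quartic and the kinetic energy quadratic, dividing the
mass between the two strictly loses energy, so the limit carries all the mass and the convergence is
strong in `H¹`. Maximizers at scale `ε → 0` form a maximizing sequence for the limit problem.
-/

noncomputable section

section Sobolev

variable {d : ℕ}

/-- The Hilbert space of square-integrable functions on `ℝᵈ`. -/
abbrev L2 (d : ℕ) : Type := Lp ℝ 2 (volume : Measure (Space d))

/-- The Hilbert space of square-integrable vector fields on `ℝᵈ`. -/
abbrev VectorL2 (d : ℕ) : Type := Lp (Space d) 2 (volume : Measure (Space d))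

theorem IsWeakGradient.congr {f f' : Space d → ℝ} {g g' : Space d → Space d}
    (hf : f =ᵐ[volume] f') (hg : g =ᵐ[volume] g') (h : IsWeakGradient f g) :
    IsWeakGradient f' g' := by
  refine ⟨h.1.congr hf, h.2.1.congr hg, fun φ hφ hc v => ?_⟩
  have hleft : ∫ x, f x * fderiv ℝ φ x v = ∫ x, f' x * fderiv ℝ φ x v :=
    integral_congr_ae (hf.mono fun x hx => by simp only [hx])
  have hright : ∫ x, inner ℝ (g x) v * φ x = ∫ x, inner ℝ (g' x) v * φ x :=
    integral_congr_ae (hg.mono fun x hx => by simp only [hx])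
  rw [← hleft, ← hright, h.2.2 φ hφ hc v]

theorem inner_integral_smul {g : Space d → Space d} (hg : LocallyIntegrable g)
    {φ : Space d → ℝ} (hφ : Continuous φ) (hc : HasCompactSupport φ) (v : Space d) :
    inner ℝ (∫ x, φ x • g x) v = ∫ x, inner ℝ (g x) v * φ x := by
  rw [real_inner_comm, ← integral_inner (hg.integrable_smul_left_of_hasCompactSupport hφ hc)]
  simp only [real_inner_smul_right, real_inner_comm v, mul_comm]

theorem IsWeakGradient.ae_eq {f f' : Space d → ℝ} {g g' : Space d → Space d}
    (hff : f =ᵐ[volume] f') (h : IsWeakGradient f g) (h' : IsWeakGradient f' g') :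
    g =ᵐ[volume] g' := by
  refine ae_eq_of_integral_contDiff_smul_eq h.2.1 h'.2.1 fun φ hφ hc =>
    ext_inner_right ℝ fun v => ?_
  rw [inner_integral_smul h.2.1 hφ.continuous hc, inner_integral_smul h'.2.1 hφ.continuous hc,
    ← neg_inj, ← h.2.2 φ hφ hc v, ← (h'.congr hff.symm .rfl).2.2 φ hφ hc v]

theorem IsWeakGradient.isWeakGradient_weakGrad {f : Space d → ℝ} {g : Space d → Space d}
    (h : IsWeakGradient f g) : IsWeakGradient f (weakGrad f) := by
  have hex : ∃ g : Space d → Space d, IsWeakGradient f g := ⟨g, h⟩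
  rw [weakGrad, dif_pos hex]
  exact hex.choose_spec

theorem IsWeakGradient.weakGrad_ae_eq {f : Space d → ℝ} {g : Space d → Space d}
    (h : IsWeakGradient f g) : weakGrad f =ᵐ[volume] g :=
  h.isWeakGradient_weakGrad.ae_eq .rfl h

/-- The graph of the weak gradient as a relation on `L²`. Keeping the gradient as a second variable
turns weak limits of Sobolev functions into weak limits in a product of Hilbert spaces. -/
def HasGrad (u : L2 d) (g : VectorL2 d) : Prop := IsWeakGradient u g

theorem IsWeakGradient.hasGrad {f : Space d → ℝ} {g : Space d → Space d}
    (hf : MemLp f 2) (hg : MemLp g 2) (h : IsWeakGradient f g) :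
    HasGrad (hf.toLp f) (hg.toLp g) :=
  h.congr hf.coeFn_toLp.symm hg.coeFn_toLp.symm

theorem inner_toLp_eq_integral {α F : Type*} [MeasurableSpace α] {μ : Measure α}
    [NormedAddCommGroup F] [InnerProductSpace ℝ F] {f : α → F} (hf : MemLp f 2 μ)
    (u : Lp F 2 μ) : inner ℝ (hf.toLp f) u = ∫ x, inner ℝ (f x) (u x) ∂μ := by
  rw [L2.inner_def]
  exact integral_congr_ae (hf.coeFn_toLp.mono fun x hx => by simp only [hx])

theorem memLp_fderiv_apply {φ : Space d → ℝ} (hφ : ContDiff ℝ ∞ φ) (hc : HasCompactSupport φ)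
    (v : Space d) : MemLp (fun x => fderiv ℝ φ x v) 2 :=
  ((hφ.continuous_fderiv (by simp)).clm_apply continuous_const).memLp_of_hasCompactSupport
    (hc.fderiv_apply ℝ v)

theorem memLp_smul_const {φ : Space d → ℝ} (hφ : Continuous φ) (hc : HasCompactSupport φ)
    (v : Space d) : MemLp (fun x => φ x • v) 2 :=
  (hφ.smul continuous_const).memLp_of_hasCompactSupport hc.smul_right

theorem inner_toLp_smul_const {φ : Space d → ℝ} (hφ : Continuous φ) (hc : HasCompactSupport φ)
    (v : Space d) (g : VectorL2 d) :
    inner ℝ ((memLp_smul_const hφ hc v).toLp _) g = ∫ x, inner ℝ (g x) v * φ x := by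
  simp only [inner_toLp_eq_integral, real_inner_smul_left, real_inner_comm v, mul_comm]

theorem hasGrad_iff_inner {u : L2 d} {g : VectorL2 d} :
    HasGrad u g ↔ ∀ (φ : Space d → ℝ) (hφ : ContDiff ℝ ∞ φ) (hc : HasCompactSupport φ)
      (v : Space d), inner ℝ ((memLp_fderiv_apply hφ hc v).toLp _) u =
        - inner ℝ ((memLp_smul_const hφ.continuous hc v).toLp _) g := by
  have hu : LocallyIntegrable u := (Lp.memLp u).locallyIntegrable (by norm_num)
  have hg : LocallyIntegrable g := (Lp.memLp g).locallyIntegrable (by norm_num)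
  have hinner (φ : Space d → ℝ) (hφ : ContDiff ℝ ∞ φ) (hc : HasCompactSupport φ) (v : Space d) :=
    inner_toLp_smul_const hφ.continuous hc v g
  simp +contextual only [HasGrad, hinner, IsWeakGradient, hu, hg, true_and, inner_toLp_eq_integral,
    RCLike.inner_apply, conj_trivial]

theorem HasGrad.sub {u u' : L2 d} {g g' : VectorL2 d} (h : HasGrad u g) (h' : HasGrad u' g') :
    HasGrad (u - u') (g - g') := by
  rw [hasGrad_iff_inner] at *
  intro φ hφ hc v
  rw [inner_sub_right, inner_sub_right, h φ hφ hc v, h' φ hφ hc v]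
  ring

theorem HasGrad.smul {u : L2 d} {g : VectorL2 d} (h : HasGrad u g) (c : ℝ) :
    HasGrad (c • u) (c • g) := by
  rw [hasGrad_iff_inner] at *
  intro φ hφ hc v
  rw [inner_smul_right, inner_smul_right, h φ hφ hc v]
  ring

theorem HasGrad.of_tendsto_inner {ι : Type*} {l : Filter ι} [l.NeBot] {u : ι → L2 d}
    {g : ι → VectorL2 d} {u₀ : L2 d} {g₀ : VectorL2 d} (h : ∀ n, HasGrad (u n) (g n))
    (hu : ∀ w, Tendsto (fun n => inner ℝ w (u n)) l (𝓝 (inner ℝ w u₀)))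
    (hg : ∀ w, Tendsto (fun n => inner ℝ w (g n)) l (𝓝 (inner ℝ w g₀))) :
    HasGrad u₀ g₀ := by
  refine hasGrad_iff_inner.2 fun φ hφ hc v => tendsto_nhds_unique (hu _) ?_
  simp_rw [fun n => hasGrad_iff_inner.1 (h n) φ hφ hc v]
  exact (hg _).neg

/-- Translation `u ↦ u(· + h)` as an isometry of `L²`. -/
def translate {F : Type*} [NormedAddCommGroup F] [NormedSpace ℝ F] (h : Space d) :
    Lp F 2 (volume : Measure (Space d)) →ₗᵢ[ℝ] Lp F 2 (volume : Measure (Space d)) :=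
  Lp.compMeasurePreservingₗᵢ ℝ (fun x => x + h) (measurePreserving_add_right volume h)

theorem coeFn_translate {F : Type*} [NormedAddCommGroup F] [NormedSpace ℝ F] (h : Space d)
    (u : Lp F 2 (volume : Measure (Space d))) :
    translate h u =ᵐ[volume] fun x => u (x + h) :=
  Lp.coeFn_compMeasurePreserving u (measurePreserving_add_right volume h)

theorem contDiff_comp_sub_right {φ : Space d → ℝ} (hφ : ContDiff ℝ ∞ φ) (h : Space d) :
    ContDiff ℝ ∞ fun x => φ (x - h) :=
  hφ.comp (contDiff_id.sub contDiff_const)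

theorem hasCompactSupport_comp_sub_right {φ : Space d → ℝ} (hc : HasCompactSupport φ)
    (h : Space d) : HasCompactSupport fun x => φ (x - h) :=
  hc.comp_homeomorph (Homeomorph.subRight h)

theorem HasGrad.translate {u : L2 d} {g : VectorL2 d} (hu : HasGrad u g) (h : Space d) :
    HasGrad (PAM.translate h u) (PAM.translate h g) := by
  refine ⟨(Lp.memLp _).locallyIntegrable (by norm_num),
    (Lp.memLp _).locallyIntegrable (by norm_num), fun φ hφ hc v => ?_⟩
  have hleft : ∫ x, PAM.translate h u x * fderiv ℝ φ x v
      = ∫ x, u x * fderiv ℝ (fun y => φ (y - h)) x v := by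
    rw [← integral_add_right_eq_self (fun x => u x * fderiv ℝ (fun y => φ (y - h)) x v) h]
    refine integral_congr_ae ((coeFn_translate h u).mono fun x hx => ?_)
    simp only [hx, fderiv_comp_sub, add_sub_cancel_right]
  have hright : ∫ x, inner ℝ (PAM.translate h g x) v * φ x
      = ∫ x, inner ℝ (g x) v * φ (x - h) := by
    rw [← integral_add_right_eq_self (fun x => inner ℝ (g x) v * φ (x - h)) h]
    refine integral_congr_ae ((coeFn_translate h g).mono fun x hx => ?_)
    simp only [hx, add_sub_cancel_right]
  rw [hleft, hright]
  exact hu.2.2 _ (contDiff_comp_sub_right hφ h) (hasCompactSupport_comp_sub_right hc h) v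

theorem hasDerivAt_integral_mul_comp_sub_smul {f φ : Space d → ℝ} (hf : LocallyIntegrable f)
    (hφ : ContDiff ℝ 1 φ) (hc : HasCompactSupport φ) (h : Space d) (s : ℝ) :
    HasDerivAt (fun s : ℝ => ∫ x, f x * φ (x - s • h))
      (-∫ x, f x * fderiv ℝ φ (x - s • h) h) s := by
  let ψ : Space d → ℝ := fun x => φ (-x)
  have hψ : ContDiff ℝ 1 ψ := hφ.comp contDiff_neg
  have hψc : HasCompactSupport ψ := hc.comp_homeomorph (Homeomorph.neg _)
  have hψ' (x : Space d) : fderiv ℝ ψ (s • h - x) h = - fderiv ℝ φ (x - s • h) h := by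
    have hφ' := (hφ.differentiable one_ne_zero (-(s • h - x))).hasFDerivAt
    have hψ' : HasFDerivAt ψ _ (s • h - x) :=
      hφ'.comp (s • h - x) (hasFDerivAt_id (𝕜 := ℝ) (s • h - x)).neg
    simp [hψ'.fderiv]
  have hconv : (fun s : ℝ => ∫ x, f x * φ (x - s • h)) =
      convolution f ψ (ContinuousLinearMap.mul ℝ ℝ) volume ∘ fun s : ℝ => id s • h := by
    ext s
    simp [convolution, ψ]
  have hex := HasCompactSupport.convolutionExists_right
    ((ContinuousLinearMap.mul ℝ ℝ).precompR (Space d)) (hψc.fderiv (𝕜 := ℝ)) hf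
    (hψ.continuous_fderiv one_ne_zero) (s • h)
  rw [hconv]
  convert! (HasCompactSupport.hasFDerivAt_convolution_right (ContinuousLinearMap.mul ℝ ℝ)
    (μ := volume) hψc hf hψ (s • h)).comp_hasDerivAt s ((hasDerivAt_id s).smul_const h) using 1
  simp only [convolution, one_smul]
  rw [ContinuousLinearMap.integral_apply hex, ← integral_neg]
  simp [ContinuousLinearMap.precompR_apply, hψ']

theorem HasGrad.hasDerivAt_integral_mul_comp_sub_smul {u : L2 d} {g : VectorL2 d}
    (hu : HasGrad u g) {φ : Space d → ℝ} (hφ : ContDiff ℝ ∞ φ) (hc : HasCompactSupport φ)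
    (h : Space d) (s : ℝ) :
    HasDerivAt (fun s : ℝ => ∫ x, u x * φ (x - s • h))
      (∫ x, inner ℝ (g x) h * φ (x - s • h)) s := by
  have hweak := hu.2.2 _ (contDiff_comp_sub_right hφ (s • h))
    (hasCompactSupport_comp_sub_right hc (s • h)) h
  simp only [fderiv_comp_sub] at hweak
  rw [← neg_eq_iff_eq_neg.2 hweak]
  exact PAM.hasDerivAt_integral_mul_comp_sub_smul hu.1 (hφ.of_le (by simp)) hc h s

theorem norm_toLp_comp_sub_smul_const {φ : Space d → ℝ} (hφ : Continuous φ)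
    (hc : HasCompactSupport φ) (a h : Space d) :
    ‖(memLp_smul_const (φ := fun x => φ (x - a)) (hφ.comp (continuous_sub_right a))
      (hasCompactSupport_comp_sub_right hc a) h).toLp _‖
      = ‖h‖ * ‖(hφ.memLp_of_hasCompactSupport hc : MemLp φ 2 volume).toLp φ‖ := by
  have htrans : eLpNorm (fun x => φ (x - a)) 2 volume = eLpNorm φ 2 volume :=
    eLpNorm_comp_measurePreserving hφ.aestronglyMeasurable (measurePreserving_sub_right volume a)
  have hsmul : eLpNorm (fun x => φ (x - a) • h) 2 volume
      = eLpNorm (‖h‖ • fun x => φ (x - a)) 2 volume :=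
    eLpNorm_congr_norm_ae (.of_forall fun x => by simp [norm_smul, mul_comm])
  rw [Lp.norm_toLp, Lp.norm_toLp, ← htrans]
  rw [hsmul, eLpNorm_const_smul, enorm_norm, ENNReal.toReal_mul, toReal_enorm]

theorem HasGrad.abs_inner_toLp_translate_sub_le {u : L2 d} {g : VectorL2 d} (hu : HasGrad u g)
    (h : Space d) {φ : Space d → ℝ} (hφ : ContDiff ℝ ∞ φ) (hc : HasCompactSupport φ) :
    |inner ℝ ((hφ.continuous.memLp_of_hasCompactSupport hc).toLp φ) (PAM.translate h u - u)|
      ≤ ‖h‖ * ‖g‖ * ‖(hφ.continuous.memLp_of_hasCompactSupport hc : MemLp φ 2 volume).toLp φ‖ := by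
  set w : L2 d := (hφ.continuous.memLp_of_hasCompactSupport hc).toLp φ with hw
  have hdiff : inner ℝ w (PAM.translate h u - u)
      = (∫ x, u x * φ (x - (1 : ℝ) • h)) - ∫ x, u x * φ (x - (0 : ℝ) • h) := by
    rw [inner_sub_right, hw, inner_toLp_eq_integral, inner_toLp_eq_integral]
    congr 1
    · rw [← integral_add_right_eq_self (fun x => u x * φ (x - (1 : ℝ) • h)) h]
      refine integral_congr_ae ((coeFn_translate h u).mono fun x hx => ?_)
      simp [hx]
    · simp
  have hderiv (s : ℝ) : ‖∫ x, inner ℝ (g x) h * φ (x - s • h)‖ ≤ ‖h‖ * ‖g‖ * ‖w‖ := by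
    rw [← inner_toLp_smul_const (contDiff_comp_sub_right hφ (s • h)).continuous
      (hasCompactSupport_comp_sub_right hc (s • h)) h g]
    refine (norm_inner_le_norm _ _).trans_eq ?_
    rw [norm_toLp_comp_sub_smul_const hφ.continuous hc (s • h) h]
    ring
  rw [hdiff]
  simpa using Convex.norm_image_sub_le_of_norm_hasDerivWithin_le (s := Set.univ) (x := 0) (y := 1)
    (fun s _ => (hu.hasDerivAt_integral_mul_comp_sub_smul hφ hc h s).hasDerivWithinAt)
    (fun s _ => hderiv s) convex_univ trivial trivial

theorem norm_le_of_dense_abs_inner_le {H : Type*} [NormedAddCommGroup H] [InnerProductSpace ℝ H]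
    {s : Set H} (hs : Dense s) {v : H} {C : ℝ} (hC : 0 ≤ C)
    (h : ∀ w ∈ s, |inner ℝ w v| ≤ C * ‖w‖) : ‖v‖ ≤ C := by
  have hclosed : IsClosed {w : H | |inner ℝ w v| ≤ C * ‖w‖} :=
    isClosed_le (by fun_prop) (by fun_prop)
  have hv : |inner ℝ v v| ≤ C * ‖v‖ := hclosed.closure_subset_iff.2 h (hs v)
  rw [real_inner_self_eq_norm_sq, abs_of_nonneg (by positivity)] at hv
  by_contra! hlt
  nlinarith

theorem HasGrad.norm_translate_sub_le {u : L2 d} {g : VectorL2 d} (hu : HasGrad u g)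
    (h : Space d) : ‖PAM.translate h u - u‖ ≤ ‖h‖ * ‖g‖ := by
  refine norm_le_of_dense_abs_inner_le
    (Lp.dense_hasCompactSupport_contDiff (E := Space d) (F := ℝ) (μ := volume) (p := 2)
      (by norm_num)) (by positivity) ?_
  rintro w ⟨φ, hwφ, hc, hφ⟩
  obtain rfl : w = (hφ.continuous.memLp_of_hasCompactSupport hc).toLp φ :=
    Lp.ext (hwφ.trans (MemLp.coeFn_toLp _).symm)
  exact hu.abs_inner_toLp_translate_sub_le h hφ hc

end Sobolev

section Gaussian

variable {d : ℕ}

theorem gaussianKernel_nonneg (ε : ℝ) (x : Space d) : 0 ≤ gaussianKernel d ε x := by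
  unfold gaussianKernel
  positivity

theorem gaussianKernel_pos {ε : ℝ} (hε : 0 < ε) (x : Space d) : 0 < gaussianKernel d ε x := by
  unfold gaussianKernel
  positivity

theorem continuous_gaussianKernel (ε : ℝ) : Continuous (gaussianKernel d ε) := by
  unfold gaussianKernel
  fun_prop

theorem gaussianKernel_neg (ε : ℝ) (x : Space d) :
    gaussianKernel d ε (-x) = gaussianKernel d ε x := by
  rw [gaussianKernel, gaussianKernel, norm_neg]

theorem gaussianKernel_anti {ε : ℝ} {x y : Space d} (h : ‖x‖ ≤ ‖y‖) :
    gaussianKernel d ε y ≤ gaussianKernel d ε x := by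
  unfold gaussianKernel
  gcongr

theorem gaussianKernel_zero (ε : ℝ) :
    gaussianKernel d ε 0 = ((2 * Real.pi * ε ^ 2) ^ ((d : ℝ) / 2))⁻¹ := by
  simp [gaussianKernel]

theorem gaussianKernel_eq_const_mul (ε : ℝ) (x : Space d) :
    gaussianKernel d ε x = gaussianKernel d ε 0 * Real.exp (-(1 / (2 * ε ^ 2)) * ‖x‖ ^ 2) := by
  rw [gaussianKernel_zero, gaussianKernel, div_eq_inv_mul, neg_mul, neg_div, one_div_mul_eq_div]

theorem integrable_gaussianKernel {ε : ℝ} (hε : 0 < ε) : Integrable (gaussianKernel d ε) := by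
  refine (Integrable.const_mul ?_ _).congr
    (.of_forall fun x => (gaussianKernel_eq_const_mul ε x).symm)
  have hcexp := GaussianFourier.integrable_cexp_neg_mul_sq_norm_add (V := Space d)
    (b := ((1 / (2 * ε ^ 2) : ℝ) : ℂ)) (by rw [Complex.ofReal_re]; positivity) 0 0
  refine hcexp.norm.congr (.of_forall fun x => ?_)
  simp [Complex.norm_exp, ← Complex.ofReal_pow, ← Complex.ofReal_mul]

theorem integral_gaussianKernel {ε : ℝ} (hε : 0 < ε) : ∫ x, gaussianKernel d ε x = 1 := by
  have hπ : Real.pi / (1 / (2 * ε ^ 2)) = 2 * Real.pi * ε ^ 2 := by field_simp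
  rw [funext (gaussianKernel_eq_const_mul ε), integral_const_mul,
    GaussianFourier.integral_rexp_neg_mul_sq_norm (by positivity), hπ,
    finrank_euclideanSpace, Fintype.card_fin, gaussianKernel_zero]
  exact inv_mul_cancel₀ (by positivity)

theorem gaussianKernel_smul {ε : ℝ} (hε : 0 < ε) (x : Space d) :
    gaussianKernel d ε x = (ε ^ d)⁻¹ * gaussianKernel d 1 (ε⁻¹ • x) := by
  have hnorm : (2 * Real.pi * ε ^ 2) ^ ((d : ℝ) / 2) =
      (2 * Real.pi * 1 ^ 2) ^ ((d : ℝ) / 2) * ε ^ d := by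
    rw [one_pow, mul_one, Real.mul_rpow (by positivity) (by positivity),
      ← Real.rpow_natCast_mul hε.le, ← Real.rpow_natCast ε d, Nat.cast_two,
      mul_div_cancel₀ _ two_ne_zero]
  have hexp : -(ε⁻¹ * ‖x‖) ^ 2 / (2 * 1 ^ 2) = -‖x‖ ^ 2 / (2 * ε ^ 2) := by
    field_simp
  rw [gaussianKernel, gaussianKernel, hnorm, norm_smul, Real.norm_of_nonneg (by positivity), hexp]
  field_simp

theorem gaussianKernel_mul {a b c : ℝ} (ha : 0 < a) (hb : 0 < b) (hc : 0 < c)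
    (habc : c ^ 2 = a ^ 2 + b ^ 2) (x h : Space d) :
    gaussianKernel d a (x - h) * gaussianKernel d b h =
      gaussianKernel d c x * gaussianKernel d (a * b / c) (h - (b ^ 2 / c ^ 2) • x) := by
  unfold gaussianKernel
  rw [div_mul_div_comm, div_mul_div_comm, ← Real.exp_add, ← Real.exp_add,
    ← Real.mul_rpow (by positivity) (by positivity),
    ← Real.mul_rpow (by positivity) (by positivity)]
  congr 2
  · rw [norm_sub_sq_real, norm_sub_sq_real, norm_smul, real_inner_smul_right,
      real_inner_comm x h, mul_pow, Real.norm_eq_abs, sq_abs]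
    have hb2 : b ^ 2 = c ^ 2 - a ^ 2 := by linarith
    have hb4 : b ^ 4 = (c ^ 2 - a ^ 2) ^ 2 := by rw [← hb2]; ring
    field_simp
    ring_nf
    simp only [hb4, hb2]
    ring
  · field_simp

theorem norm_sq_mul_gaussianKernel_le {ε : ℝ} (hε : 0 < ε) (x : Space d) :
    ‖x‖ ^ 2 * gaussianKernel d ε x ≤
      4 * 2 ^ ((d : ℝ) / 2) * ε ^ 2 * gaussianKernel d (√2 * ε) x := by
  set t := ‖x‖ ^ 2 / (4 * ε ^ 2) with ht
  have hnorm : ‖x‖ ^ 2 = 4 * ε ^ 2 * t := by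
    rw [ht]
    field_simp
  have hε0 : gaussianKernel d ε 0 = 2 ^ ((d : ℝ) / 2) * gaussianKernel d (√2 * ε) 0 := by
    rw [gaussianKernel_zero, gaussianKernel_zero, mul_pow, Real.sq_sqrt two_pos.le,
      mul_left_comm (2 * Real.pi), Real.mul_rpow (x := 2) (by positivity) (by positivity)]
    field_simp
  have hexp : Real.exp (-(1 / (2 * ε ^ 2)) * ‖x‖ ^ 2) = Real.exp (-t) * Real.exp (-t) := by
    rw [← Real.exp_add, ht]
    congr 1
    field_simp
    ring
  have hexp' : Real.exp (-(1 / (2 * (√2 * ε) ^ 2)) * ‖x‖ ^ 2) = Real.exp (-t) := by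
    rw [ht, mul_pow, Real.sq_sqrt two_pos.le]
    congr 1
    field_simp
    ring
  have htexp : t * Real.exp (-t) ≤ 1 :=
    (Real.mul_exp_neg_le_exp_neg_one t).trans (Real.exp_le_one_iff.2 (by norm_num))
  have hpos := gaussianKernel_nonneg (d := d) (√2 * ε) 0
  rw [gaussianKernel_eq_const_mul, gaussianKernel_eq_const_mul (√2 * ε), hexp, hexp', hε0]
  calc ‖x‖ ^ 2 * (2 ^ ((d : ℝ) / 2) * gaussianKernel d (√2 * ε) 0 *
        (Real.exp (-t) * Real.exp (-t)))
      = 4 * 2 ^ ((d : ℝ) / 2) * ε ^ 2 * (gaussianKernel d (√2 * ε) 0 * Real.exp (-t)) *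
          (t * Real.exp (-t)) := by
        rw [hnorm]
        ring
    _ ≤ _ := mul_le_of_le_one_right (by positivity) htexp

/-- The Gaussian density `p_ε` with values in `ℝ≥0∞`. -/
def gaussianDensity (d : ℕ) (ε : ℝ) (x : Space d) : ℝ≥0∞ := ENNReal.ofReal (gaussianKernel d ε x)

@[fun_prop]
theorem measurable_gaussianDensity (ε : ℝ) : Measurable (gaussianDensity d ε) :=
  (continuous_gaussianKernel ε).measurable.ennreal_ofReal

theorem gaussianDensity_neg (ε : ℝ) (x : Space d) :
    gaussianDensity d ε (-x) = gaussianDensity d ε x := by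
  rw [gaussianDensity, gaussianKernel_neg, gaussianDensity]

theorem gaussianDensity_pos {ε : ℝ} (hε : 0 < ε) (x : Space d) : 0 < gaussianDensity d ε x :=
  ENNReal.ofReal_pos.2 (gaussianKernel_pos hε x)

theorem gaussianDensity_one_le_one (x : Space d) : gaussianDensity d 1 x ≤ 1 := by
  refine ENNReal.ofReal_le_one.2
    ((gaussianKernel_anti (norm_zero.trans_le (norm_nonneg x))).trans ?_)
  rw [gaussianKernel_zero]
  exact inv_le_one_of_one_le₀
    (Real.one_le_rpow (by linarith [Real.pi_gt_three]) (by positivity))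

theorem tendsto_gaussianDensity_cocompact {ε : ℝ} (hε : 0 < ε) :
    Tendsto (gaussianDensity d ε) (cocompact (Space d)) (𝓝 0) := by
  have hnorm : Tendsto (fun x : Space d => 1 / (2 * ε ^ 2) * ‖x‖ ^ 2) (cocompact _) atTop :=
    ((tendsto_pow_atTop two_ne_zero).comp (tendsto_norm_cocompact_atTop)).const_mul_atTop
      (by positivity)
  have hkernel : Tendsto (gaussianKernel d ε) (cocompact (Space d)) (𝓝 0) := by
    rw [funext (gaussianKernel_eq_const_mul ε)]
    simpa [Function.comp_def] using
      (Real.tendsto_exp_neg_atTop_nhds_zero.comp hnorm).const_mul (gaussianKernel d ε 0)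
  unfold gaussianDensity
  simpa only [ENNReal.ofReal_zero] using ENNReal.tendsto_ofReal hkernel

theorem lintegral_gaussianDensity {ε : ℝ} (hε : 0 < ε) : ∫⁻ x, gaussianDensity d ε x = 1 := by
  unfold gaussianDensity
  rw [← ofReal_integral_eq_lintegral_ofReal (integrable_gaussianKernel hε)
    (.of_forall (gaussianKernel_nonneg ε)), integral_gaussianKernel hε, ENNReal.ofReal_one]

theorem lintegral_gaussianDensity_sub_mul {a b c : ℝ} (ha : 0 < a) (hb : 0 < b) (hc : 0 < c)
    (habc : c ^ 2 = a ^ 2 + b ^ 2) (x : Space d) :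
    ∫⁻ h, gaussianDensity d a (x - h) * gaussianDensity d b h = gaussianDensity d c x := by
  have hprod (h : Space d) : gaussianDensity d a (x - h) * gaussianDensity d b h =
      gaussianDensity d c x * gaussianDensity d (a * b / c) (h - (b ^ 2 / c ^ 2) • x) := by
    simp only [gaussianDensity, ← ENNReal.ofReal_mul (gaussianKernel_nonneg _ _),
      gaussianKernel_mul ha hb hc habc]
  simp_rw [hprod]
  rw [lintegral_const_mul _ (by fun_prop),
    lintegral_sub_right_eq_self (gaussianDensity d (a * b / c)),
    lintegral_gaussianDensity (by positivity), mul_one]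

theorem ofReal_le_gaussianDensity {ε : ℝ} (hε : 0 < ε) {z : Space d} (hz : ‖z‖ ≤ ε) :
    ENNReal.ofReal (Real.exp (1 / 2) * (2 * Real.pi) ^ ((d : ℝ) / 2) * ε ^ d)⁻¹ ≤
      gaussianDensity d ε z := by
  have hpow : (2 * Real.pi * ε ^ 2) ^ ((d : ℝ) / 2) = (2 * Real.pi) ^ ((d : ℝ) / 2) * ε ^ d := by
    rw [Real.mul_rpow (by positivity) (by positivity), ← Real.rpow_natCast_mul hε.le]
    norm_num [mul_div_cancel₀]
  have hexp : Real.exp (-(1 / 2)) ≤ Real.exp (-‖z‖ ^ 2 / (2 * ε ^ 2)) := by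
    rw [Real.exp_le_exp, neg_div, neg_le_neg_iff, div_le_div_iff₀ (by positivity) two_pos]
    linarith [pow_le_pow_left₀ (norm_nonneg z) hz 2]
  refine ENNReal.ofReal_le_ofReal ?_
  rw [gaussianKernel, hpow, mul_assoc, mul_inv, ← Real.exp_neg, ← div_eq_mul_inv]
  gcongr

theorem setLIntegral_closedBall_le {f : Space d → ℝ≥0∞} {b : ℝ≥0∞} {ε : ℝ} (hε : 0 < ε)
    {x : Space d} (h : ∫⁻ y, gaussianDensity d ε (x - y) * f y ≤ b) :
    ∫⁻ y in Metric.closedBall x ε, f y ≤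
      ENNReal.ofReal (Real.exp (1 / 2) * (2 * Real.pi) ^ ((d : ℝ) / 2) * ε ^ d) * b := by
  set c := Real.exp (1 / 2) * (2 * Real.pi) ^ ((d : ℝ) / 2) * ε ^ d
  have hc0 : 0 < c := by positivity
  rw [← ENNReal.div_le_iff' (ENNReal.ofReal_pos.2 hc0).ne' ENNReal.ofReal_ne_top,
    ENNReal.div_eq_inv_mul, ← ENNReal.ofReal_inv_of_pos hc0,
    ← lintegral_const_mul' _ _ ENNReal.ofReal_ne_top]
  calc ∫⁻ y in Metric.closedBall x ε, ENNReal.ofReal c⁻¹ * f y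
      ≤ ∫⁻ y in Metric.closedBall x ε, gaussianDensity d ε (x - y) * f y :=
        setLIntegral_mono' Metric.isClosed_closedBall.measurableSet fun y hy => by
          gcongr
          exact ofReal_le_gaussianDensity hε (by rwa [← dist_eq_norm, ← Metric.mem_closedBall'])
    _ ≤ ∫⁻ y, gaussianDensity d ε (x - y) * f y := setLIntegral_le_lintegral _ _
    _ ≤ b := h

/-- The centred Gaussian probability measure with density `p_ε`. -/
def gaussianMeasure (d : ℕ) (ε : ℝ) : Measure (Space d) :=
  volume.withDensity (gaussianDensity d ε)

theorem isProbabilityMeasure_gaussianMeasure {ε : ℝ} (hε : 0 < ε) :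
    IsProbabilityMeasure (gaussianMeasure d ε) := by
  constructor
  rw [gaussianMeasure, withDensity_apply _ MeasurableSet.univ, setLIntegral_univ,
    lintegral_gaussianDensity hε]

theorem lintegral_gaussianMeasure (ε : ℝ) {F : Space d → ℝ≥0∞} (hF : Measurable F) :
    ∫⁻ h, F h ∂(gaussianMeasure d ε) = ∫⁻ h, gaussianDensity d ε h * F h :=
  lintegral_withDensity_eq_lintegral_mul _ (measurable_gaussianDensity ε) hF

/-- A constant `C` for which `p_ε` has second moment at most `(C ε)²`. -/
def momentConst (d : ℕ) : ℝ := √(4 * 2 ^ ((d : ℝ) / 2))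

theorem momentConst_pos (d : ℕ) : 0 < momentConst d := by
  unfold momentConst
  positivity

theorem norm_sq_mul_gaussianKernel_le_momentConst {ε : ℝ} (hε : 0 < ε) (x : Space d) :
    ‖x‖ ^ 2 * gaussianKernel d ε x ≤
      (momentConst d * ε) ^ 2 * gaussianKernel d (√2 * ε) x := by
  rw [momentConst, mul_pow, Real.sq_sqrt (by positivity)]
  exact norm_sq_mul_gaussianKernel_le hε x

theorem lintegral_enorm_sq_gaussianMeasure_le {ε : ℝ} (hε : 0 < ε) :
    ∫⁻ h, ‖h‖ₑ ^ 2 ∂(gaussianMeasure d ε) ≤ ENNReal.ofReal ((momentConst d * ε) ^ 2) := by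
  have hpointwise (h : Space d) : gaussianDensity d ε h * ‖h‖ₑ ^ 2 ≤
      ENNReal.ofReal ((momentConst d * ε) ^ 2) * gaussianDensity d (√2 * ε) h := by
    rw [gaussianDensity, gaussianDensity, mul_comm, ← ofReal_norm,
      ← ENNReal.ofReal_pow (norm_nonneg _), ← ENNReal.ofReal_mul (by positivity),
      ← ENNReal.ofReal_mul (by positivity)]
    exact ENNReal.ofReal_le_ofReal (norm_sq_mul_gaussianKernel_le_momentConst hε h)
  calc ∫⁻ h, ‖h‖ₑ ^ 2 ∂(gaussianMeasure d ε) = ∫⁻ h, gaussianDensity d ε h * ‖h‖ₑ ^ 2 :=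
        lintegral_gaussianMeasure ε (by fun_prop)
    _ ≤ ∫⁻ h, ENNReal.ofReal ((momentConst d * ε) ^ 2) * gaussianDensity d (√2 * ε) h :=
        lintegral_mono hpointwise
    _ = ENNReal.ofReal ((momentConst d * ε) ^ 2) := by
        rw [lintegral_const_mul _ (measurable_gaussianDensity _),
          lintegral_gaussianDensity (by positivity), mul_one]

end Gaussian

section IsWithin

/-- `a` and `b` differ by at most `η`. -/
def IsWithin (η a b : ℝ≥0∞) : Prop := a ≤ b + η ∧ b ≤ a + η

variable {η η' a b c : ℝ≥0∞}

theorem IsWithin.symm (h : IsWithin η a b) : IsWithin η b a := ⟨h.2, h.1⟩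

theorem IsWithin.mono (h : IsWithin η a b) (hη : η ≤ η') : IsWithin η' a b :=
  ⟨h.1.trans (add_le_add_right hη b), h.2.trans (add_le_add_right hη a)⟩

theorem IsWithin.trans (hab : IsWithin η a b) (hbc : IsWithin η' b c) :
    IsWithin (η + η') a c := by
  constructor
  · calc a ≤ b + η := hab.1
      _ ≤ c + η' + η := by gcongr; exact hbc.1
      _ = c + (η + η') := by ring
  · calc c ≤ b + η' := hbc.2
      _ ≤ a + η + η' := by gcongr; exact hab.2
      _ = a + (η + η') := by ring

theorem isWithin_ofReal_iff {η a b : ℝ} (hη : 0 ≤ η) (ha : 0 ≤ a) (hb : 0 ≤ b) :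
    IsWithin (ENNReal.ofReal η) (ENNReal.ofReal a) (ENNReal.ofReal b) ↔ |a - b| ≤ η := by
  rw [IsWithin, ← ENNReal.ofReal_add hb hη, ← ENNReal.ofReal_add ha hη,
    ENNReal.ofReal_le_ofReal_iff (by positivity), ENNReal.ofReal_le_ofReal_iff (by positivity),
    abs_sub_le_iff, sub_le_iff_le_add', sub_le_iff_le_add']

theorem IsWithin.of_tendsto {ι : Type*} {l : Filter ι} [l.NeBot] {f : ι → ℝ≥0∞}
    (hf : Tendsto f l (𝓝 a)) (h : ∀ᶠ i in l, IsWithin η (f i) b) : IsWithin η a b :=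
  ⟨le_of_tendsto hf (h.mono fun _ hi => hi.1),
    ge_of_tendsto (hf.add_const η) (h.mono fun _ hi => hi.2)⟩

theorem tendsto_of_isWithin {ι : Type*} {l : Filter ι} {f s : ι → ℝ≥0∞} (ha : a ≠ ⊤)
    (hs : Tendsto s l (𝓝 0)) (h : ∀ᶠ i in l, IsWithin (s i) (f i) a) : Tendsto f l (𝓝 a) := by
  have hlower : Tendsto (fun i => a - s i) l (𝓝 a) := by
    simpa only [tsub_zero] using ENNReal.Tendsto.sub tendsto_const_nhds hs (.inl ha)
  have hupper : Tendsto (fun i => a + s i) l (𝓝 a) := by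
    simpa only [add_zero] using tendsto_const_nhds.add hs
  exact tendsto_of_tendsto_of_tendsto_of_le_of_le' hlower hupper
    (h.mono fun _ hi => tsub_le_iff_right.2 hi.2) (h.mono fun _ hi => hi.1)

theorem isWithin_eLpNorm {α : Type*} [MeasurableSpace α] {μ : Measure α} {F G H : α → ℝ≥0∞}
    (hF : Measurable F) (hG : Measurable G) (hH : Measurable H)
    (h : ∀ x, IsWithin (H x) (F x) (G x)) {p : ℝ≥0∞} (hp : 1 ≤ p) :
    IsWithin (eLpNorm H p μ) (eLpNorm F p μ) (eLpNorm G p μ) :=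
  ⟨(eLpNorm_mono_enorm fun x => (h x).1).trans
      (eLpNorm_add_le hG.aestronglyMeasurable hH.aestronglyMeasurable hp),
    (eLpNorm_mono_enorm fun x => (h x).2).trans
      (eLpNorm_add_le hF.aestronglyMeasurable hH.aestronglyMeasurable hp)⟩

end IsWithin

section Weighted

variable {d : ℕ}

theorem eLpNorm_two_sq {α E : Type*} [MeasurableSpace α] [TopologicalSpace E]
    [ContinuousENorm E] (f : α → E) (μ : Measure α) :
    eLpNorm f 2 μ ^ 2 = ∫⁻ x, ‖f x‖ₑ ^ 2 ∂μ := by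
  simpa using eLpNorm_nnreal_pow_eq_lintegral (f := f) (μ := μ) (p := 2) two_ne_zero

theorem lintegral_enorm_sq {α E : Type*} [MeasurableSpace α] {μ : Measure α}
    [NormedAddCommGroup E] (u : Lp E 2 μ) : ∫⁻ x, ‖u x‖ₑ ^ 2 ∂μ = ENNReal.ofReal (‖u‖ ^ 2) := by
  rw [← eLpNorm_two_sq, ENNReal.ofReal_pow (norm_nonneg u), Lp.norm_def,
    ENNReal.ofReal_toReal (Lp.eLpNorm_ne_top u)]

theorem ofReal_sq_eq_enorm_sq (a : ℝ) : ENNReal.ofReal (a ^ 2) = ‖a‖ₑ ^ 2 := by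
  rw [Real.enorm_eq_ofReal_abs, ← ENNReal.ofReal_pow (abs_nonneg a), sq_abs]

theorem measurable_coe (u : L2 d) : Measurable (u : Space d → ℝ) :=
  (Lp.stronglyMeasurable u).measurable

/-- The `L²` norm of `u` with respect to the measure `ρ(x) dx`. -/
def weightedNorm (ρ : Space d → ℝ≥0∞) (u : L2 d) : ℝ≥0∞ := eLpNorm u 2 (volume.withDensity ρ)

theorem weightedNorm_sq {ρ : Space d → ℝ≥0∞} (hρ : Measurable ρ) (u : L2 d) :
    weightedNorm ρ u ^ 2 = ∫⁻ y, ρ y * ‖u y‖ₑ ^ 2 := by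
  rw [weightedNorm, eLpNorm_two_sq]
  exact lintegral_withDensity_eq_lintegral_mul _ hρ ((measurable_coe u).enorm.pow_const 2)

theorem isWithin_weightedNorm_sub (ρ : Space d → ℝ≥0∞) (u v : L2 d) :
    IsWithin (weightedNorm ρ (u - v)) (weightedNorm ρ u) (weightedNorm ρ v) := by
  have hle (u v : L2 d) : weightedNorm ρ u ≤ weightedNorm ρ v + weightedNorm ρ (u - v) := by
    have hsub := (withDensity_absolutelyContinuous volume ρ).ae_le (Lp.coeFn_sub u v)
    unfold weightedNorm
    rw [eLpNorm_congr_ae hsub]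
    simpa only [add_sub_cancel] using eLpNorm_add_le (μ := volume.withDensity ρ)
      (measurable_coe v).aestronglyMeasurable
      ((measurable_coe u).sub (measurable_coe v)).aestronglyMeasurable one_le_two
  have hcomm : weightedNorm ρ (v - u) = weightedNorm ρ (u - v) := by
    have hneg := (withDensity_absolutelyContinuous volume ρ).ae_le (Lp.coeFn_neg (u - v))
    unfold weightedNorm
    rw [← neg_sub u v, eLpNorm_congr_ae hneg, eLpNorm_neg]
  exact ⟨hle u v, hcomm ▸ hle v u⟩

theorem weightedNorm_le {ρ : Space d → ℝ≥0∞} (hρ : Measurable ρ) {S : ℝ} (hS : 0 ≤ S)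
    (hρS : ∀ y, ρ y ≤ ENNReal.ofReal S) (u : L2 d) :
    weightedNorm ρ u ≤ ENNReal.ofReal (√S * ‖u‖) := by
  rw [← ENNReal.pow_le_pow_left_iff two_ne_zero, weightedNorm_sq hρ,
    ← ENNReal.ofReal_pow (by positivity), mul_pow, Real.sq_sqrt hS, ENNReal.ofReal_mul hS,
    ← lintegral_enorm_sq, ← lintegral_const_mul _ ((measurable_coe u).enorm.pow_const 2)]
  exact lintegral_mono fun y => by gcongr; exact hρS y

theorem weightedNorm_translate_sq {ρ : Space d → ℝ≥0∞} (hρ : Measurable ρ) (u : L2 d)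
    (h : Space d) : weightedNorm ρ (translate h u) ^ 2 = ∫⁻ y, ρ y * ‖u (y + h)‖ₑ ^ 2 := by
  rw [weightedNorm_sq hρ]
  refine lintegral_congr_ae ?_
  filter_upwards [coeFn_translate h u] with y hy
  rw [hy]

theorem measurable_weightedNorm_translate {ρ : Space d → ℝ≥0∞} (hρ : Measurable ρ) (u : L2 d) :
    Measurable fun h => weightedNorm ρ (translate h u) := by
  have := measurable_coe u
  have hroot : (fun h => weightedNorm ρ (translate h u)) =
      fun h => (∫⁻ y, ρ y * ‖u (y + h)‖ₑ ^ 2) ^ (2⁻¹ : ℝ) := by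
    ext h
    rw [← weightedNorm_translate_sq hρ, ← ENNReal.rpow_ofNat, ENNReal.rpow_rpow_inv two_ne_zero]
  rw [hroot]
  refine Measurable.pow_const (Measurable.lintegral_prod_right'
    (f := fun p : Space d × Space d => ρ p.2 * ‖u (p.2 + p.1)‖ₑ ^ 2) ?_) _
  fun_prop

/-- The convolution `ρ * p_δ` of a weight with the Gaussian density. -/
def gaussianConv (δ : ℝ) (ρ : Space d → ℝ≥0∞) (y : Space d) : ℝ≥0∞ :=
  ∫⁻ h, ρ (y - h) * gaussianDensity d δ h

theorem measurable_gaussianConv (δ : ℝ) {ρ : Space d → ℝ≥0∞} (hρ : Measurable ρ) :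
    Measurable (gaussianConv δ ρ) :=
  Measurable.lintegral_prod_right'
    (f := fun p : Space d × Space d => ρ (p.1 - p.2) * gaussianDensity d δ p.2) (by fun_prop)

theorem weightedNorm_gaussianConv_sq {ρ : Space d → ℝ≥0∞} (hρ : Measurable ρ) (δ : ℝ)
    (u : L2 d) : weightedNorm (gaussianConv δ ρ) u ^ 2 =
      ∫⁻ h, weightedNorm ρ (translate h u) ^ 2 ∂(gaussianMeasure d δ) := by
  have hu := measurable_coe u
  have hmul (y : Space d) : gaussianConv δ ρ y * ‖u y‖ₑ ^ 2 =
      ∫⁻ h, gaussianDensity d δ h * (ρ (y - h) * ‖u y‖ₑ ^ 2) := by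
    rw [gaussianConv, ← lintegral_mul_const _ (by fun_prop)]
    exact lintegral_congr fun h => by ring
  rw [weightedNorm_sq (measurable_gaussianConv δ hρ),
    lintegral_gaussianMeasure _ ((measurable_weightedNorm_translate hρ u).pow_const 2)]
  simp_rw [weightedNorm_translate_sq hρ, hmul]
  rw [lintegral_lintegral_swap (by fun_prop)]
  refine lintegral_congr fun h => ?_
  rw [lintegral_const_mul _ (by fun_prop),
    ← lintegral_add_right_eq_self (fun y => ρ (y - h) * ‖u y‖ₑ ^ 2) h]
  simp only [add_sub_cancel_right]

theorem weightedNorm_gaussianConv {ρ : Space d → ℝ≥0∞} (hρ : Measurable ρ) (δ : ℝ) (u : L2 d) :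
    weightedNorm (gaussianConv δ ρ) u =
      eLpNorm (fun h => weightedNorm ρ (translate h u)) 2 (gaussianMeasure d δ) := by
  rw [← (ENNReal.pow_right_strictMono two_ne_zero).injective.eq_iff,
    weightedNorm_gaussianConv_sq hρ, eLpNorm_two_sq]
  simp only [enorm_eq_self]

theorem HasGrad.weightedNorm_translate_sub_le {ρ : Space d → ℝ≥0∞} (hρ : Measurable ρ) {S : ℝ}
    (hS : 0 ≤ S) (hρS : ∀ y, ρ y ≤ ENNReal.ofReal S) {u : L2 d} {g : VectorL2 d}
    (hu : HasGrad u g) (h : Space d) :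
    weightedNorm ρ (PAM.translate h u - u) ≤ ENNReal.ofReal (√S * ‖g‖) * ‖h‖ₑ := by
  refine (weightedNorm_le hρ hS hρS _).trans ?_
  rw [← ofReal_norm, ← ENNReal.ofReal_mul (by positivity), mul_assoc, mul_comm ‖g‖]
  exact ENNReal.ofReal_le_ofReal (by gcongr; exact hu.norm_translate_sub_le h)

theorem eLpNorm_mul_enorm_gaussianMeasure_le {δ : ℝ} (hδ : 0 < δ) {c : ℝ} (hc : 0 ≤ c) :
    eLpNorm (fun h => ENNReal.ofReal c * ‖h‖ₑ) 2 (gaussianMeasure d δ) ≤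
      ENNReal.ofReal (c * (momentConst d * δ)) := by
  have hmoment := momentConst_pos d
  rw [← ENNReal.pow_le_pow_left_iff two_ne_zero, eLpNorm_two_sq]
  simp only [enorm_eq_self, mul_pow]
  rw [lintegral_const_mul _ (by fun_prop), ENNReal.ofReal_mul hc, mul_pow]
  gcongr
  rw [← ENNReal.ofReal_pow (by positivity)]
  exact lintegral_enorm_sq_gaussianMeasure_le hδ

theorem HasGrad.isWithin_weightedNorm_gaussianConv {ρ : Space d → ℝ≥0∞} (hρ : Measurable ρ)
    {S : ℝ} (hS : 0 ≤ S) (hρS : ∀ y, ρ y ≤ ENNReal.ofReal S) {δ : ℝ} (hδ : 0 < δ) {u : L2 d}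
    {g : VectorL2 d} (hu : HasGrad u g) :
    IsWithin (ENNReal.ofReal (√S * ‖g‖ * (momentConst d * δ)))
      (weightedNorm (gaussianConv δ ρ) u) (weightedNorm ρ u) := by
  have := isProbabilityMeasure_gaussianMeasure (d := d) hδ
  have hconst : eLpNorm (fun _ => weightedNorm ρ u) 2 (gaussianMeasure d δ) =
      weightedNorm ρ u := by
    simp [eLpNorm_const']
  rw [weightedNorm_gaussianConv hρ, ← hconst]
  refine (isWithin_eLpNorm (measurable_weightedNorm_translate hρ u) measurable_const
    (measurable_enorm.const_mul _) (fun h => ?_) one_le_two).mono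
    (eLpNorm_mul_enorm_gaussianMeasure_le hδ (by positivity))
  exact (isWithin_weightedNorm_sub ρ _ u).mono (hu.weightedNorm_translate_sub_le hρ hS hρS h)

theorem abs_sub_le_of_le_two_pow_mul {f : ℝ → ℝ} {θ D : ℝ} (hθ : 0 < θ) (hD : 0 ≤ D)
    (h : ∀ ε ε', 0 < ε → ε ≤ ε' → ε' ≤ 2 * ε → |f ε - f ε'| ≤ D * ε ^ θ) {ε : ℝ} (hε : 0 < ε)
    (k : ℕ) : ∀ r, ε ≤ r → r ≤ 2 ^ k * ε → |f ε - f r| ≤ D / (1 - 2 ^ (-θ)) * r ^ θ := by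
  -- the increments over `[r / 2, r]`, `[r / 4, r / 2]`, … form a geometric series of ratio `q`
  set q : ℝ := 2 ^ (-θ) with hq
  have hq1 : 0 < 1 - q :=
    sub_pos.2 (Real.rpow_lt_one_of_one_lt_of_neg one_lt_two (neg_lt_zero.2 hθ))
  have hq0 : 0 < q := by positivity
  have hhalf {r : ℝ} (hr : 0 ≤ r) : (r / 2) ^ θ = q * r ^ θ := by
    rw [Real.div_rpow hr two_pos.le, hq, Real.rpow_neg two_pos.le, div_eq_inv_mul]
  have hgeom : D / (1 - q) * q + D * q ≤ D / (1 - q) := by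
    have hsum : D / (1 - q) = D / (1 - q) * q + D := by
      field_simp
      ring
    nlinarith
  induction k with
  | zero =>
    intro r hr hr'
    rw [le_antisymm (by simpa using hr') hr, sub_self, abs_zero]
    positivity
  | succ k ih =>
    intro r hr hr'
    rcases le_total r (2 * ε) with hr2 | hr2
    · calc |f ε - f r| ≤ D * ε ^ θ := h ε r hε hr hr2
        _ ≤ D / (1 - q) * r ^ θ := by
          gcongr
          exact le_div_self hD hq1 (by linarith)
    · calc |f ε - f r| ≤ |f ε - f (r / 2)| + |f (r / 2) - f r| := abs_sub_le _ _ _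
        _ ≤ D / (1 - q) * (r / 2) ^ θ + D * (r / 2) ^ θ :=
          add_le_add (ih (r / 2) (by linarith) (by rw [pow_succ] at hr'; linarith))
            (h (r / 2) r (by linarith) (by linarith) (by linarith))
        _ = (D / (1 - q) * q + D * q) * r ^ θ := by
          rw [hhalf (by linarith)]
          ring
        _ ≤ D / (1 - q) * r ^ θ :=
          mul_le_mul_of_nonneg_right hgeom (Real.rpow_nonneg (by linarith) θ)

theorem abs_sub_le_of_abs_sub_le_of_le_two_mul {f : ℝ → ℝ} {θ D : ℝ} (hθ : 0 < θ) (hD : 0 ≤ D)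
    (h : ∀ ε ε', 0 < ε → ε ≤ ε' → ε' ≤ 2 * ε → |f ε - f ε'| ≤ D * ε ^ θ) {ε r : ℝ} (hε : 0 < ε)
    (hr : ε ≤ r) : |f ε - f r| ≤ D / (1 - 2 ^ (-θ)) * r ^ θ := by
  obtain ⟨k, hk⟩ := pow_unbounded_of_one_lt (r / ε) one_lt_two
  exact abs_sub_le_of_le_two_pow_mul hθ hD h hε k r hr ((div_lt_iff₀ hε).1 hk).le

end Weighted

section Interaction

variable {d : ℕ}

theorem mollifiedKernel_eq (γ : Measure (Space d)) (ε : ℝ) (x : Space d) :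
    mollifiedKernel γ ε x = ∫⁻ y, gaussianDensity d ε (x - y) ∂γ := rfl

theorem measurable_mollifiedKernel (γ : Measure (Space d)) [SFinite γ] (ε : ℝ) :
    Measurable (mollifiedKernel γ ε) :=
  Measurable.lintegral_prod_right'
    (f := fun p : Space d × Space d => gaussianDensity d ε (p.1 - p.2)) (by fun_prop)

theorem measurable_mollifiedKernel_sub (γ : Measure (Space d)) [SFinite γ] (ε : ℝ) (x : Space d) :
    Measurable fun y => mollifiedKernel γ ε (x - y) :=
  (measurable_mollifiedKernel γ ε).comp (measurable_const.sub measurable_id)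

instance sfinite_mollifiedCov (γ : Measure (Space d)) [SFinite γ] (ε : ℝ) :
    SFinite (mollifiedCov γ ε) :=
  inferInstanceAs (SFinite (volume.withDensity _))

theorem gaussianConv_mollifiedKernel (γ : Measure (Space d)) [SFinite γ] {a b c : ℝ} (ha : 0 < a)
    (hb : 0 < b) (hc : 0 < c) (habc : c ^ 2 = a ^ 2 + b ^ 2) (x : Space d) :
    gaussianConv b (fun y => mollifiedKernel γ a (x - y)) =
      fun y => mollifiedKernel γ c (x - y) := by
  ext y
  have hmul (h : Space d) : mollifiedKernel γ a (x - (y - h)) * gaussianDensity d b h =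
      ∫⁻ z, gaussianDensity d a (x - (y - h) - z) * gaussianDensity d b h ∂γ := by
    rw [mollifiedKernel_eq, lintegral_mul_const _ (by fun_prop)]
  simp_rw [gaussianConv, hmul]
  rw [lintegral_lintegral_swap (by fun_prop)]
  refine lintegral_congr fun z => ?_
  rw [← gaussianDensity, ← lintegral_gaussianDensity_sub_mul ha hb hc habc,
    ← lintegral_neg_eq_self]
  refine lintegral_congr fun h => ?_
  rw [gaussianDensity_neg]
  congr 2
  abel

/-- The potential `μ * f²` generated by `f²`. -/
def potential (μ : Measure (Space d)) (f : Space d → ℝ) (x : Space d) : ℝ≥0∞ :=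
  ∫⁻ z, ‖f (x - z)‖ₑ ^ 2 ∂μ

theorem interaction_eq (μ : Measure (Space d)) (f : Space d → ℝ) :
    interaction μ f = 2⁻¹ * ∫⁻ x, ‖f x‖ₑ ^ 2 * potential μ f x := by
  simp only [interaction, potential, ofReal_sq_eq_enorm_sq]

theorem measurable_potential (μ : Measure (Space d)) [SFinite μ] {f : Space d → ℝ}
    (hf : Measurable f) : Measurable (potential μ f) :=
  Measurable.lintegral_prod_right'
    (f := fun p : Space d × Space d => ‖f (p.1 - p.2)‖ₑ ^ 2) (by fun_prop)

theorem interaction_congr_ae (μ : Measure (Space d)) [SFinite μ] {f f' : Space d → ℝ}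
    (h : f =ᵐ[volume] f') : interaction μ f = interaction μ f' := by
  have hsub : ∀ᵐ x : Space d, ∀ᵐ z ∂μ, f (x - z) = f' (x - z) :=
    Measure.ae_ae_of_ae_prod
      ((quasiMeasurePreserving_sub_of_right_invariant volume μ).ae h)
  rw [interaction_eq, interaction_eq]
  congr 1
  refine lintegral_congr_ae ?_
  filter_upwards [h, hsub] with x hx hxz
  rw [hx]
  congr 1
  exact lintegral_congr_ae (hxz.mono fun z hz => by simp only [hz])

theorem interaction_comp_add_right (μ : Measure (Space d)) (f : Space d → ℝ) (h : Space d) :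
    interaction μ (fun x => f (x + h)) = interaction μ f := by
  rw [interaction_eq, interaction_eq,
    ← lintegral_add_right_eq_self (fun x => ‖f x‖ₑ ^ 2 * potential μ f x) h]
  simp only [potential, sub_add_eq_add_sub]

theorem interaction_translate (μ : Measure (Space d)) [SFinite μ] (u : L2 d) (h : Space d) :
    interaction μ (translate h u : L2 d) = interaction μ u := by
  rw [interaction_congr_ae μ (coeFn_translate h u), interaction_comp_add_right μ u h]

theorem potential_withDensity {k : Space d → ℝ≥0∞} (hk : Measurable k) (u : L2 d) (x : Space d) :
    potential (volume.withDensity k) u x = weightedNorm (fun y => k (x - y)) u ^ 2 := by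
  have := measurable_coe u
  rw [weightedNorm_sq (by fun_prop), potential,
    lintegral_withDensity_eq_lintegral_mul _ hk (by fun_prop), ← lintegral_sub_left_eq_self _ x]
  simp only [Pi.mul_apply, sub_sub_cancel]

theorem half_lintegral_const_mul_enorm_sq {c : ℝ} (hc : 0 ≤ c) (u : L2 d) :
    2⁻¹ * ∫⁻ x, ENNReal.ofReal c * ‖u x‖ₑ ^ 2 = ENNReal.ofReal (c * ‖u‖ ^ 2 / 2) := by
  rw [lintegral_const_mul _ ((measurable_coe u).enorm.pow_const 2), lintegral_enorm_sq,
    ← ENNReal.ofReal_mul hc, ENNReal.ofReal_div_of_pos two_pos, ENNReal.ofReal_ofNat,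
    ENNReal.div_eq_inv_mul]

theorem interaction_le_of_potential_le (μ : Measure (Space d)) (u : L2 d) {c : ℝ} (hc : 0 ≤ c)
    (h : ∀ᵐ x, potential μ u x ≤ ENNReal.ofReal c) :
    interaction μ u ≤ ENNReal.ofReal (c * ‖u‖ ^ 2 / 2) := by
  rw [interaction_eq, ← half_lintegral_const_mul_enorm_sq hc]
  refine mul_le_mul_right (lintegral_mono_ae (h.mono fun x hx => ?_)) _
  rw [mul_comm (ENNReal.ofReal c)]
  gcongr

theorem isWithin_interaction (μ ν : Measure (Space d)) (u : L2 d) {c : ℝ} (hc : 0 ≤ c)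
    (h : ∀ x, IsWithin (ENNReal.ofReal c) (potential μ u x) (potential ν u x)) :
    IsWithin (ENNReal.ofReal (c * ‖u‖ ^ 2 / 2)) (interaction μ u) (interaction ν u) := by
  have hle {μ ν : Measure (Space d)}
      (h : ∀ x, potential μ u x ≤ potential ν u x + ENNReal.ofReal c) :
      interaction μ u ≤ interaction ν u + ENNReal.ofReal (c * ‖u‖ ^ 2 / 2) := by
    have := measurable_coe u
    rw [interaction_eq, interaction_eq, ← half_lintegral_const_mul_enorm_sq hc, ← mul_add,
      ← lintegral_add_right _ (by fun_prop)]
    gcongr with x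
    rw [mul_comm (ENNReal.ofReal c), ← mul_add]
    gcongr
    exact h x
  exact ⟨hle fun x => (h x).1, hle fun x => (h x).2⟩

end Interaction

section Regular

variable {d : ℕ}

/-- The properties of the covariance measure `γ` used in the analysis of the variational problems:
its mollifications are of order `ε^{-w}`, with `0 < w < 2`, and vanish at infinity. -/
structure RegularCov (γ : Measure (Space d)) (w A : ℝ) : Prop where
  w_pos : 0 < w
  w_lt : w < 2
  A_pos : 0 < A
  bound : ∀ ε x, 0 < ε → mollifiedKernel γ ε x ≤ ENNReal.ofReal (A * ε ^ (-w))
  decay : ∀ ε, 0 < ε → Tendsto (mollifiedKernel γ ε) (cocompact (Space d)) (𝓝 0)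
  lower : ∃ a : ℝ, 0 < a ∧ ∀ ε, 0 < ε → ENNReal.ofReal (a * ε ^ (-w)) ≤ mollifiedKernel γ ε 0

/-- The square root of the potential `(γ_ε * u²)(x)`. It is the `L²` norm of `u` for the weight
`γ_ε(x - ·)`, and is studied as a function of the scale `ε`. -/
def potentialNorm (γ : Measure (Space d)) (x : Space d) (u : L2 d) (ε : ℝ) : ℝ :=
  (weightedNorm (fun y => mollifiedKernel γ ε (x - y)) u).toReal

theorem potentialNorm_nonneg (γ : Measure (Space d)) (x : Space d) (u : L2 d) (ε : ℝ) :
    0 ≤ potentialNorm γ x u ε :=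
  ENNReal.toReal_nonneg

/-- The constant in the Hölder estimate, of exponent `1 - w / 2`, of `potentialNorm` in the
scale. -/
def holderConst (d : ℕ) (w A : ℝ) : ℝ :=
  2 * momentConst d * √A / (1 - 2 ^ (-(1 - w / 2)))

/-- The constant in the Hölder estimate, of exponent `1 - w / 2`, of the interaction in the scale,
for functions whose `L²` norm and gradient norm are at most `R`. -/
def oscConst (d : ℕ) (w A R : ℝ) : ℝ :=
  (√A * R + holderConst d w A * R) * (holderConst d w A * R) * R ^ 2

theorem tendsto_const_mul_rpow (C : ℝ) {θ : ℝ} (hθ : 0 < θ) :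
    Tendsto (fun r : ℝ => C * r ^ θ) (𝓝[>] 0) (𝓝 0) := by
  have hcont : ContinuousAt (fun r : ℝ => C * r ^ θ) 0 :=
    (Real.continuousAt_rpow_const _ _ (.inr hθ.le)).const_mul C
  simpa only [Real.zero_rpow hθ.ne', mul_zero] using hcont.tendsto.mono_left nhdsWithin_le_nhds

theorem exists_mul_rpow_le (C : ℝ) {θ η : ℝ} (hθ : 0 < θ) (hη : 0 < η) :
    ∃ r : ℝ, 0 < r ∧ r ≤ 1 ∧ C * r ^ θ ≤ η := by
  obtain ⟨r, hrη, hr⟩ := (((tendsto_const_mul_rpow C hθ).eventually (ge_mem_nhds hη)).and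
    (Ioc_mem_nhdsGT one_pos)).exists
  exact ⟨r, hr.1, hr.2, hrη⟩

namespace RegularCov

variable {γ : Measure (Space d)} {w A : ℝ}

theorem holderConst_nonneg (hγ : RegularCov γ w A) : 0 ≤ holderConst d w A := by
  have hmoment := momentConst_pos d
  have hratio : (2 : ℝ) ^ (-(1 - w / 2)) < 1 :=
    Real.rpow_lt_one_of_one_lt_of_neg one_lt_two (by linarith [hγ.w_lt])
  exact div_nonneg (by positivity) (sub_nonneg.2 hratio.le)

theorem oscConst_nonneg (hγ : RegularCov γ w A) {R : ℝ} (hR : 0 ≤ R) : 0 ≤ oscConst d w A R := by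
  have hH := hγ.holderConst_nonneg
  unfold oscConst
  positivity

variable [SFinite γ]

theorem weightedNorm_le (hγ : RegularCov γ w A) {ε : ℝ} (hε : 0 < ε) (x : Space d) (u : L2 d) :
    weightedNorm (fun y => mollifiedKernel γ ε (x - y)) u ≤
      ENNReal.ofReal (√(A * ε ^ (-w)) * ‖u‖) :=
  PAM.weightedNorm_le (measurable_mollifiedKernel_sub γ ε x)
    (mul_nonneg hγ.A_pos.le (Real.rpow_nonneg hε.le _)) (fun _ => hγ.bound ε _ hε) u

theorem ofReal_potentialNorm (hγ : RegularCov γ w A) {ε : ℝ} (hε : 0 < ε) (x : Space d)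
    (u : L2 d) : ENNReal.ofReal (potentialNorm γ x u ε) =
      weightedNorm (fun y => mollifiedKernel γ ε (x - y)) u :=
  ENNReal.ofReal_toReal ((hγ.weightedNorm_le hε x u).trans_lt ENNReal.ofReal_lt_top).ne

theorem potentialNorm_le (hγ : RegularCov γ w A) {ε : ℝ} (hε : 0 < ε) (x : Space d) (u : L2 d) :
    potentialNorm γ x u ε ≤ √(A * ε ^ (-w)) * ‖u‖ :=
  ENNReal.toReal_le_of_le_ofReal (by positivity) (hγ.weightedNorm_le hε x u)

theorem potential_mollifiedCov (hγ : RegularCov γ w A) {ε : ℝ} (hε : 0 < ε) (x : Space d)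
    (u : L2 d) : potential (mollifiedCov γ ε) u x = ENNReal.ofReal (potentialNorm γ x u ε ^ 2) := by
  rw [mollifiedCov, potential_withDensity (measurable_mollifiedKernel γ ε),
    ENNReal.ofReal_pow (potentialNorm_nonneg γ x u ε), hγ.ofReal_potentialNorm hε]

theorem abs_potentialNorm_sub_le_of_le_two_mul (hγ : RegularCov γ w A) {u : L2 d}
    {g : VectorL2 d} (hu : HasGrad u g) (x : Space d) {ε ε' : ℝ} (hε : 0 < ε) (hle : ε ≤ ε')
    (hle2 : ε' ≤ 2 * ε) :
    |potentialNorm γ x u ε - potentialNorm γ x u ε'| ≤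
      2 * momentConst d * √A * ‖g‖ * ε ^ (1 - w / 2) := by
  have hA := hγ.A_pos
  have hmoment := momentConst_pos d
  rcases eq_or_lt_of_le hle with rfl | hlt
  · rw [sub_self, abs_zero]
    positivity
  have hε' : 0 < ε' := hε.trans hlt
  -- `γ_{ε'} = γ_ε * p_δ`
  set δ := √(ε' ^ 2 - ε ^ 2)
  have hδ : 0 < δ := Real.sqrt_pos.2 (by nlinarith)
  have hδ_sq : δ ^ 2 = ε' ^ 2 - ε ^ 2 := Real.sq_sqrt (by nlinarith)
  have hδ_le : δ ≤ 2 * ε := by nlinarith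
  have hwithin := hu.isWithin_weightedNorm_gaussianConv (measurable_mollifiedKernel_sub γ ε x)
    (by positivity) (fun y => hγ.bound ε _ hε) hδ
  rw [gaussianConv_mollifiedKernel γ hε hδ hε' (by linarith), ← hγ.ofReal_potentialNorm hε,
    ← hγ.ofReal_potentialNorm hε', isWithin_ofReal_iff (by positivity)
    (potentialNorm_nonneg γ x u ε') (potentialNorm_nonneg γ x u ε), abs_sub_comm] at hwithin
  have hpow : √(A * ε ^ (-w)) * ε = √A * ε ^ (1 - w / 2) := by
    rw [Real.sqrt_mul hA.le, mul_assoc, Real.sqrt_eq_rpow (ε ^ (-w)), ← Real.rpow_mul hε.le,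
      ← Real.rpow_add_one hε.ne']
    ring_nf
  calc |potentialNorm γ x u ε - potentialNorm γ x u ε'|
      ≤ √(A * ε ^ (-w)) * ‖g‖ * (momentConst d * δ) := hwithin
    _ ≤ √(A * ε ^ (-w)) * ‖g‖ * (momentConst d * (2 * ε)) := by gcongr
    _ = √(A * ε ^ (-w)) * ε * (2 * momentConst d * ‖g‖) := by ring
    _ = 2 * momentConst d * √A * ‖g‖ * ε ^ (1 - w / 2) := by
      rw [hpow]
      ring

theorem abs_potentialNorm_sub_le (hγ : RegularCov γ w A) {u : L2 d} {g : VectorL2 d}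
    (hu : HasGrad u g) (x : Space d) {ε r : ℝ} (hε : 0 < ε) (hr : ε ≤ r) :
    |potentialNorm γ x u ε - potentialNorm γ x u r| ≤
      holderConst d w A * ‖g‖ * r ^ (1 - w / 2) := by
  have hmoment := momentConst_pos d
  refine (abs_sub_le_of_abs_sub_le_of_le_two_mul (by linarith [hγ.w_lt]) (by positivity)
    (fun ε ε' hε hle hle2 => hγ.abs_potentialNorm_sub_le_of_le_two_mul hu x hε hle hle2)
    hε hr).trans_eq ?_
  unfold holderConst
  ring

theorem potentialNorm_le_of_le_one (hγ : RegularCov γ w A) {u : L2 d} {g : VectorL2 d}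
    (hu : HasGrad u g) (x : Space d) {ε : ℝ} (hε : 0 < ε) (hε1 : ε ≤ 1) :
    potentialNorm γ x u ε ≤ √A * ‖u‖ + holderConst d w A * ‖g‖ := by
  have hosc := hγ.abs_potentialNorm_sub_le hu x hε hε1
  have hone := hγ.potentialNorm_le one_pos x u
  simp only [Real.one_rpow, mul_one] at hosc hone
  linarith [(abs_le.1 hosc).2]

theorem isWithin_potential_mollifiedCov (hγ : RegularCov γ w A) {u : L2 d} {g : VectorL2 d}
    (hu : HasGrad u g) {R : ℝ} (huR : ‖u‖ ≤ R) (hgR : ‖g‖ ≤ R) {ε r : ℝ} (hε : 0 < ε)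
    (hr : ε ≤ r) (hr1 : r ≤ 1) (x : Space d) :
    IsWithin (ENNReal.ofReal (2 * (√A * R + holderConst d w A * R) * (holderConst d w A * R) *
        r ^ (1 - w / 2)))
      (potential (mollifiedCov γ ε) u x) (potential (mollifiedCov γ r) u x) := by
  have hH := hγ.holderConst_nonneg
  have hR : 0 ≤ R := (norm_nonneg u).trans huR
  have hr0 : 0 < r := hε.trans_le hr
  rw [hγ.potential_mollifiedCov hε, hγ.potential_mollifiedCov hr0,
    isWithin_ofReal_iff (by positivity) (sq_nonneg _) (sq_nonneg _)]
  set B := √A * R + holderConst d w A * R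
  have hB {s : ℝ} (hs : 0 < s) (hs1 : s ≤ 1) : potentialNorm γ x u s ≤ B :=
    (hγ.potentialNorm_le_of_le_one hu x hs hs1).trans (by unfold B; gcongr)
  have hosc : |potentialNorm γ x u ε - potentialNorm γ x u r| ≤
      holderConst d w A * R * r ^ (1 - w / 2) :=
    (hγ.abs_potentialNorm_sub_le hu x hε hr).trans (by gcongr)
  calc |potentialNorm γ x u ε ^ 2 - potentialNorm γ x u r ^ 2|
      = (potentialNorm γ x u ε + potentialNorm γ x u r) *
          |potentialNorm γ x u ε - potentialNorm γ x u r| := by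
        rw [sq_sub_sq, abs_mul, abs_of_nonneg
          (add_nonneg (potentialNorm_nonneg γ x u ε) (potentialNorm_nonneg γ x u r))]
    _ ≤ (B + B) * (holderConst d w A * R * r ^ (1 - w / 2)) := by
        gcongr
        exacts [hB hε (hr.trans hr1), hB hr0 hr1]
    _ = 2 * B * (holderConst d w A * R) * r ^ (1 - w / 2) := by ring

theorem isWithin_interaction_mollifiedCov (hγ : RegularCov γ w A) {u : L2 d} {g : VectorL2 d}
    (hu : HasGrad u g) {R : ℝ} (huR : ‖u‖ ≤ R) (hgR : ‖g‖ ≤ R) {ε r : ℝ} (hε : 0 < ε)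
    (hr : ε ≤ r) (hr1 : r ≤ 1) :
    IsWithin (ENNReal.ofReal (oscConst d w A R * r ^ (1 - w / 2)))
      (interaction (mollifiedCov γ ε) u) (interaction (mollifiedCov γ r) u) := by
  have hH := hγ.holderConst_nonneg
  have hR : 0 ≤ R := (norm_nonneg u).trans huR
  have hr0 : 0 < r := hε.trans_le hr
  refine (isWithin_interaction _ _ u (by positivity)
    (hγ.isWithin_potential_mollifiedCov hu huR hgR hε hr hr1)).mono (ENNReal.ofReal_le_ofReal ?_)
  calc _ ≤ 2 * (√A * R + holderConst d w A * R) * (holderConst d w A * R) * r ^ (1 - w / 2) *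
        R ^ 2 / 2 := by gcongr
    _ = oscConst d w A R * r ^ (1 - w / 2) := by
      unfold oscConst
      ring

theorem potentialNorm_sq_le_of_le (hγ : RegularCov γ w A) {u : L2 d} {g : VectorL2 d}
    (hu : HasGrad u g) (x : Space d) {ε r : ℝ} (hε : 0 < ε) (hr : ε ≤ r) :
    potentialNorm γ x u ε ^ 2 ≤
      2 * (A * r ^ (-w)) * ‖u‖ ^ 2 + 2 * holderConst d w A ^ 2 * r ^ (2 - w) * ‖g‖ ^ 2 := by
  have hr0 : 0 < r := hε.trans_le hr
  have hosc := (abs_le.1 (hγ.abs_potentialNorm_sub_le hu x hε hr)).2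
  have hcoarse := hγ.potentialNorm_le hr0 x u
  have hpow : (r ^ (1 - w / 2)) ^ 2 = r ^ (2 - w) := by
    rw [← Real.rpow_mul_natCast hr0.le]
    ring_nf
  have hsqrt : √(A * r ^ (-w)) ^ 2 = A * r ^ (-w) :=
    Real.sq_sqrt (mul_nonneg hγ.A_pos.le (Real.rpow_nonneg hr0.le _))
  calc potentialNorm γ x u ε ^ 2
      ≤ (√(A * r ^ (-w)) * ‖u‖ + holderConst d w A * ‖g‖ * r ^ (1 - w / 2)) ^ 2 :=
        pow_le_pow_left₀ (potentialNorm_nonneg γ x u ε) (by linarith) 2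
    _ ≤ 2 * ((√(A * r ^ (-w)) * ‖u‖) ^ 2 +
          (holderConst d w A * ‖g‖ * r ^ (1 - w / 2)) ^ 2) := add_sq_le
    _ = 2 * √(A * r ^ (-w)) ^ 2 * ‖u‖ ^ 2 +
          2 * holderConst d w A ^ 2 * (r ^ (1 - w / 2)) ^ 2 * ‖g‖ ^ 2 := by ring
    _ = _ := by rw [hpow, hsqrt]

theorem exists_potentialNorm_sq_le (hγ : RegularCov γ w A) {τ : ℝ} (hτ : 0 < τ) :
    ∃ C : ℝ, 0 ≤ C ∧ ∀ (u : L2 d) (g : VectorL2 d), HasGrad u g → ∀ ε x, 0 < ε →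
      potentialNorm γ x u ε ^ 2 ≤ C * ‖u‖ ^ 2 + τ * ‖g‖ ^ 2 := by
  obtain ⟨r, hr, -, hrτ⟩ :=
    exists_mul_rpow_le (2 * holderConst d w A ^ 2) (θ := 2 - w) (by linarith [hγ.w_lt]) hτ
  have hr_pow : 0 ≤ A * r ^ (-w) := mul_nonneg hγ.A_pos.le (Real.rpow_nonneg hr.le _)
  refine ⟨2 * (A * r ^ (-w)), by positivity, fun u g hu ε x hε => ?_⟩
  rcases le_total ε r with hle | hle
  · exact (hγ.potentialNorm_sq_le_of_le hu x hε hle).trans (by gcongr)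
  · calc potentialNorm γ x u ε ^ 2 ≤ (√(A * ε ^ (-w)) * ‖u‖) ^ 2 :=
          pow_le_pow_left₀ (potentialNorm_nonneg γ x u ε) (hγ.potentialNorm_le hε x u) 2
      _ = A * ε ^ (-w) * ‖u‖ ^ 2 := by
          rw [mul_pow, Real.sq_sqrt (mul_nonneg hγ.A_pos.le (Real.rpow_nonneg hε.le _))]
      _ ≤ A * r ^ (-w) * ‖u‖ ^ 2 := by
          gcongr A * ?_ * ‖u‖ ^ 2
          exacts [hγ.A_pos.le, Real.rpow_le_rpow_of_nonpos hr hle (by linarith [hγ.w_pos])]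
      _ ≤ 2 * (A * r ^ (-w)) * ‖u‖ ^ 2 + τ * ‖g‖ ^ 2 := by
          nlinarith [mul_nonneg hr_pow (sq_nonneg ‖u‖), mul_nonneg hτ.le (sq_nonneg ‖g‖)]

end RegularCov

end Regular

section ZeroScale

theorem ae_le_of_setLIntegral_closedBall_le {α : Type*} [MetricSpace α] [MeasurableSpace α]
    [BorelSpace α] [ProperSpace α] [HasBesicovitchCovering α] {μ : Measure α}
    [IsLocallyFiniteMeasure μ] [μ.IsOpenPosMeasure] {f : α → ℝ≥0∞} (hf : Measurable f)
    {c : ℝ≥0∞} (hc : c ≠ ⊤)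
    (h : ∀ x r, 0 < r → r ≤ 1 →
      ∫⁻ y in Metric.closedBall x r, f y ∂μ ≤ c * μ (Metric.closedBall x r)) :
    ∀ᵐ x ∂μ, f x ≤ c := by
  have hball (x : α) (r : ℝ) : μ.withDensity f (Metric.closedBall x r) =
      ∫⁻ y in Metric.closedBall x r, f y ∂μ :=
    withDensity_apply f Metric.isClosed_closedBall.measurableSet
  have hfinite (x : α) (r : ℝ) : μ (Metric.closedBall x r) < ⊤ :=
    (isCompact_closedBall x r).measure_lt_top
  have : IsLocallyFiniteMeasure (μ.withDensity f) :=
    ⟨fun x => ⟨Metric.closedBall x 1, Metric.closedBall_mem_nhds x one_pos, by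
      rw [hball]
      exact (h x 1 one_pos le_rfl).trans_lt (ENNReal.mul_lt_top hc.lt_top (hfinite x 1))⟩⟩
  filter_upwards [Besicovitch.ae_tendsto_rnDeriv (μ.withDensity f) μ,
    Measure.rnDeriv_withDensity μ hf] with x hx hfx
  rw [← hfx]
  refine le_of_tendsto hx ?_
  filter_upwards [Ioc_mem_nhdsGT one_pos] with r hr
  rw [hball, ENNReal.div_le_iff (Metric.measure_closedBall_pos μ x hr.1).ne' (hfinite x r).ne]
  exact h x r hr.1 hr.2

variable {d : ℕ}

theorem exists_ae_le_of_lintegral_gaussianDensity_mul_le {f : Space d → ℝ≥0∞} (hf : Measurable f)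
    {b : ℝ≥0∞} (hb : b ≠ ⊤)
    (h : ∀ x ε, 0 < ε → ε ≤ 1 → ∫⁻ y, gaussianDensity d ε (x - y) * f y ≤ b) :
    ∃ c : NNReal, ∀ᵐ x, f x ≤ c := by
  set v := volume (Metric.ball (0 : Space d) 1)
  have hv : v ≠ 0 := (Metric.measure_ball_pos _ _ one_pos).ne'
  set K := Real.exp (1 / 2) * (2 * Real.pi) ^ ((d : ℝ) / 2)
  have hfinite : ENNReal.ofReal K * b / v ≠ ⊤ :=
    ENNReal.div_ne_top (ENNReal.mul_ne_top ENNReal.ofReal_ne_top hb) hv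
  lift ENNReal.ofReal K * b / v to NNReal using hfinite with c hc
  refine ⟨c, ae_le_of_setLIntegral_closedBall_le hf ENNReal.coe_ne_top fun x ε hε hε1 => ?_⟩
  calc ∫⁻ y in Metric.closedBall x ε, f y
      ≤ ENNReal.ofReal (K * ε ^ d) * b := setLIntegral_closedBall_le hε (h x ε hε hε1)
    _ = ENNReal.ofReal K * b / v * (ENNReal.ofReal (ε ^ d) * v) := by
      rw [ENNReal.ofReal_mul (by positivity), mul_comm (ENNReal.ofReal (ε ^ d)), ← mul_assoc,
        ENNReal.div_mul_cancel hv measure_ball_lt_top.ne, mul_right_comm]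
    _ = c * volume (Metric.closedBall x ε) := by
      rw [Measure.addHaar_closedBall _ _ hε.le, finrank_euclideanSpace, Fintype.card_fin, hc]

theorem lintegral_gaussianDensity_mul_potential (γ : Measure (Space d)) [SFinite γ] (ε : ℝ)
    {f : Space d → ℝ} (hf : Measurable f) (x : Space d) :
    ∫⁻ y, gaussianDensity d ε (x - y) * potential γ f y = potential (mollifiedCov γ ε) f x := by
  have hleft (y : Space d) : gaussianDensity d ε (x - y) * potential γ f y =
      ∫⁻ z, gaussianDensity d ε (x - y) * ‖f (y - z)‖ₑ ^ 2 ∂γ :=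
    (lintegral_const_mul _ (by fun_prop)).symm
  have hright (y : Space d) : mollifiedKernel γ ε y * ‖f (x - y)‖ₑ ^ 2 =
      ∫⁻ z, gaussianDensity d ε (y - z) * ‖f (x - y)‖ₑ ^ 2 ∂γ := by
    rw [mollifiedKernel_eq, lintegral_mul_const _ (by fun_prop)]
  rw [potential, mollifiedCov, lintegral_withDensity_eq_lintegral_mul _
    (measurable_mollifiedKernel γ ε) (by fun_prop)]
  simp_rw [Pi.mul_apply, hleft, hright]
  conv_lhs => rw [lintegral_lintegral_swap (by fun_prop)]
  conv_rhs => rw [lintegral_lintegral_swap (by fun_prop)]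
  refine lintegral_congr fun z => ?_
  rw [← lintegral_sub_left_eq_self
    (fun y => gaussianDensity d ε (y - z) * ‖f (x - y)‖ₑ ^ 2) (x + z)]
  refine lintegral_congr fun y => ?_
  rw [show x + z - y - z = x - y by abel, show x - (x + z - y) = y - z by abel]

theorem interaction_eq_weightedNorm_sq (μ : Measure (Space d)) (u : L2 d) {ρ : Space d → ℝ≥0∞}
    (hρ : Measurable ρ) (h : ρ =ᵐ[volume] potential μ u) :
    interaction μ u = 2⁻¹ * weightedNorm ρ u ^ 2 := by
  rw [interaction_eq, weightedNorm_sq hρ]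
  congr 1
  refine lintegral_congr_ae (h.mono fun x hx => ?_)
  simp only [hx, mul_comm]

theorem gaussianConv_eq_potential_mollifiedCov (γ : Measure (Space d)) [SFinite γ] (ε : ℝ)
    (u : L2 d) {ρ : Space d → ℝ≥0∞} (h : ρ =ᵐ[volume] potential γ u) :
    gaussianConv ε ρ = potential (mollifiedCov γ ε) u := by
  ext x
  rw [← lintegral_gaussianDensity_mul_potential γ ε (measurable_coe u), gaussianConv,
    ← lintegral_sub_left_eq_self _ x]
  refine lintegral_congr_ae (h.mono fun y hy => ?_)
  simp only [sub_sub_cancel, hy, mul_comm]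

namespace RegularCov

variable {γ : Measure (Space d)} [SFinite γ] {w A : ℝ}

theorem exists_ae_potential_le (hγ : RegularCov γ w A) {u : L2 d} {g : VectorL2 d}
    (hu : HasGrad u g) : ∃ c : NNReal, ∀ᵐ x, potential γ u x ≤ c := by
  refine exists_ae_le_of_lintegral_gaussianDensity_mul_le
    (measurable_potential γ (measurable_coe u))
    (b := ENNReal.ofReal ((√A * ‖u‖ + holderConst d w A * ‖g‖) ^ 2)) ENNReal.ofReal_ne_top
    fun x ε hε hε1 => ?_
  rw [lintegral_gaussianDensity_mul_potential γ ε (measurable_coe u),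
    hγ.potential_mollifiedCov hε]
  exact ENNReal.ofReal_le_ofReal (pow_le_pow_left₀ (potentialNorm_nonneg γ x u ε)
    (hγ.potentialNorm_le_of_le_one hu x hε hε1) 2)

theorem tendsto_interaction (hγ : RegularCov γ w A) {u : L2 d} {g : VectorL2 d}
    (hu : HasGrad u g) :
    Tendsto (fun ε => interaction (mollifiedCov γ ε) u) (𝓝[>] 0) (𝓝 (interaction γ u)) := by
  obtain ⟨c, hc⟩ := hγ.exists_ae_potential_le hu
  -- The potential is only bounded almost everywhere, so it is truncated to a bounded weight.
  set ρ : Space d → ℝ≥0∞ := fun x => min (potential γ u x) c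
  have hρ_meas : Measurable ρ :=
    (measurable_potential γ (measurable_coe u)).min measurable_const
  have hρ : ρ =ᵐ[volume] potential γ u := hc.mono fun x hx => min_eq_left hx
  have hρ_le (x : Space d) : ρ x ≤ ENNReal.ofReal c :=
    (min_le_right _ _).trans_eq ENNReal.ofReal_coe_nnreal.symm
  have hε (ε : ℝ) :
      interaction (mollifiedCov γ ε) u = 2⁻¹ * weightedNorm (gaussianConv ε ρ) u ^ 2 :=
    interaction_eq_weightedNorm_sq _ u (measurable_gaussianConv ε hρ_meas)
      (.of_eq (gaussianConv_eq_potential_mollifiedCov γ ε u hρ))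
  simp_rw [interaction_eq_weightedNorm_sq γ u hρ_meas hρ, hε]
  have herror : Tendsto (fun ε => ENNReal.ofReal (√c * ‖g‖ * (momentConst d * ε))) (𝓝[>] 0)
      (𝓝 0) := by
    have hcont : Continuous fun ε => ENNReal.ofReal (√c * ‖g‖ * (momentConst d * ε)) :=
      ENNReal.continuous_ofReal.comp (by fun_prop)
    simpa only [mul_zero, ENNReal.ofReal_zero] using (hcont.tendsto 0).mono_left nhdsWithin_le_nhds
  have hnorm : Tendsto (fun ε => weightedNorm (gaussianConv ε ρ) u) (𝓝[>] 0)
      (𝓝 (weightedNorm ρ u)) := by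
    refine tendsto_of_isWithin ?_ herror ?_
    · exact ((PAM.weightedNorm_le hρ_meas c.2 hρ_le u).trans_lt ENNReal.ofReal_lt_top).ne
    · filter_upwards [self_mem_nhdsWithin] with ε hε
      exact hu.isWithin_weightedNorm_gaussianConv hρ_meas c.2 hρ_le hε
  exact ENNReal.Tendsto.const_mul (((ENNReal.continuous_pow 2).tendsto _).comp hnorm)
    (.inr (ENNReal.inv_ne_top.2 two_ne_zero))

end RegularCov

/-- The covariance at scale `ε`, which is `γ` itself for `ε ≤ 0`. -/
def scaledCov (γ : Measure (Space d)) (ε : ℝ) : Measure (Space d) :=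
  if 0 < ε then mollifiedCov γ ε else γ

theorem scaledCov_of_pos (γ : Measure (Space d)) {ε : ℝ} (hε : 0 < ε) :
    scaledCov γ ε = mollifiedCov γ ε :=
  if_pos hε

theorem scaledCov_of_nonpos (γ : Measure (Space d)) {ε : ℝ} (hε : ε ≤ 0) : scaledCov γ ε = γ :=
  if_neg hε.not_gt

instance sfinite_scaledCov (γ : Measure (Space d)) [SFinite γ] (ε : ℝ) :
    SFinite (scaledCov γ ε) := by
  unfold scaledCov
  split_ifs <;> infer_instance

/-- `k` is a measurable kernel, bounded by `S` and supported in the ball of radius `ρ` around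
the origin. -/
structure IsBoundedKernel (k : Space d → ℝ≥0∞) (S ρ : ℝ) : Prop where
  measurable : Measurable k
  nonneg : 0 ≤ S
  le : ∀ x, k x ≤ ENNReal.ofReal S
  eq_zero : ∀ x, ρ < ‖x‖ → k x = 0

/-- The properties of a measure `μ` used in the compactness argument for the associated
variational problem. -/
structure Tame (μ : Measure (Space d)) : Prop where
  coercive : ∀ τ : ℝ, 0 < τ → ∃ C : ℝ, 0 ≤ C ∧ ∀ (u : L2 d) (g : VectorL2 d), HasGrad u g →
    interaction μ u ≤ ENNReal.ofReal ((C * ‖u‖ ^ 2 + τ * ‖g‖ ^ 2) * ‖u‖ ^ 2)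
  approx : ∀ R η : ℝ, 0 < η → ∃ (k : Space d → ℝ≥0∞) (S ρ : ℝ), IsBoundedKernel k S ρ ∧
    ∀ (u : L2 d) (g : VectorL2 d), HasGrad u g → ‖u‖ ≤ R → ‖g‖ ≤ R →
      IsWithin (ENNReal.ofReal η) (interaction μ u) (interaction (volume.withDensity k) u)

theorem isWithin_interaction_withDensity {k k' : Space d → ℝ≥0∞} (hk : Measurable k)
    (hk' : Measurable k') {η : ℝ} (hη : 0 ≤ η) (h : ∀ x, IsWithin (ENNReal.ofReal η) (k x) (k' x))
    (u : L2 d) : IsWithin (ENNReal.ofReal (η * ‖u‖ ^ 4 / 2))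
      (interaction (volume.withDensity k) u) (interaction (volume.withDensity k') u) := by
  have := measurable_coe u
  have hle {k k' : Space d → ℝ≥0∞} (hk : Measurable k) (hk' : Measurable k')
      (h : ∀ x, k x ≤ k' x + ENNReal.ofReal η) (x : Space d) :
      potential (volume.withDensity k) u x ≤
        potential (volume.withDensity k') u x + ENNReal.ofReal (η * ‖u‖ ^ 2) := by
    rw [potential_withDensity hk, potential_withDensity hk', weightedNorm_sq (by fun_prop),
      weightedNorm_sq (by fun_prop), ENNReal.ofReal_mul hη, ← lintegral_enorm_sq,
      ← lintegral_const_mul _ (by fun_prop), ← lintegral_add_right _ (by fun_prop)]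
    simp_rw [← add_mul]
    gcongr
    exact h _
  convert isWithin_interaction _ _ u (c := η * ‖u‖ ^ 2) (by positivity) fun x =>
    ⟨hle hk hk' (fun x => (h x).1) x, hle hk' hk (fun x => (h x).2) x⟩ using 2
  ring

namespace RegularCov

variable {γ : Measure (Space d)} [SFinite γ] {w A : ℝ}

theorem isWithin_interaction_scaledCov (hγ : RegularCov γ w A) {u : L2 d} {g : VectorL2 d}
    (hu : HasGrad u g) {R : ℝ} (huR : ‖u‖ ≤ R) (hgR : ‖g‖ ≤ R) {ε r : ℝ} (hr0 : 0 < r)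
    (hr : ε ≤ r) (hr1 : r ≤ 1) :
    IsWithin (ENNReal.ofReal (oscConst d w A R * r ^ (1 - w / 2)))
      (interaction (scaledCov γ ε) u) (interaction (mollifiedCov γ r) u) := by
  rcases lt_or_ge 0 ε with hε | hε
  · rw [scaledCov_of_pos γ hε]
    exact hγ.isWithin_interaction_mollifiedCov hu huR hgR hε hr hr1
  · rw [scaledCov_of_nonpos γ hε]
    refine .of_tendsto (hγ.tendsto_interaction hu) ?_
    filter_upwards [Ioc_mem_nhdsGT hr0] with s hs
    exact hγ.isWithin_interaction_mollifiedCov hu huR hgR hs.1 hs.2 hr1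

theorem exists_interaction_scaledCov_le (hγ : RegularCov γ w A) {τ : ℝ} (hτ : 0 < τ) :
    ∃ C : ℝ, 0 ≤ C ∧ ∀ (u : L2 d) (g : VectorL2 d), HasGrad u g → ∀ ε,
      interaction (scaledCov γ ε) u ≤
        ENNReal.ofReal ((C * ‖u‖ ^ 2 + τ * ‖g‖ ^ 2) * ‖u‖ ^ 2) := by
  obtain ⟨C, hC, hle⟩ := hγ.exists_potentialNorm_sq_le hτ
  refine ⟨C, hC, fun u g hu ε => ?_⟩
  have hmollified {ε : ℝ} (hε : 0 < ε) : interaction (mollifiedCov γ ε) u ≤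
      ENNReal.ofReal ((C * ‖u‖ ^ 2 + τ * ‖g‖ ^ 2) * ‖u‖ ^ 2) := by
    refine (interaction_le_of_potential_le (mollifiedCov γ ε) u
      (c := C * ‖u‖ ^ 2 + τ * ‖g‖ ^ 2) (by positivity) (ae_of_all _ fun x => ?_)).trans
      (ENNReal.ofReal_le_ofReal (half_le_self (by positivity)))
    rw [hγ.potential_mollifiedCov hε]
    exact ENNReal.ofReal_le_ofReal (hle u g hu ε x hε)
  rcases lt_or_ge 0 ε with hε | hε
  · rw [scaledCov_of_pos γ hε]
    exact hmollified hε
  · rw [scaledCov_of_nonpos γ hε]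
    exact le_of_tendsto (hγ.tendsto_interaction hu)
      (eventually_nhdsWithin_of_forall fun _ => hmollified)

theorem exists_isBoundedKernel_isWithin (hγ : RegularCov γ w A) {r : ℝ} (hr : 0 < r) {η : ℝ}
    (hη : 0 < η) : ∃ (k : Space d → ℝ≥0∞) (S ρ : ℝ), IsBoundedKernel k S ρ ∧
      ∀ x, IsWithin (ENNReal.ofReal η) (mollifiedKernel γ r x) (k x) := by
  obtain ⟨ρ, -, hρ⟩ := (Metric.hasBasis_cobounded_compl_closedBall (0 : Space d)).eventually_iff.1
    (Metric.cobounded_eq_cocompact (α := Space d) ▸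
      (hγ.decay r hr).eventually (ge_mem_nhds (ENNReal.ofReal_pos.2 hη)))
  set k := (Metric.closedBall 0 ρ).indicator (mollifiedKernel γ r)
  have hk_le (x : Space d) : k x ≤ mollifiedKernel γ r x := Set.indicator_le_self _ _ x
  refine ⟨k, A * r ^ (-w), ρ, ⟨?_, ?_, fun x => (hk_le x).trans (hγ.bound r x hr), fun x hx => ?_⟩,
    fun x => ⟨?_, (hk_le x).trans le_self_add⟩⟩
  · exact (measurable_mollifiedKernel γ r).indicator Metric.isClosed_closedBall.measurableSet
  · exact mul_nonneg hγ.A_pos.le (Real.rpow_nonneg hr.le _)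
  · exact Set.indicator_of_notMem (by simpa using hx) _
  · by_cases hx : x ∈ Metric.closedBall (0 : Space d) ρ
    · exact (Set.indicator_of_mem hx (mollifiedKernel γ r)).ge.trans le_self_add
    · exact (hρ hx).trans le_add_self

theorem exists_isBoundedKernel_isWithin_interaction (hγ : RegularCov γ w A) {r : ℝ} (hr : 0 < r)
    (R : ℝ) {η : ℝ} (hη : 0 < η) : ∃ (k : Space d → ℝ≥0∞) (S ρ : ℝ), IsBoundedKernel k S ρ ∧
      ∀ u : L2 d, ‖u‖ ≤ R → IsWithin (ENNReal.ofReal η) (interaction (mollifiedCov γ r) u)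
        (interaction (volume.withDensity k) u) := by
  have hη' : 0 < η / (1 + R ^ 4) := by positivity
  obtain ⟨k, S, ρ, hk, hwithin⟩ := hγ.exists_isBoundedKernel_isWithin hr hη'
  refine ⟨k, S, ρ, hk, fun u huR => (isWithin_interaction_withDensity
    (measurable_mollifiedKernel γ r) hk.measurable hη'.le hwithin u).mono
    (ENNReal.ofReal_le_ofReal ?_)⟩
  calc η / (1 + R ^ 4) * ‖u‖ ^ 4 / 2 ≤ η / (1 + R ^ 4) * ‖u‖ ^ 4 := half_le_self (by positivity)
    _ ≤ η / (1 + R ^ 4) * (1 + R ^ 4) := by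
      gcongr
      linarith [pow_le_pow_left₀ (norm_nonneg u) huR 4]
    _ = η := div_mul_cancel₀ η (by positivity)

theorem tame_scaledCov (hγ : RegularCov γ w A) (ε : ℝ) : Tame (scaledCov γ ε) where
  coercive τ hτ := by
    obtain ⟨C, hC, hle⟩ := hγ.exists_interaction_scaledCov_le hτ
    exact ⟨C, hC, fun u g hu => hle u g hu ε⟩
  approx R η hη := by
    rcases lt_or_ge 0 ε with hε | hε
    · obtain ⟨k, S, ρ, hk, hwithin⟩ := hγ.exists_isBoundedKernel_isWithin_interaction hε R hη
      rw [scaledCov_of_pos γ hε]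
      exact ⟨k, S, ρ, hk, fun u _ _ huR _ => hwithin u huR⟩
    · obtain ⟨r, hr, hr1, hrη⟩ := exists_mul_rpow_le (oscConst d w A R) (θ := 1 - w / 2)
        (by linarith [hγ.w_lt]) (half_pos hη)
      obtain ⟨k, S, ρ, hk, hwithin⟩ :=
        hγ.exists_isBoundedKernel_isWithin_interaction hr R (half_pos hη)
      refine ⟨k, S, ρ, hk, fun u g hu huR hgR => ?_⟩
      rw [← add_halves η, ENNReal.ofReal_add (half_pos hη).le (half_pos hη).le]
      exact ((hγ.isWithin_interaction_scaledCov hu huR hgR hr (hε.trans hr.le) hr1).mono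
        (ENNReal.ofReal_le_ofReal hrη)).trans (hwithin u huR)

end RegularCov

end ZeroScale

section LocalCompactness

/-- Weak convergence of a sequence in a Hilbert space. -/
def WeaklyTendsto {H : Type*} [NormedAddCommGroup H] [InnerProductSpace ℝ H] (x : ℕ → H) (a : H) :
    Prop :=
  ∀ y, Tendsto (fun n => inner ℝ y (x n)) atTop (𝓝 (inner ℝ y a))

namespace WeaklyTendsto

variable {H : Type*} [NormedAddCommGroup H] [InnerProductSpace ℝ H] {x : ℕ → H} {a : H}

theorem comp (hx : WeaklyTendsto x a) {φ : ℕ → ℕ} (hφ : StrictMono φ) :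
    WeaklyTendsto (x ∘ φ) a :=
  fun y => (hx y).comp hφ.tendsto_atTop

theorem sub_const (hx : WeaklyTendsto x a) (b : H) : WeaklyTendsto (fun n => x n - b) (a - b) :=
  fun y => by simpa only [inner_sub_right] using (hx y).sub_const (inner ℝ y b)

end WeaklyTendsto

theorem exists_weaklyTendsto_subseq {H : Type*} [NormedAddCommGroup H] [InnerProductSpace ℝ H]
    [CompleteSpace H] [TopologicalSpace.SeparableSpace H] {x : ℕ → H} {R : ℝ}
    (hx : ∀ n, ‖x n‖ ≤ R) : ∃ (a : H) (φ : ℕ → ℕ), StrictMono φ ∧ WeaklyTendsto (x ∘ φ) a := by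
  obtain ⟨a, -, φ, hφ, hlim⟩ := WeakDual.isSeqCompact_closedBall ℝ H (0 : StrongDual ℝ H) R
    (x := fun n => StrongDual.toWeakDual (InnerProductSpace.toDual ℝ H (x n))) fun n => by
      simpa using hx n
  refine ⟨(InnerProductSpace.toDual ℝ H).symm (WeakDual.toStrongDual a), φ, hφ, fun y => ?_⟩
  rw [real_inner_comm, InnerProductSpace.toDual_symm_apply]
  exact (((WeakDual.eval_continuous (𝕜 := ℝ) y).tendsto a).comp hlim).congr
    fun n => real_inner_comm _ _

theorem tendsto_zero_of_le_add {ι κ : Type*} {l : Filter ι} {l' : Filter κ} [l'.NeBot]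
    {a : ι → ℝ≥0∞} {b : κ → ι → ℝ≥0∞} {c : κ → ℝ≥0∞} (hb : ∀ᶠ k in l', Tendsto (b k) l (𝓝 0))
    (hc : Tendsto c l' (𝓝 0)) (h : ∀ᶠ k in l', ∀ i, a i ≤ b k i + c k) : Tendsto a l (𝓝 0) := by
  rw [ENNReal.tendsto_nhds_zero]
  intro ε hε
  have hε2 : 0 < ε / 2 := ENNReal.half_pos hε.ne'
  obtain ⟨k, hbk, hck, hk⟩ := (hb.and ((ENNReal.tendsto_nhds_zero.1 hc _ hε2).and h)).exists
  filter_upwards [ENNReal.tendsto_nhds_zero.1 hbk _ hε2] with i hi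
  exact (hk i).trans ((add_le_add hi hck).trans_eq (ENNReal.add_halves ε))

theorem lintegral_enorm_mul_enorm_le {α : Type*} [MeasurableSpace α] {μ : Measure α}
    {f g : α → ℝ} (hf : AEMeasurable f μ) (hg : AEMeasurable g μ) :
    ∫⁻ x, ‖f x‖ₑ * ‖g x‖ₑ ∂μ ≤ eLpNorm f 2 μ * eLpNorm g 2 μ := by
  simpa [eLpNorm_eq_lintegral_rpow_enorm_toReal two_ne_zero ENNReal.ofNat_ne_top] using
    ENNReal.lintegral_mul_le_Lp_mul_Lq μ Real.HolderConjugate.two_two hf.enorm hg.enorm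

theorem tendsto_eLpNorm_two_zero {ι α E : Type*} [MeasurableSpace α] [NormedAddCommGroup E]
    {l : Filter ι} {μ : ι → Measure α} {f : ι → α → E}
    (h : Tendsto (fun i => ∫⁻ x, ‖f i x‖ₑ ^ 2 ∂(μ i)) l (𝓝 0)) :
    Tendsto (fun i => eLpNorm (f i) 2 (μ i)) l (𝓝 0) := by
  have hsqrt := (ENNReal.continuous_rpow_const (y := 2⁻¹)).tendsto 0 |>.comp h
  rw [ENNReal.zero_rpow_of_pos (by norm_num)] at hsqrt
  refine hsqrt.congr fun i => ?_
  rw [Function.comp_apply, ← eLpNorm_two_sq, ← ENNReal.rpow_natCast_mul]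
  norm_num

theorem tendsto_eLpNorm_two_zero_of_le {α : Type*} [MeasurableSpace α] {μ : Measure α}
    [IsFiniteMeasure μ] {f : ℕ → α → ℝ} (hf : ∀ n, Measurable (f n)) {C : ℝ}
    (hC : ∀ n x, ‖f n x‖ ≤ C) (hlim : ∀ x, Tendsto (fun n => f n x) atTop (𝓝 0)) :
    Tendsto (fun n => eLpNorm (f n) 2 μ) atTop (𝓝 0) := by
  refine tendsto_eLpNorm_two_zero ?_
  have hdom := tendsto_lintegral_of_dominated_convergence (μ := μ)
    (F := fun n x => ‖f n x‖ₑ ^ 2) (f := fun _ => 0) (fun _ => ENNReal.ofReal C ^ 2)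
    (fun n => (hf n).enorm.pow_const 2)
    (fun n => ae_of_all _ fun x => by
      simp only [← ofReal_norm]
      gcongr
      exact hC n x)
    (by simp [ENNReal.mul_eq_top])
    (ae_of_all _ fun x => by
      simpa [Function.comp_def] using (ENNReal.continuous_pow 2).tendsto _ |>.comp (hlim x).enorm)
  simpa only [lintegral_zero] using hdom

variable {d : ℕ}

theorem memLp_gaussianKernel_sub {δ : ℝ} (hδ : 0 < δ) (x : Space d) :
    MemLp (fun y => gaussianKernel d δ (x - y)) 2 volume := by
  have hcont : Continuous fun y => gaussianKernel d δ (x - y) :=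
    (continuous_gaussianKernel δ).comp (by fun_prop)
  rw [memLp_two_iff_integrable_sq hcont.aestronglyMeasurable]
  simp_rw [sq]
  refine ((integrable_gaussianKernel hδ).comp_sub_left x).mul_bdd
    (c := gaussianKernel d δ 0) hcont.aestronglyMeasurable (ae_of_all _ fun y => ?_)
  rw [Real.norm_of_nonneg (gaussianKernel_nonneg _ _)]
  exact gaussianKernel_anti (by simp)

theorem norm_toLp_gaussianKernel_sub {δ : ℝ} (hδ : 0 < δ) (x : Space d) :
    ‖(memLp_gaussianKernel_sub hδ x).toLp‖ = ‖(memLp_gaussianKernel_sub (d := d) hδ 0).toLp‖ := by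
  rw [Lp.norm_toLp, Lp.norm_toLp, ← eLpNorm_comp_measurePreserving
    (memLp_gaussianKernel_sub (d := d) hδ 0).1 (measurePreserving_sub_right volume x)]
  simp only [Function.comp_def, zero_sub, neg_sub]

/-- The mollification of `u` at scale `δ`. -/
def mollify (δ : ℝ) (u : L2 d) (x : Space d) : ℝ := ∫ y, gaussianKernel d δ (x - y) * u y

theorem mollify_eq_inner {δ : ℝ} (hδ : 0 < δ) (u : L2 d) (x : Space d) :
    mollify δ u x = inner ℝ (memLp_gaussianKernel_sub hδ x).toLp u := by
  rw [inner_toLp_eq_integral, mollify]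
  simp only [RCLike.inner_apply, conj_trivial, mul_comm]

theorem measurable_mollify (δ : ℝ) (u : L2 d) : Measurable (mollify δ u) := by
  have := measurable_coe u
  have := (continuous_gaussianKernel (d := d) δ).measurable
  have hjoint : Measurable fun p : Space d × Space d => gaussianKernel d δ (p.1 - p.2) * u p.2 := by
    fun_prop
  exact hjoint.stronglyMeasurable.integral_prod_right'.measurable

theorem norm_mollify_le {δ : ℝ} (hδ : 0 < δ) (u : L2 d) (x : Space d) :
    ‖mollify δ u x‖ ≤ ‖(memLp_gaussianKernel_sub (d := d) hδ 0).toLp‖ * ‖u‖ := by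
  rw [mollify_eq_inner hδ, ← norm_toLp_gaussianKernel_sub hδ x]
  exact norm_inner_le_norm _ _

theorem sub_mollify_eq_integral {δ : ℝ} (hδ : 0 < δ) (u : L2 d) (x : Space d) :
    u x - mollify δ u x = ∫ h, gaussianKernel d δ h * (u x - u (x - h)) := by
  have h_int : Integrable fun y => gaussianKernel d δ (x - y) * u y :=
    (memLp_gaussianKernel_sub hδ x).integrable_mul (Lp.memLp u)
  have h_int' : Integrable fun h => gaussianKernel d δ h * u (x - h) := by
    simpa using h_int.comp_sub_left x
  simp_rw [mul_sub]
  rw [integral_sub ((integrable_gaussianKernel hδ).mul_const _) h_int', integral_mul_const,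
    integral_gaussianKernel hδ, one_mul, mollify,
    ← integral_sub_left_eq_self (fun y => gaussianKernel d δ (x - y) * u y) volume x]
  simp only [sub_sub_cancel]

theorem enorm_sub_mollify_sq_le {δ : ℝ} (hδ : 0 < δ) (u : L2 d) (x : Space d) :
    ‖u x - mollify δ u x‖ₑ ^ 2 ≤ ∫⁻ h, ‖u x - u (x - h)‖ₑ ^ 2 ∂(gaussianMeasure d δ) := by
  have := measurable_coe u
  have hsub : Measurable fun h => u x - u (x - h) := by fun_prop
  have := isProbabilityMeasure_gaussianMeasure (d := d) hδ
  rw [← eLpNorm_two_sq]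
  gcongr
  calc ‖u x - mollify δ u x‖ₑ ≤ ∫⁻ h, ‖gaussianKernel d δ h * (u x - u (x - h))‖ₑ := by
        rw [sub_mollify_eq_integral hδ]
        exact enorm_integral_le_lintegral_enorm _
    _ = eLpNorm (fun h => u x - u (x - h)) 1 (gaussianMeasure d δ) := by
        rw [eLpNorm_one_eq_lintegral_enorm, lintegral_gaussianMeasure _ hsub.enorm]
        simp_rw [enorm_mul, Real.enorm_of_nonneg (gaussianKernel_nonneg _ _), gaussianDensity]
    _ ≤ eLpNorm (fun h => u x - u (x - h)) 2 (gaussianMeasure d δ) :=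
        eLpNorm_le_eLpNorm_of_exponent_le one_le_two hsub.aestronglyMeasurable

theorem HasGrad.lintegral_enorm_sub_sq_le {u : L2 d} {g : VectorL2 d} (hu : HasGrad u g)
    (h : Space d) : ∫⁻ x, ‖u x - u (x - h)‖ₑ ^ 2 ≤ (ENNReal.ofReal ‖g‖ * ‖h‖ₑ) ^ 2 := by
  calc ∫⁻ x, ‖u x - u (x - h)‖ₑ ^ 2 = ∫⁻ x, ‖(PAM.translate (-h) u - u : L2 d) x‖ₑ ^ 2 := by
        apply lintegral_congr_ae
        filter_upwards [Lp.coeFn_sub (PAM.translate (-h) u) u, coeFn_translate (-h) u]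
          with x hsub htranslate
        rw [hsub, Pi.sub_apply, htranslate, ← sub_eq_add_neg, ← enorm_neg, neg_sub]
    _ = ENNReal.ofReal ‖PAM.translate (-h) u - u‖ ^ 2 := by
        rw [lintegral_enorm_sq, ENNReal.ofReal_pow (norm_nonneg _)]
    _ ≤ (ENNReal.ofReal ‖g‖ * ‖h‖ₑ) ^ 2 := by
        rw [← ofReal_norm, ← ENNReal.ofReal_mul (norm_nonneg g)]
        gcongr
        simpa [mul_comm] using hu.norm_translate_sub_le (-h)

theorem HasGrad.eLpNorm_sub_mollify_le {u : L2 d} {g : VectorL2 d} (hu : HasGrad u g) {δ : ℝ}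
    (hδ : 0 < δ) : eLpNorm (fun x => u x - mollify δ u x) 2 volume ≤
      ENNReal.ofReal (‖g‖ * (momentConst d * δ)) := by
  have := measurable_coe u
  have := isProbabilityMeasure_gaussianMeasure (d := d) hδ
  have hsub : Measurable fun z : Space d × Space d => ‖u z.1 - u (z.1 - z.2)‖ₑ ^ 2 := by fun_prop
  refine le_trans ?_ (eLpNorm_mul_enorm_gaussianMeasure_le hδ (norm_nonneg g))
  rw [← ENNReal.pow_le_pow_left_iff two_ne_zero, eLpNorm_two_sq, eLpNorm_two_sq]
  calc ∫⁻ x, ‖u x - mollify δ u x‖ₑ ^ 2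
      ≤ ∫⁻ x, ∫⁻ h, ‖u x - u (x - h)‖ₑ ^ 2 ∂(gaussianMeasure d δ) :=
        lintegral_mono fun x => enorm_sub_mollify_sq_le hδ u x
    _ = ∫⁻ h, (∫⁻ x, ‖u x - u (x - h)‖ₑ ^ 2) ∂(gaussianMeasure d δ) :=
        lintegral_lintegral_swap hsub.aemeasurable
    _ ≤ ∫⁻ h, ‖ENNReal.ofReal ‖g‖ * ‖h‖ₑ‖ₑ ^ 2 ∂(gaussianMeasure d δ) := by
        simp only [enorm_eq_self]
        exact lintegral_mono fun h => hu.lintegral_enorm_sub_sq_le h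

theorem tendsto_eLpNorm_mollify {r : ℕ → L2 d} {R : ℝ} (hrR : ∀ n, ‖r n‖ ≤ R)
    (hweak : WeaklyTendsto r 0) {δ : ℝ} (hδ : 0 < δ) (μ : Measure (Space d)) [IsFiniteMeasure μ] :
    Tendsto (fun n => eLpNorm (mollify δ (r n)) 2 μ) atTop (𝓝 0) := by
  refine tendsto_eLpNorm_two_zero_of_le (fun n => measurable_mollify δ (r n))
    (fun n x => (norm_mollify_le hδ (r n) x).trans
      (mul_le_mul_of_nonneg_left (hrR n) (norm_nonneg _))) fun x => ?_
  simp_rw [mollify_eq_inner hδ]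
  simpa only [inner_zero_right] using hweak (memLp_gaussianKernel_sub hδ x).toLp

/-- Convergence to zero in `L²_loc`. -/
def TendstoZeroLocally (r : ℕ → L2 d) : Prop :=
  ∀ x ρ, Tendsto (fun n => eLpNorm (r n) 2 (volume.restrict (Metric.closedBall x ρ))) atTop (𝓝 0)

theorem TendstoZeroLocally.tendsto_setLIntegral {r : ℕ → L2 d} (hr : TendstoZeroLocally r)
    (x : Space d) (ρ : ℝ) :
    Tendsto (fun n => ∫⁻ y in Metric.closedBall x ρ, ‖r n y‖ₑ ^ 2) atTop (𝓝 0) := by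
  have hpow := ((ENNReal.continuous_pow 2).tendsto 0).comp (hr x ρ)
  rw [zero_pow two_ne_zero] at hpow
  exact hpow.congr fun n => eLpNorm_two_sq _ _

theorem tendstoZeroLocally_of_weaklyTendsto {r : ℕ → L2 d} {q : ℕ → VectorL2 d}
    (hr : ∀ n, HasGrad (r n) (q n)) {R : ℝ} (hrR : ∀ n, ‖r n‖ ≤ R) (hqR : ∀ n, ‖q n‖ ≤ R)
    (hweak : WeaklyTendsto r 0) : TendstoZeroLocally r := by
  intro x ρ
  have : IsFiniteMeasure (volume.restrict (Metric.closedBall x ρ)) :=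
    isFiniteMeasure_restrict.2 measure_closedBall_lt_top.ne
  have hmoment := momentConst_pos d
  have herror : Tendsto (fun δ => ENNReal.ofReal (R * (momentConst d * δ))) (𝓝[>] 0) (𝓝 0) := by
    have hcont : Continuous fun δ => ENNReal.ofReal (R * (momentConst d * δ)) :=
      ENNReal.continuous_ofReal.comp (by fun_prop)
    simpa only [mul_zero, ENNReal.ofReal_zero] using (hcont.tendsto 0).mono_left nhdsWithin_le_nhds
  refine tendsto_zero_of_le_add (l' := 𝓝[>] (0 : ℝ))
    (eventually_nhdsWithin_of_forall fun δ hδ => tendsto_eLpNorm_mollify hrR hweak hδ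
      (volume.restrict (Metric.closedBall x ρ))) herror
    (eventually_nhdsWithin_of_forall fun δ (hδ : 0 < δ) n => ?_)
  have hsub : Measurable fun x => r n x - mollify δ (r n) x :=
    (measurable_coe (r n)).sub (measurable_mollify δ (r n))
  calc eLpNorm (r n) 2 (volume.restrict (Metric.closedBall x ρ))
      = eLpNorm (mollify δ (r n) + fun x => r n x - mollify δ (r n) x) 2
          (volume.restrict (Metric.closedBall x ρ)) := by
        congr 1
        ext y
        simp only [Pi.add_apply, add_sub_cancel]
    _ ≤ _ := eLpNorm_add_le (measurable_mollify δ (r n)).aestronglyMeasurable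
        hsub.aestronglyMeasurable one_le_two
    _ ≤ _ := by
        gcongr
        refine (eLpNorm_mono_measure _ Measure.restrict_le_self).trans
          (((hr n).eLpNorm_sub_mollify_le hδ).trans ?_)
        gcongr
        exact hqR n

theorem eLpNorm_restrict_le (u : L2 d) (s : Set (Space d)) :
    eLpNorm u 2 (volume.restrict s) ≤ ENNReal.ofReal ‖u‖ := by
  rw [Lp.norm_def, ENNReal.ofReal_toReal (Lp.eLpNorm_ne_top u)]
  exact eLpNorm_mono_measure _ Measure.restrict_le_self

theorem tendsto_eLpNorm_compl_closedBall (u : L2 d) :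
    Tendsto (fun ρ => eLpNorm u 2 (volume.restrict (Metric.closedBall 0 ρ)ᶜ)) atTop (𝓝 0) := by
  let μ : Measure (Space d) := volume.withDensity fun x => ‖u x‖ₑ ^ 2
  have : IsFiniteMeasure μ := isFiniteMeasure_withDensity <| by
    rw [lintegral_enorm_sq]
    exact ENNReal.ofReal_ne_top
  have htight := tendsto_measure_compl_closedBall_of_isTightMeasureSet
    (isTightMeasureSet_singleton (μ := μ)) 0
  refine tendsto_eLpNorm_two_zero (htight.congr fun ρ => ?_)
  simp only [Set.mem_singleton_iff, iSup_iSup_eq_left]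
  exact withDensity_apply _ Metric.isClosed_closedBall.measurableSet.compl

theorem TendstoZeroLocally.tendsto_lintegral_enorm_mul_enorm {r : ℕ → L2 d}
    (hloc : TendstoZeroLocally r) {R : ℝ} (hrR : ∀ n, ‖r n‖ ≤ R) (u : L2 d) :
    Tendsto (fun n => ∫⁻ x, ‖u x‖ₑ * ‖r n x‖ₑ) atTop (𝓝 0) := by
  have hmeas (v : L2 d) (μ : Measure (Space d)) : AEMeasurable v μ :=
    (measurable_coe v).aemeasurable
  refine tendsto_zero_of_le_add (l' := atTop)
    (b := fun ρ n =>
      ENNReal.ofReal ‖u‖ * eLpNorm (r n) 2 (volume.restrict (Metric.closedBall 0 ρ)))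
    (c := fun ρ => eLpNorm u 2 (volume.restrict (Metric.closedBall 0 ρ)ᶜ) * ENNReal.ofReal R)
    (.of_forall fun ρ => ?_) ?_ (.of_forall fun ρ n => ?_)
  · simpa only [mul_zero] using
      ENNReal.Tendsto.const_mul (hloc 0 ρ) (.inr (ENNReal.ofReal_ne_top (r := ‖u‖)))
  · simpa only [zero_mul] using
      ENNReal.Tendsto.mul_const (tendsto_eLpNorm_compl_closedBall u)
        (.inr (ENNReal.ofReal_ne_top (r := R)))
  · rw [← lintegral_add_compl _ (Metric.isClosed_closedBall (x := 0) (ε := ρ)).measurableSet]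
    refine add_le_add ?_ ?_
    · refine (lintegral_enorm_mul_enorm_le (hmeas u _) (hmeas (r n) _)).trans ?_
      gcongr
      exact eLpNorm_restrict_le u _
    · refine (lintegral_enorm_mul_enorm_le (hmeas u _) (hmeas (r n) _)).trans ?_
      gcongr
      exact (eLpNorm_restrict_le (r n) _).trans (ENNReal.ofReal_le_ofReal (hrR n))

end LocalCompactness

section Splitting

variable {d : ℕ}

/-- The bilinear form `∬ a(x) k(x - y) b(y) dx dy` of a kernel `k`. -/
def kernelForm (k a b : Space d → ℝ≥0∞) : ℝ≥0∞ := ∫⁻ x, a x * ∫⁻ y, k (x - y) * b y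

theorem measurable_lintegral_comp_sub_mul {k b : Space d → ℝ≥0∞} (hk : Measurable k)
    (hb : Measurable b) : Measurable fun x => ∫⁻ y, k (x - y) * b y :=
  Measurable.lintegral_prod_right' (f := fun p : Space d × Space d => k (p.1 - p.2) * b p.2)
    (by fun_prop)

theorem interaction_withDensity {k : Space d → ℝ≥0∞} (hk : Measurable k) (u : L2 d) :
    interaction (volume.withDensity k) u =
      2⁻¹ * kernelForm k (fun x => ‖u x‖ₑ ^ 2) (fun x => ‖u x‖ₑ ^ 2) := by
  rw [interaction_eq, kernelForm]
  congr! with x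
  rw [potential_withDensity hk, weightedNorm_sq (by fun_prop)]

theorem kernelForm_mono_ae {k a a' b b' : Space d → ℝ≥0∞} (ha : a ≤ᵐ[volume] a')
    (hb : b ≤ᵐ[volume] b') : kernelForm k a b ≤ kernelForm k a' b' := by
  refine lintegral_mono_ae ?_
  filter_upwards [ha] with x hax
  refine mul_le_mul' hax (lintegral_mono_ae ?_)
  filter_upwards [hb] with y hby
  gcongr

theorem kernelForm_add_left {k a a' b : Space d → ℝ≥0∞} (hk : Measurable k) (ha : Measurable a)
    (hb : Measurable b) : kernelForm k (a + a') b = kernelForm k a b + kernelForm k a' b := by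
  have := measurable_lintegral_comp_sub_mul hk hb
  unfold kernelForm
  rw [← lintegral_add_left (by fun_prop)]
  simp only [Pi.add_apply, add_mul]

theorem kernelForm_add_right {k a b b' : Space d → ℝ≥0∞} (hk : Measurable k) (ha : Measurable a)
    (hb : Measurable b) : kernelForm k a (b + b') = kernelForm k a b + kernelForm k a b' := by
  have := measurable_lintegral_comp_sub_mul hk hb
  unfold kernelForm
  rw [← lintegral_add_left (by fun_prop)]
  congr! 2 with x
  rw [← mul_add, ← lintegral_add_left (by fun_prop)]
  simp only [Pi.add_apply, mul_add]

theorem kernelForm_swap {k a b : Space d → ℝ≥0∞} (hk : Measurable k) (ha : Measurable a)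
    (hb : Measurable b) : kernelForm k a b = kernelForm (fun z => k (-z)) b a := by
  unfold kernelForm
  calc ∫⁻ x, a x * ∫⁻ y, k (x - y) * b y = ∫⁻ x, ∫⁻ y, a x * (k (x - y) * b y) :=
        lintegral_congr fun x => (lintegral_const_mul _ (by fun_prop)).symm
    _ = ∫⁻ y, ∫⁻ x, a x * (k (x - y) * b y) := lintegral_lintegral_swap (by fun_prop)
    _ = ∫⁻ y, ∫⁻ x, b y * (k (-(y - x)) * a x) := by
        congr! 4 with y x
        rw [neg_sub]
        ring
    _ = ∫⁻ y, b y * ∫⁻ x, k (-(y - x)) * a x :=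
        lintegral_congr fun y => lintegral_const_mul _ (by fun_prop)

namespace IsBoundedKernel

variable {k : Space d → ℝ≥0∞} {S ρ : ℝ}

theorem comp_neg (hk : IsBoundedKernel k S ρ) : IsBoundedKernel (fun z => k (-z)) S ρ where
  measurable := hk.measurable.comp measurable_neg
  nonneg := hk.nonneg
  le x := hk.le (-x)
  eq_zero x hx := hk.eq_zero (-x) (by rwa [norm_neg])

theorem kernelForm_le (hk : IsBoundedKernel k S ρ) {a b : Space d → ℝ≥0∞} (ha : Measurable a)
    (hb : Measurable b) :
    kernelForm k a b ≤ ENNReal.ofReal S * ((∫⁻ x, a x) * ∫⁻ x, b x) := by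
  calc ∫⁻ x, a x * ∫⁻ y, k (x - y) * b y ≤ ∫⁻ x, a x * ∫⁻ y, ENNReal.ofReal S * b y := by
        gcongr with x y
        exact hk.le _
    _ = ENNReal.ofReal S * ((∫⁻ x, a x) * ∫⁻ x, b x) := by
        rw [lintegral_mul_const _ ha, lintegral_const_mul _ hb]
        ring

theorem lintegral_comp_sub_mul_le (hk : IsBoundedKernel k S ρ) {b : Space d → ℝ≥0∞}
    (hb : Measurable b) (x : Space d) :
    ∫⁻ y, k (x - y) * b y ≤ ENNReal.ofReal S * ∫⁻ y in Metric.closedBall x ρ, b y := by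
  rw [← lintegral_const_mul _ hb, ← lintegral_indicator Metric.isClosed_closedBall.measurableSet]
  refine lintegral_mono fun y => ?_
  by_cases hy : y ∈ Metric.closedBall x ρ
  · rw [Set.indicator_of_mem hy]
    gcongr
    exact hk.le _
  · have hzero : k (x - y) = 0 := hk.eq_zero _ (by simpa [dist_eq_norm, norm_sub_rev] using hy)
    simp [hzero]

theorem tendsto_kernelForm_zero (hk : IsBoundedKernel k S ρ) {a : Space d → ℝ≥0∞}
    {b : ℕ → Space d → ℝ≥0∞} (ha : Measurable a) (hatop : ∫⁻ x, a x ≠ ⊤)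
    (hb : ∀ n, Measurable (b n)) {c : ℝ≥0∞} (hc : c ≠ ⊤) (hbc : ∀ n, ∫⁻ x, b n x ≤ c)
    (hloc : ∀ x, Tendsto (fun n => ∫⁻ y in Metric.closedBall x ρ, b n y) atTop (𝓝 0)) :
    Tendsto (fun n => kernelForm k a (b n)) atTop (𝓝 0) := by
  have hdom := tendsto_lintegral_of_dominated_convergence (μ := (volume : Measure (Space d)))
    (F := fun n x => a x * ∫⁻ y, k (x - y) * b n y) (f := fun _ => 0)
    (fun x => a x * (ENNReal.ofReal S * c))
    (fun n => ha.mul (measurable_lintegral_comp_sub_mul hk.measurable (hb n)))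
    (fun n => ae_of_all _ fun x => mul_le_mul_right
      ((hk.lintegral_comp_sub_mul_le (hb n) x).trans
        (mul_le_mul_right ((setLIntegral_le_lintegral _ _).trans (hbc n)) _)) _)
    (by
      rw [lintegral_mul_const _ ha]
      exact ENNReal.mul_ne_top hatop (ENNReal.mul_ne_top ENNReal.ofReal_ne_top hc)) ?_
  · rwa [lintegral_zero] at hdom
  · filter_upwards [ae_lt_top ha hatop] with x hx
    have hball := ENNReal.Tendsto.const_mul (hloc x) (.inr (ENNReal.ofReal_ne_top (r := S)))
    rw [mul_zero] at hball
    have hconv := tendsto_of_tendsto_of_tendsto_of_le_of_le tendsto_const_nhds hball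
      (fun n => zero_le) (fun n => hk.lintegral_comp_sub_mul_le (hb n) x)
    simpa only [mul_zero] using ENNReal.Tendsto.const_mul hconv (.inr hx.ne)

theorem kernelForm_add_add_le (hk : IsBoundedKernel k S ρ) {a b e : Space d → ℝ≥0∞}
    (ha : Measurable a) (hb : Measurable b) (he : Measurable e) {m : ℝ≥0∞}
    (hm : ∫⁻ x, (a + b) x ≤ m) :
    kernelForm k (a + b + e) (a + b + e) ≤ kernelForm k a a + kernelForm k b b +
      (kernelForm k a b + kernelForm (fun z => k (-z)) a b +
        ENNReal.ofReal S * ((∫⁻ x, e x) * (m + m + ∫⁻ x, e x))) := by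
  have hab := ha.add hb
  have hleft : kernelForm k (a + b) e ≤ ENNReal.ofReal S * (m * ∫⁻ x, e x) :=
    (hk.kernelForm_le hab he).trans (by gcongr)
  have hright : kernelForm k e (a + b + e) ≤
      ENNReal.ofReal S * ((∫⁻ x, e x) * (m + ∫⁻ x, e x)) := by
    refine (hk.kernelForm_le he (hab.add he)).trans ?_
    simp only [Pi.add_apply (a + b) e]
    rw [lintegral_add_left hab]
    gcongr
  rw [kernelForm_add_left hk.measurable hab (hab.add he),
    kernelForm_add_right hk.measurable hab hab, kernelForm_add_left hk.measurable ha hab,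
    kernelForm_add_right hk.measurable ha ha, kernelForm_add_right hk.measurable hb ha,
    kernelForm_swap hk.measurable hb ha]
  calc _ ≤ kernelForm k a a + kernelForm k a b +
        (kernelForm (fun z => k (-z)) a b + kernelForm k b b) +
        ENNReal.ofReal S * (m * ∫⁻ x, e x) +
        ENNReal.ofReal S * ((∫⁻ x, e x) * (m + ∫⁻ x, e x)) := by gcongr
    _ = _ := by ring

theorem interaction_add_le (hk : IsBoundedKernel k S ρ) (u v : L2 d) {m : ℝ≥0∞}
    (hm : ENNReal.ofReal (‖u‖ ^ 2) + ENNReal.ofReal (‖v‖ ^ 2) ≤ m) :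
    interaction (volume.withDensity k) (u + v : L2 d) ≤
      interaction (volume.withDensity k) u + interaction (volume.withDensity k) v +
      (kernelForm k (fun x => ‖u x‖ₑ ^ 2) (fun x => ‖v x‖ₑ ^ 2) +
        kernelForm (fun z => k (-z)) (fun x => ‖u x‖ₑ ^ 2) (fun x => ‖v x‖ₑ ^ 2) +
        ENNReal.ofReal S * ((∫⁻ x, 2 * (‖u x‖ₑ * ‖v x‖ₑ)) *
          (m + m + ∫⁻ x, 2 * (‖u x‖ₑ * ‖v x‖ₑ)))) := by
  have := measurable_coe u
  have := measurable_coe v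
  have hpointwise : (fun x => ‖(u + v : L2 d) x‖ₑ ^ 2) ≤ᵐ[volume]
      (fun x => ‖u x‖ₑ ^ 2) + (fun x => ‖v x‖ₑ ^ 2) + fun x => 2 * (‖u x‖ₑ * ‖v x‖ₑ) := by
    filter_upwards [Lp.coeFn_add u v] with x hx
    calc ‖(u + v : L2 d) x‖ₑ ^ 2 ≤ (‖u x‖ₑ + ‖v x‖ₑ) ^ 2 := by
          rw [hx, Pi.add_apply]
          gcongr
          exact enorm_add_le _ _
      _ = ‖u x‖ₑ ^ 2 + ‖v x‖ₑ ^ 2 + 2 * (‖u x‖ₑ * ‖v x‖ₑ) := by ring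
  have hexpand := (kernelForm_mono_ae hpointwise hpointwise).trans
    (hk.kernelForm_add_add_le (m := m) (by fun_prop) (by fun_prop) (by fun_prop) (by
      simp only [Pi.add_apply]
      rwa [lintegral_add_left (by fun_prop), lintegral_enorm_sq, lintegral_enorm_sq]))
  simp_rw [interaction_withDensity hk.measurable, ← mul_add]
  refine (mul_le_mul_right hexpand _).trans ?_
  rw [mul_add]
  gcongr
  exact mul_le_of_le_one_left' (by simp)

theorem eventually_interaction_add_le (hk : IsBoundedKernel k S ρ) (u : L2 d) {r : ℕ → L2 d}
    {R : ℝ} (hrR : ∀ n, ‖r n‖ ≤ R) (hloc : TendstoZeroLocally r) {η : ℝ≥0∞} (hη : 0 < η) :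
    ∀ᶠ n in atTop, interaction (volume.withDensity k) (u + r n : L2 d) ≤
      interaction (volume.withDensity k) u + interaction (volume.withDensity k) (r n) + η := by
  have := measurable_coe u
  have hr n : Measurable fun x => ‖r n x‖ₑ ^ 2 := (measurable_coe (r n)).enorm.pow_const 2
  have hnorm n : ENNReal.ofReal (‖r n‖ ^ 2) ≤ ENNReal.ofReal (R ^ 2) := by
    gcongr
    exact hrR n
  have hform {k : Space d → ℝ≥0∞} (hk : IsBoundedKernel k S ρ) : Tendsto
      (fun n => kernelForm k (fun x => ‖u x‖ₑ ^ 2) fun x => ‖r n x‖ₑ ^ 2) atTop (𝓝 0) :=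
    hk.tendsto_kernelForm_zero (by fun_prop)
      (by rw [lintegral_enorm_sq]; exact ENNReal.ofReal_ne_top) hr ENNReal.ofReal_ne_top
      (fun n => (lintegral_enorm_sq (r n)).trans_le (hnorm n))
      fun x => hloc.tendsto_setLIntegral x ρ
  have hcross : Tendsto (fun n => ∫⁻ x, 2 * (‖u x‖ₑ * ‖r n x‖ₑ)) atTop (𝓝 0) := by
    simp_rw [lintegral_const_mul' _ _ ENNReal.ofNat_ne_top]
    simpa only [mul_zero] using ENNReal.Tendsto.const_mul
      (hloc.tendsto_lintegral_enorm_mul_enorm hrR u) (.inr (ENNReal.ofNat_ne_top (n := 2)))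
  set m := ENNReal.ofReal (‖u‖ ^ 2) + ENNReal.ofReal (R ^ 2)
  have hm : m + m ≠ ⊤ := by simp [m]
  have hcross_mul := ENNReal.Tendsto.const_mul
    (ENNReal.Tendsto.mul hcross (.inr (by simpa using hm)) (hcross.const_add (m + m))
      (.inr ENNReal.zero_ne_top)) (.inr (ENNReal.ofReal_ne_top (r := S)))
  have herror := ((hform hk).add (hform hk.comp_neg)).add hcross_mul
  simp only [zero_mul, mul_zero, add_zero] at herror
  filter_upwards [ENNReal.tendsto_nhds_zero.1 herror η hη] with n hn
  exact (hk.interaction_add_le u (r n) (add_le_add_right (hnorm n) _)).trans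
    (add_le_add_right hn _)

theorem interaction_le_of_setLIntegral_le (hk : IsBoundedKernel k S ρ) {c : ℝ} (hc : 0 ≤ c)
    (u : L2 d) (h : ∀ z, ∫⁻ x in Metric.closedBall z ρ, ‖u x‖ₑ ^ 2 ≤ ENNReal.ofReal c) :
    interaction (volume.withDensity k) u ≤ ENNReal.ofReal (S * c * ‖u‖ ^ 2 / 2) := by
  have := measurable_coe u
  have := hk.measurable
  refine interaction_le_of_potential_le _ u (mul_nonneg hk.nonneg hc) (ae_of_all _ fun x => ?_)
  rw [potential_withDensity hk.measurable, weightedNorm_sq (by fun_prop),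
    ENNReal.ofReal_mul hk.nonneg]
  refine (hk.lintegral_comp_sub_mul_le (by fun_prop) x).trans ?_
  gcongr
  exact h x

end IsBoundedKernel

theorem Tame.eventually_interaction_le {μ : Measure (Space d)} (hμ : Tame μ) {v : ℕ → L2 d}
    {h : ℕ → VectorL2 d} {u : L2 d} {g : VectorL2 d} (hv : ∀ n, HasGrad (v n) (h n))
    (hu : HasGrad u g) {R : ℝ} (hvR : ∀ n, ‖v n‖ ≤ R) (hhR : ∀ n, ‖h n‖ ≤ R)
    (hweak : WeaklyTendsto v u) {η : ℝ} (hη : 0 < η) :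
    ∀ᶠ n in atTop, interaction μ (v n) ≤
      interaction μ u + interaction μ (v n - u : L2 d) + ENNReal.ofReal η := by
  set R' := R + ‖u‖ + ‖g‖
  have hR : 0 ≤ R := (norm_nonneg _).trans (hvR 0)
  have hu0 := norm_nonneg u
  have hg0 := norm_nonneg g
  obtain ⟨k, S, ρ, hk, happrox⟩ := hμ.approx R' (η / 4) (by positivity)
  have hgrad n : HasGrad (v n - u) (h n - g) := (hv n).sub hu
  have hrR n : ‖v n - u‖ ≤ R' := (norm_sub_le _ _).trans (by linarith [hvR n])
  have hqR n : ‖h n - g‖ ≤ R' := (norm_sub_le _ _).trans (by linarith [hhR n])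
  have hsub : WeaklyTendsto (fun n => v n - u) 0 := by simpa only [sub_self] using hweak.sub_const u
  have hloc := tendstoZeroLocally_of_weaklyTendsto hgrad hrR hqR hsub
  have hη4 : 0 < ENNReal.ofReal (η / 4) := ENNReal.ofReal_pos.2 (by positivity)
  filter_upwards [hk.eventually_interaction_add_le u hrR hloc hη4] with n hn
  rw [add_sub_cancel] at hn
  have hvn := (happrox (v n) (h n) (hv n) (by linarith [hvR n]) (by linarith [hhR n])).1
  have hun := (happrox u g hu (by linarith) (by linarith)).2
  have hrn := (happrox (v n - u) (h n - g) (hgrad n) (hrR n) (hqR n)).2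
  calc interaction μ (v n)
      ≤ (interaction μ u + ENNReal.ofReal (η / 4)) +
        (interaction μ (v n - u : L2 d) + ENNReal.ofReal (η / 4)) + ENNReal.ofReal (η / 4) +
          ENNReal.ofReal (η / 4) := hvn.trans (by gcongr; exact hn.trans (by gcongr))
    _ = interaction μ u + interaction μ (v n - u : L2 d) +
        (ENNReal.ofReal (η / 4) + ENNReal.ofReal (η / 4) + ENNReal.ofReal (η / 4) +
          ENNReal.ofReal (η / 4)) := by ring
    _ = interaction μ u + interaction μ (v n - u : L2 d) + ENNReal.ofReal η := by
        simp_rw [← ENNReal.ofReal_add (show 0 ≤ η / 4 by positivity)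
          (show 0 ≤ η / 4 by positivity)]
        rw [← ENNReal.ofReal_add (by positivity) (by positivity),
          ← ENNReal.ofReal_add (by positivity) (by positivity)]
        ring_nf

end Splitting

section Compactness

variable {d : ℕ}

theorem setLIntegral_closedBall_translate (z : Space d) (u : L2 d) (ρ : ℝ) :
    ∫⁻ x in Metric.closedBall 0 ρ, ‖translate z u x‖ₑ ^ 2 =
      ∫⁻ x in Metric.closedBall z ρ, ‖u x‖ₑ ^ 2 := by
  have hball : Metric.closedBall (0 : Space d) ρ = (· + z) ⁻¹' Metric.closedBall z ρ := by
    ext x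
    simp [dist_eq_norm]
  rw [← (measurePreserving_add_right volume z).setLIntegral_comp_preimage
    Metric.isClosed_closedBall.measurableSet ((measurable_coe u).enorm.pow_const 2), ← hball]
  refine lintegral_congr_ae ?_
  filter_upwards [ae_restrict_of_ae (coeFn_translate z u)] with x hx
  rw [hx]

theorem toReal_interaction_smul (μ : Measure (Space d)) [SFinite μ] (c : ℝ) (u : L2 d) :
    (interaction μ (c • u : L2 d)).toReal = c ^ 4 * (interaction μ u).toReal := by
  have hpotential x : potential μ (c • (u : Space d → ℝ)) x = ‖c‖ₑ ^ 2 * potential μ u x := by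
    unfold potential
    rw [← lintegral_const_mul' _ _ (by simp)]
    simp only [Pi.smul_apply, smul_eq_mul, enorm_mul, mul_pow]
  have hinteraction : interaction μ (c • u : L2 d) = ‖c‖ₑ ^ 4 * interaction μ u := by
    rw [interaction_congr_ae μ (Lp.coeFn_smul c u), interaction_eq, interaction_eq, mul_left_comm,
      ← lintegral_const_mul' (‖c‖ₑ ^ 4) _ (by simp)]
    congr! 3 with x
    rw [hpotential, Pi.smul_apply, smul_eq_mul, enorm_mul]
    ring
  rw [hinteraction, ENNReal.toReal_mul, ENNReal.toReal_pow, toReal_enorm, Real.norm_eq_abs,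
    Even.pow_abs (by decide)]

theorem WeaklyTendsto.tendsto_norm_sub_sq {H : Type*} [NormedAddCommGroup H]
    [InnerProductSpace ℝ H] {x : ℕ → H} {a : H} (hx : WeaklyTendsto x a) {m : ℝ}
    (hnorm : ∀ n, ‖x n‖ = m) :
    Tendsto (fun n => ‖x n - a‖ ^ 2) atTop (𝓝 (m ^ 2 - ‖a‖ ^ 2)) := by
  have hlim := (((hx a).const_mul 2).const_sub (m ^ 2)).add_const (‖a‖ ^ 2)
  rw [real_inner_self_eq_norm_sq] at hlim
  convert hlim using 2 with n
  · rw [norm_sub_sq_real, hnorm, real_inner_comm]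
  · ring

theorem tendsto_of_tendsto_norm_sub_sq {E : Type*} [NormedAddCommGroup E] {x : ℕ → E} {a : E}
    (h : Tendsto (fun n => ‖x n - a‖ ^ 2) atTop (𝓝 0)) : Tendsto x atTop (𝓝 a) := by
  rw [tendsto_iff_norm_sub_tendsto_zero]
  simpa [Function.comp_def] using (Real.continuous_sqrt.tendsto 0).comp h

/-- The energy of a function `u` of `H¹` with gradient `g`, as a real number. -/
def sobolevEnergy (κ : ℝ) (μ : Measure (Space d)) (u : L2 d) (g : VectorL2 d) : ℝ :=
  (interaction μ u).toReal - κ * ‖g‖ ^ 2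

theorem sobolevEnergy_translate (κ : ℝ) (μ : Measure (Space d)) [SFinite μ] (u : L2 d)
    (g : VectorL2 d) (z : Space d) :
    sobolevEnergy κ μ (translate z u) (translate z g) = sobolevEnergy κ μ u g := by
  unfold sobolevEnergy
  rw [interaction_translate, LinearIsometry.norm_map]

theorem norm_grad_le_of_le_sobolevEnergy {μ : Measure (Space d)} {κ C b : ℝ} (hκ : 0 < κ)
    {u : L2 d} {g : VectorL2 d} (hnorm : ‖u‖ = 1)
    (hinteraction : (interaction μ u).toReal ≤ (C * ‖u‖ ^ 2 + κ / 2 * ‖g‖ ^ 2) * ‖u‖ ^ 2)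
    (hb : b ≤ sobolevEnergy κ μ u g) : ‖g‖ ≤ √(2 * (C - b) / κ) := by
  refine Real.le_sqrt_of_sq_le ?_
  rw [hnorm] at hinteraction
  unfold sobolevEnergy at hb
  rw [le_div_iff₀ hκ]
  linarith

namespace Tame

variable {μ : Measure (Space d)}

theorem interaction_ne_top (hμ : Tame μ) {u : L2 d} {g : VectorL2 d} (hu : HasGrad u g) :
    interaction μ u ≠ ⊤ := by
  obtain ⟨C, -, hC⟩ := hμ.coercive 1 one_pos
  exact ((hC u g hu).trans_lt ENNReal.ofReal_lt_top).ne

theorem toReal_interaction_le (hμ : Tame μ) {τ : ℝ} (hτ : 0 < τ) : ∃ C : ℝ, 0 ≤ C ∧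
    ∀ (u : L2 d) (g : VectorL2 d), HasGrad u g →
      (interaction μ u).toReal ≤ (C * ‖u‖ ^ 2 + τ * ‖g‖ ^ 2) * ‖u‖ ^ 2 := by
  obtain ⟨C, hC, hle⟩ := hμ.coercive τ hτ
  exact ⟨C, hC, fun u g hu => ENNReal.toReal_le_of_le_ofReal (by positivity) (hle u g hu)⟩

theorem exists_norm_grad_le (hμ : Tame μ) {κ : ℝ} (hκ : 0 < κ) (b : ℝ) : ∃ R : ℝ,
    ∀ (u : L2 d) (g : VectorL2 d), HasGrad u g → ‖u‖ = 1 → b ≤ sobolevEnergy κ μ u g →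
      ‖g‖ ≤ R := by
  obtain ⟨C, -, hC⟩ := hμ.toReal_interaction_le (half_pos hκ)
  exact ⟨_, fun u g hu hnorm => norm_grad_le_of_le_sobolevEnergy hκ hnorm (hC u g hu)⟩

theorem exists_mass_lower_bound (hμ : Tame μ) {κ M : ℝ} (hκ : 0 < κ) (hM : 0 < M) (R : ℝ) :
    ∃ c ρ : ℝ, 0 < c ∧ ∀ (u : L2 d) (g : VectorL2 d), HasGrad u g → ‖u‖ = 1 → ‖g‖ ≤ R →
      M / 2 ≤ sobolevEnergy κ μ u g →
      ∃ z, ENNReal.ofReal c < ∫⁻ x in Metric.closedBall z ρ, ‖u x‖ₑ ^ 2 := by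
  obtain ⟨k, S, ρ, hk, happrox⟩ := hμ.approx (max R 1) (M / 8) (by linarith)
  have hS := hk.nonneg
  have hc : 0 < M / (4 * (S + 1)) := by positivity
  refine ⟨M / (4 * (S + 1)), ρ, hc, fun u g hu hnorm hgR henergy => ?_⟩
  by_contra! hvanish
  have hinteraction := (happrox u g hu (hnorm.trans_le (le_max_right _ _))
    (hgR.trans (le_max_left _ _))).1.trans
    (add_le_add_left (hk.interaction_le_of_setLIntegral_le hc.le u hvanish) _)
  rw [← ENNReal.ofReal_add (by positivity) (by positivity), hnorm] at hinteraction
  replace hinteraction := ENNReal.toReal_le_of_le_ofReal (by positivity) hinteraction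
  have hSc : S * (M / (4 * (S + 1))) ≤ M / 4 := by
    rw [← mul_div_assoc, div_le_div_iff₀ (by positivity) (by norm_num)]
    nlinarith
  have hgradient : 0 ≤ κ * ‖g‖ ^ 2 := by positivity
  unfold sobolevEnergy at henergy
  linarith

theorem exists_translated_weak_limit (hμ : Tame μ) {κ M : ℝ} (hκ : 0 < κ) (hM : 0 < M)
    {v : ℕ → L2 d} {h : ℕ → VectorL2 d} (hv : ∀ n, HasGrad (v n) (h n)) (hnorm : ∀ n, ‖v n‖ = 1)
    {R : ℝ} (hhR : ∀ n, ‖h n‖ ≤ R) (henergy : ∀ n, M / 2 ≤ sobolevEnergy κ μ (v n) (h n)) :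
    ∃ (φ : ℕ → ℕ) (z : ℕ → Space d) (u : L2 d) (g : VectorL2 d), StrictMono φ ∧ u ≠ 0 ∧
      WeaklyTendsto (fun n => translate (z n) (v (φ n))) u ∧
      WeaklyTendsto (fun n => translate (z n) (h (φ n))) g := by
  obtain ⟨c, ρ, hc, hmass⟩ := hμ.exists_mass_lower_bound hκ hM R
  have : Fact ((2 : ℝ≥0∞) ≠ ⊤) := ⟨ENNReal.ofNat_ne_top⟩
  choose z hz using fun n => hmass (v n) (h n) (hv n) (hnorm n) (hhR n) (henergy n)
  obtain ⟨u, φ₁, hφ₁, hu⟩ := exists_weaklyTendsto_subseq (x := fun n => translate (z n) (v n))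
    (R := 1) fun n => by rw [LinearIsometry.norm_map, hnorm]
  obtain ⟨g, φ₂, hφ₂, hg⟩ := exists_weaklyTendsto_subseq
    (x := fun n => translate (z (φ₁ n)) (h (φ₁ n))) (R := R) fun n => by
      rw [LinearIsometry.norm_map]
      exact hhR _
  refine ⟨φ₁ ∘ φ₂, z ∘ φ₁ ∘ φ₂, u, g, hφ₁.comp hφ₂, ?_, hu.comp hφ₂, hg⟩
  rintro rfl
  have hloc := tendstoZeroLocally_of_weaklyTendsto (fun n => (hv (φ₁ n)).translate (z (φ₁ n)))
    (R := max R 1) (fun n => by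
      rw [LinearIsometry.norm_map, hnorm]
      exact le_max_right _ _)
    (fun n => by
      rw [LinearIsometry.norm_map]
      exact (hhR _).trans (le_max_left _ _)) hu
  obtain ⟨n, hn⟩ := ((ENNReal.tendsto_nhds_zero.1 (hloc.tendsto_setLIntegral 0 ρ))
    _ (ENNReal.ofReal_pos.2 hc)).exists
  rw [setLIntegral_closedBall_translate] at hn
  exact (hz (φ₁ n)).not_ge hn

/-- By the quartic homogeneity of the interaction, mass below `1` is strictly penalized; this
excludes the splitting of maximizing sequences. -/
theorem sobolevEnergy_le_norm_pow_four_mul [SFinite μ] (hμ : Tame μ) {κ M : ℝ} (hκ : 0 < κ)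
    (hM : ∀ (u : L2 d) (g : VectorL2 d), HasGrad u g → ‖u‖ = 1 → sobolevEnergy κ μ u g ≤ M)
    {u : L2 d} {g : VectorL2 d} (hu : HasGrad u g) (hnorm : ‖u‖ ≤ 1) :
    sobolevEnergy κ μ u g ≤ ‖u‖ ^ 4 * M := by
  have hgradient : 0 ≤ κ * ‖g‖ ^ 2 := by positivity
  rcases eq_or_ne u 0 with rfl | hne
  · obtain ⟨C, -, hC⟩ := hμ.toReal_interaction_le one_pos
    have hinteraction := hC 0 g hu
    simp only [sobolevEnergy, norm_zero] at hinteraction ⊢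
    linarith
  · have hpos : 0 < ‖u‖ := norm_pos_iff.2 hne
    have hunit := hM _ _ (hu.smul ‖u‖⁻¹) (norm_smul_inv_norm hne)
    unfold sobolevEnergy at hunit ⊢
    rw [toReal_interaction_smul, norm_smul, norm_inv, norm_norm] at hunit
    calc (interaction μ u).toReal - κ * ‖g‖ ^ 2
        ≤ (interaction μ u).toReal - ‖u‖ ^ 2 * (κ * ‖g‖ ^ 2) :=
          sub_le_sub_left (mul_le_of_le_one_left hgradient (pow_le_one₀ hpos.le hnorm)) _
      _ = ‖u‖ ^ 4 *
          (‖u‖⁻¹ ^ 4 * (interaction μ u).toReal - κ * (‖u‖⁻¹ * ‖g‖) ^ 2) := by field_simp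
      _ ≤ ‖u‖ ^ 4 * M := by gcongr

theorem eventually_sobolevEnergy_le (hμ : Tame μ) (κ : ℝ) {v : ℕ → L2 d} {h : ℕ → VectorL2 d}
    {u : L2 d} {g : VectorL2 d} (hv : ∀ n, HasGrad (v n) (h n)) (hu : HasGrad u g) {R : ℝ}
    (hvR : ∀ n, ‖v n‖ ≤ R) (hhR : ∀ n, ‖h n‖ ≤ R) (hvu : WeaklyTendsto v u)
    (hhg : WeaklyTendsto h g) {η : ℝ} (hη : 0 < η) :
    ∀ᶠ n in atTop, sobolevEnergy κ μ (v n) (h n) ≤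
      sobolevEnergy κ μ u g + sobolevEnergy κ μ (v n - u) (h n - g) + η := by
  have hcross : Tendsto (fun n => 2 * κ * (inner ℝ g (h n) - ‖g‖ ^ 2)) atTop (𝓝 0) := by
    have hlim := ((hhg g).sub_const (‖g‖ ^ 2)).const_mul (2 * κ)
    rwa [real_inner_self_eq_norm_sq, sub_self, mul_zero] at hlim
  filter_upwards [hμ.eventually_interaction_le hv hu hvR hhR hvu (half_pos hη),
    hcross.eventually (lt_mem_nhds (neg_lt_zero.2 (half_pos hη)))] with n hinteraction hinner
  have hu_top := hμ.interaction_ne_top hu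
  have hr_top := hμ.interaction_ne_top ((hv n).sub hu)
  have hreal := ENNReal.toReal_mono (by finiteness) hinteraction
  rw [ENNReal.toReal_add (by finiteness) ENNReal.ofReal_ne_top,
    ENNReal.toReal_add hu_top hr_top, ENNReal.toReal_ofReal (half_pos hη).le] at hreal
  have hgrad_sq : ‖h n - g‖ ^ 2 = ‖h n‖ ^ 2 - 2 * inner ℝ g (h n) + ‖g‖ ^ 2 := by
    rw [norm_sub_sq_real, real_inner_comm]
  unfold sobolevEnergy
  rw [hgrad_sq]
  linarith

theorem norm_weak_limit_eq_one [SFinite μ] (hμ : Tame μ) {κ M : ℝ} (hκ : 0 < κ) (hM0 : 0 < M)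
    (hM : ∀ (u : L2 d) (g : VectorL2 d), HasGrad u g → ‖u‖ = 1 → sobolevEnergy κ μ u g ≤ M)
    {v : ℕ → L2 d} {h : ℕ → VectorL2 d} {u : L2 d} {g : VectorL2 d}
    (hv : ∀ n, HasGrad (v n) (h n)) (hu : HasGrad u g) (hnorm : ∀ n, ‖v n‖ = 1) (hne : u ≠ 0)
    {R : ℝ} (hhR : ∀ n, ‖h n‖ ≤ R) (hvu : WeaklyTendsto v u) (hhg : WeaklyTendsto h g)
    (hlim : Tendsto (fun n => sobolevEnergy κ μ (v n) (h n)) atTop (𝓝 M)) : ‖u‖ = 1 := by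
  have hpos : 0 < ‖u‖ ^ 2 := by positivity
  have hsq := hvu.tendsto_norm_sub_sq hnorm
  rw [one_pow] at hsq
  have hle : ‖u‖ ^ 2 ≤ 1 := sub_nonneg.1 (ge_of_tendsto' hsq fun n => sq_nonneg _)
  have hnorm_le : ‖u‖ ≤ 1 := (sq_le_one_iff₀ (norm_nonneg u)).1 hle
  have hremainder : ∀ᶠ n in atTop, ‖v n - u‖ ≤ 1 := by
    filter_upwards [hsq.eventually (gt_mem_nhds (sub_lt_self 1 hpos))] with n hn
    exact (sq_le_one_iff₀ (norm_nonneg _)).1 hn.le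
  have hsplit : M ≤ ‖u‖ ^ 4 * M + (1 - ‖u‖ ^ 2) ^ 2 * M := by
    refine le_of_forall_pos_le_add fun η hη => le_of_tendsto_of_tendsto hlim
      ((((hsq.pow 2).mul_const M).const_add (‖u‖ ^ 4 * M)).add_const η) ?_
    filter_upwards [hμ.eventually_sobolevEnergy_le κ hv hu (R := max R 1)
      (fun n => (hnorm n).trans_le (le_max_right _ _))
      (fun n => (hhR n).trans (le_max_left _ _)) hvu hhg hη, hremainder] with n hn hrn
    have hu_le := hμ.sobolevEnergy_le_norm_pow_four_mul hκ hM hu hnorm_le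
    have hr_le := hμ.sobolevEnergy_le_norm_pow_four_mul hκ hM ((hv n).sub hu) hrn
    rw [show (‖v n - u‖ ^ 2) ^ 2 = ‖v n - u‖ ^ 4 by ring]
    linarith
  have hconvex : 1 ≤ ‖u‖ ^ 4 + (1 - ‖u‖ ^ 2) ^ 2 :=
    le_of_mul_le_mul_right (by linarith) hM0
  have hge : 1 ≤ ‖u‖ ^ 2 := by nlinarith
  exact (pow_eq_one_iff_of_nonneg (norm_nonneg u) two_ne_zero).1 (le_antisymm hle hge)

theorem tendsto_toReal_interaction_zero (hμ : Tame μ) {r : ℕ → L2 d} {q : ℕ → VectorL2 d}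
    (hr : ∀ n, HasGrad (r n) (q n)) {R : ℝ} (hqR : ∀ n, ‖q n‖ ≤ R)
    (hlim : Tendsto (fun n => ‖r n‖ ^ 2) atTop (𝓝 0)) :
    Tendsto (fun n => (interaction μ (r n)).toReal) atTop (𝓝 0) := by
  obtain ⟨C, -, hC⟩ := hμ.toReal_interaction_le one_pos
  have hbound : Tendsto (fun n => (C * ‖r n‖ ^ 2 + R ^ 2) * ‖r n‖ ^ 2) atTop (𝓝 0) := by
    simpa using ((hlim.const_mul C).add_const (R ^ 2)).mul hlim
  refine squeeze_zero (fun n => ENNReal.toReal_nonneg) (fun n => (hC _ _ (hr n)).trans ?_) hbound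
  rw [one_mul]
  gcongr
  exact hqR n

theorem tendsto_of_weaklyTendsto [SFinite μ] (hμ : Tame μ) {κ M : ℝ} (hκ : 0 < κ) (hM0 : 0 < M)
    (hM : ∀ (u : L2 d) (g : VectorL2 d), HasGrad u g → ‖u‖ = 1 → sobolevEnergy κ μ u g ≤ M)
    {v : ℕ → L2 d} {h : ℕ → VectorL2 d} {u : L2 d} {g : VectorL2 d}
    (hv : ∀ n, HasGrad (v n) (h n)) (hnorm : ∀ n, ‖v n‖ = 1) (hne : u ≠ 0)
    {R : ℝ} (hhR : ∀ n, ‖h n‖ ≤ R) (hvu : WeaklyTendsto v u) (hhg : WeaklyTendsto h g)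
    (hlim : Tendsto (fun n => sobolevEnergy κ μ (v n) (h n)) atTop (𝓝 M)) :
    HasGrad u g ∧ ‖u‖ = 1 ∧ sobolevEnergy κ μ u g = M ∧ Tendsto v atTop (𝓝 u) ∧
      Tendsto h atTop (𝓝 g) := by
  have hu : HasGrad u g := .of_tendsto_inner hv hvu hhg
  have hu1 := hμ.norm_weak_limit_eq_one hκ hM0 hM hv hu hnorm hne hhR hvu hhg hlim
  have hsq : Tendsto (fun n => ‖v n - u‖ ^ 2) atTop (𝓝 0) := by
    simpa [hu1] using hvu.tendsto_norm_sub_sq hnorm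
  have hinteraction := hμ.tendsto_toReal_interaction_zero (fun n => (hv n).sub hu) (R := R + ‖g‖)
    (fun n => (norm_sub_le _ _).trans (add_le_add_left (hhR n) _)) hsq
  have hgrad_le {η : ℝ} (hη : 0 < η) :
      ∀ᶠ n in atTop, κ * ‖h n - g‖ ^ 2 ≤ sobolevEnergy κ μ u g - M + η := by
    have hη3 : 0 < η / 3 := by positivity
    filter_upwards [hμ.eventually_sobolevEnergy_le κ hv hu (R := max R 1)
      (fun n => (hnorm n).trans_le (le_max_right _ _))
      (fun n => (hhR n).trans (le_max_left _ _)) hvu hhg hη3,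
      hinteraction.eventually (gt_mem_nhds hη3),
      hlim.eventually (lt_mem_nhds (sub_lt_self M hη3))] with n hsplit hn henergy
    rw [sobolevEnergy.eq_def κ μ (v n - u)] at hsplit
    linarith
  have hEu : sobolevEnergy κ μ u g = M := by
    refine le_antisymm (hM u g hu hu1) (le_of_forall_pos_le_add fun η hη => ?_)
    obtain ⟨n, hn⟩ := (hgrad_le hη).exists
    have hgradient : 0 ≤ κ * ‖h n - g‖ ^ 2 := by positivity
    linarith
  refine ⟨hu, hu1, hEu, tendsto_of_tendsto_norm_sub_sq hsq, tendsto_of_tendsto_norm_sub_sq <|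
    tendsto_order.2 ⟨fun a ha => .of_forall fun n => ha.trans_le (sq_nonneg _), fun a ha => ?_⟩⟩
  filter_upwards [hgrad_le (η := κ * (a / 2)) (by positivity)] with n hn
  rw [hEu, sub_self, zero_add] at hn
  exact (le_of_mul_le_mul_left hn hκ).trans_lt (half_lt_self ha)

theorem exists_maximizer_of_maximizing [SFinite μ] (hμ : Tame μ) {κ M : ℝ} (hκ : 0 < κ)
    (hM0 : 0 < M)
    (hM : ∀ (u : L2 d) (g : VectorL2 d), HasGrad u g → ‖u‖ = 1 → sobolevEnergy κ μ u g ≤ M)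
    {v : ℕ → L2 d} {h : ℕ → VectorL2 d} (hv : ∀ n, HasGrad (v n) (h n)) (hnorm : ∀ n, ‖v n‖ = 1)
    (hlim : Tendsto (fun n => sobolevEnergy κ μ (v n) (h n)) atTop (𝓝 M)) :
    ∃ (φ : ℕ → ℕ) (z : ℕ → Space d) (u : L2 d) (g : VectorL2 d), StrictMono φ ∧ HasGrad u g ∧
      ‖u‖ = 1 ∧ sobolevEnergy κ μ u g = M ∧
      Tendsto (fun n => translate (z n) (v (φ n))) atTop (𝓝 u) ∧
      Tendsto (fun n => translate (z n) (h (φ n))) atTop (𝓝 g) := by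
  obtain ⟨R, hR⟩ := hμ.exists_norm_grad_le hκ (M / 2)
  obtain ⟨φ₀, hφ₀, henergy⟩ :=
    extraction_of_eventually_atTop (hlim.eventually (le_mem_nhds (half_lt_self hM0)))
  have hhR n : ‖h (φ₀ n)‖ ≤ R := hR _ _ (hv _) (hnorm _) (henergy n)
  obtain ⟨φ, z, u, g, hφ, hne, hvu, hhg⟩ := hμ.exists_translated_weak_limit hκ hM0
    (v := v ∘ φ₀) (h := h ∘ φ₀) (fun n => hv _) (fun n => hnorm _) hhR henergy
  have hφ' := hφ₀.comp hφ
  refine ⟨φ₀ ∘ φ, z, u, g, hφ', hμ.tendsto_of_weaklyTendsto hκ hM0 hM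
    (fun n => (hv _).translate (z n)) (fun n => ?_) hne (R := R) (fun n => ?_) hvu hhg ?_⟩
  · rw [LinearIsometry.norm_map]
    exact hnorm _
  · rw [LinearIsometry.norm_map]
    exact hhR _
  · simp only [sobolevEnergy_translate]
    exact hlim.comp hφ'.tendsto_atTop

end Tame

end Compactness

section GaussianTrial

variable {d : ℕ}

theorem norm_toLp_sq_eq_integral {α F : Type*} [MeasurableSpace α] {μ : Measure α}
    [NormedAddCommGroup F] [InnerProductSpace ℝ F] {f : α → F} (hf : MemLp f 2 μ) :
    ‖hf.toLp f‖ ^ 2 = ∫ x, ‖f x‖ ^ 2 ∂μ := by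
  rw [← real_inner_self_eq_norm_sq, inner_toLp_eq_integral]
  refine integral_congr_ae ?_
  filter_upwards [hf.coeFn_toLp] with x hx
  rw [hx, real_inner_self_eq_norm_sq]

theorem isWeakGradient_of_contDiff {f : Space d → ℝ} {g : Space d → Space d}
    (hf : ContDiff ℝ 1 f) (hg : ∀ x, HasGradientAt f (g x) x) : IsWeakGradient f g := by
  have hdiff : Differentiable ℝ f := hf.differentiable one_ne_zero
  have hfderiv (x v : Space d) : inner ℝ (g x) v = fderiv ℝ f x v := by
    rw [(hg x).hasFDerivAt.fderiv, InnerProductSpace.toDual_apply_apply]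
  have hg_eq : g = fun x => (InnerProductSpace.toDual ℝ (Space d)).symm (fderiv ℝ f x) :=
    funext fun x => (hg x).gradient.symm
  have hg_cont : Continuous g := by
    rw [hg_eq]
    exact (LinearIsometryEquiv.continuous _).comp (hf.continuous_fderiv one_ne_zero)
  refine ⟨hf.continuous.locallyIntegrable, hg_cont.locallyIntegrable, fun φ hφ hc v => ?_⟩
  have hφ_diff : Differentiable ℝ φ := hφ.differentiable (by simp)
  have hφ_cont := hφ.continuous
  have hφ_fderiv : Continuous fun x => fderiv ℝ φ x v :=
    (hφ.continuous_fderiv (by simp)).clm_apply continuous_const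
  have hf_fderiv : Continuous fun x => fderiv ℝ f x v :=
    (hf.continuous_fderiv one_ne_zero).clm_apply continuous_const
  simp_rw [hfderiv]
  exact integral_mul_fderiv_eq_neg_fderiv_mul_of_integrable
    ((hf_fderiv.mul hφ_cont).integrable_of_hasCompactSupport hc.mul_left)
    ((hf.continuous.mul hφ_fderiv).integrable_of_hasCompactSupport
      (hc.fderiv_apply ℝ v).mul_left)
    ((hf.continuous.mul hφ_cont).integrable_of_hasCompactSupport hc.mul_left)
    (fun x _ => hdiff x) fun x _ => hφ_diff x

/-- The square root of the Gaussian density `p_s`, a normalized trial function for the variational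
problems. -/
def sqrtGaussian (d : ℕ) (s : ℝ) (x : Space d) : ℝ := √(gaussianKernel d s x)

/-- The gradient of `sqrtGaussian d s`. -/
def gradSqrtGaussian (d : ℕ) (s : ℝ) (x : Space d) : Space d :=
  (-(2 * s ^ 2)⁻¹ * sqrtGaussian d s x) • x

theorem sqrtGaussian_sq (s : ℝ) (x : Space d) : sqrtGaussian d s x ^ 2 = gaussianKernel d s x :=
  Real.sq_sqrt (gaussianKernel_nonneg s x)

theorem enorm_sq_sqrtGaussian (s : ℝ) (x : Space d) :
    ‖sqrtGaussian d s x‖ₑ ^ 2 = gaussianDensity d s x := by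
  rw [← ofReal_sq_eq_enorm_sq, sqrtGaussian_sq, gaussianDensity]

theorem norm_gradSqrtGaussian_sq (s : ℝ) (x : Space d) :
    ‖gradSqrtGaussian d s x‖ ^ 2 = (2 * s ^ 2)⁻¹ ^ 2 * (‖x‖ ^ 2 * gaussianKernel d s x) := by
  rw [gradSqrtGaussian, norm_smul, mul_pow, Real.norm_eq_abs, sq_abs, mul_pow, sqrtGaussian_sq]
  ring

theorem contDiff_gaussianKernel (s : ℝ) : ContDiff ℝ 1 (gaussianKernel d s) := by
  have : ContDiff ℝ 1 fun x : Space d => ‖x‖ ^ 2 := contDiff_norm_sq ℝ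
  unfold gaussianKernel
  fun_prop

theorem contDiff_sqrtGaussian {s : ℝ} (hs : 0 < s) : ContDiff ℝ 1 (sqrtGaussian d s) :=
  (contDiff_gaussianKernel s).sqrt fun x => (gaussianKernel_pos hs x).ne'

theorem hasGradientAt_gaussianKernel (s : ℝ) (x : Space d) :
    HasGradientAt (gaussianKernel d s) ((-(s ^ 2)⁻¹ * gaussianKernel d s x) • x) x := by
  have hderiv := (((hasStrictFDerivAt_norm_sq x).hasFDerivAt.neg.mul_const
    (2 * s ^ 2)⁻¹).exp).mul_const ((2 * Real.pi * s ^ 2) ^ ((d : ℝ) / 2))⁻¹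
  refine hasGradientAt_iff_hasFDerivAt.2 (hderiv.congr_fderiv ?_)
  ext v
  simp [gaussianKernel, div_eq_mul_inv]
  ring

theorem hasGradientAt_sqrtGaussian {s : ℝ} (hs : 0 < s) (x : Space d) :
    HasGradientAt (sqrtGaussian d s) (gradSqrtGaussian d s x) x := by
  have hpos := gaussianKernel_pos hs x
  have hderiv := (hasGradientAt_gaussianKernel s x).hasFDerivAt.sqrt hpos.ne'
  refine hasGradientAt_iff_hasFDerivAt.2 (hderiv.congr_fderiv ?_)
  have hcoeff : 1 / (2 * √(gaussianKernel d s x)) * (-(s ^ 2)⁻¹ * gaussianKernel d s x) =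
      -(2 * s ^ 2)⁻¹ * √(gaussianKernel d s x) := by
    have hsqrt := Real.sqrt_pos.2 hpos
    rw [← Real.sq_sqrt hpos.le, Real.sqrt_sq hsqrt.le]
    field_simp
  rw [gradSqrtGaussian, sqrtGaussian, ← hcoeff, mul_smul (1 / _), map_smul _ (1 / _)]

theorem memLp_sqrtGaussian {s : ℝ} (hs : 0 < s) : MemLp (sqrtGaussian d s) 2 := by
  rw [memLp_two_iff_integrable_sq (contDiff_sqrtGaussian hs).continuous.aestronglyMeasurable]
  simp_rw [sqrtGaussian_sq]
  exact integrable_gaussianKernel hs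

theorem integrable_norm_sq_mul_gaussianKernel {s : ℝ} (hs : 0 < s) :
    Integrable fun x : Space d => ‖x‖ ^ 2 * gaussianKernel d s x := by
  have := continuous_gaussianKernel (d := d) s
  refine ((integrable_gaussianKernel (ε := √2 * s) (by positivity)).const_mul
    ((momentConst d * s) ^ 2)).mono' (by fun_prop) (.of_forall fun x => ?_)
  rw [Real.norm_of_nonneg (mul_nonneg (sq_nonneg _) (gaussianKernel_nonneg s x))]
  exact norm_sq_mul_gaussianKernel_le_momentConst hs x

theorem integral_norm_sq_mul_gaussianKernel_le {s : ℝ} (hs : 0 < s) :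
    ∫ x : Space d, ‖x‖ ^ 2 * gaussianKernel d s x ≤ (momentConst d * s) ^ 2 := by
  have hs' : 0 < √2 * s := by positivity
  calc ∫ x : Space d, ‖x‖ ^ 2 * gaussianKernel d s x
      ≤ ∫ x : Space d, (momentConst d * s) ^ 2 * gaussianKernel d (√2 * s) x :=
        integral_mono (integrable_norm_sq_mul_gaussianKernel hs)
          ((integrable_gaussianKernel hs').const_mul _)
          (norm_sq_mul_gaussianKernel_le_momentConst hs)
    _ = (momentConst d * s) ^ 2 := by
        rw [integral_const_mul, integral_gaussianKernel hs', mul_one]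

theorem memLp_gradSqrtGaussian {s : ℝ} (hs : 0 < s) : MemLp (gradSqrtGaussian d s) 2 := by
  have hcont : Continuous (gradSqrtGaussian d s) := by
    have := (contDiff_sqrtGaussian (d := d) hs).continuous
    unfold gradSqrtGaussian
    fun_prop
  rw [← memLp_norm_iff hcont.aestronglyMeasurable,
    memLp_two_iff_integrable_sq hcont.norm.aestronglyMeasurable]
  simp_rw [norm_gradSqrtGaussian_sq]
  exact (integrable_norm_sq_mul_gaussianKernel hs).const_mul _

theorem hasGrad_sqrtGaussian {s : ℝ} (hs : 0 < s) :
    HasGrad ((memLp_sqrtGaussian (d := d) hs).toLp _)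
      ((memLp_gradSqrtGaussian (d := d) hs).toLp _) :=
  (isWeakGradient_of_contDiff (contDiff_sqrtGaussian hs)
    (hasGradientAt_sqrtGaussian hs)).hasGrad _ _

theorem norm_toLp_sqrtGaussian {s : ℝ} (hs : 0 < s) :
    ‖(memLp_sqrtGaussian (d := d) hs).toLp _‖ = 1 := by
  rw [← pow_eq_one_iff_of_nonneg (norm_nonneg _) two_ne_zero, norm_toLp_sq_eq_integral]
  simp only [Real.norm_eq_abs, sq_abs, sqrtGaussian_sq, integral_gaussianKernel hs]

theorem norm_toLp_gradSqrtGaussian_sq_le {s : ℝ} (hs : 0 < s) :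
    ‖(memLp_gradSqrtGaussian (d := d) hs).toLp _‖ ^ 2 ≤ momentConst d ^ 2 / s ^ 2 := by
  have hmoment := momentConst_pos d
  rw [norm_toLp_sq_eq_integral]
  simp only [norm_gradSqrtGaussian_sq, integral_const_mul]
  calc (2 * s ^ 2)⁻¹ ^ 2 * ∫ x : Space d, ‖x‖ ^ 2 * gaussianKernel d s x
      ≤ (2 * s ^ 2)⁻¹ ^ 2 * (momentConst d * s) ^ 2 := by
        gcongr
        exact integral_norm_sq_mul_gaussianKernel_le hs
    _ = momentConst d ^ 2 / s ^ 2 / 4 := by field_simp; norm_num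
    _ ≤ momentConst d ^ 2 / s ^ 2 := div_le_self (by positivity) (by norm_num)

theorem lintegral_mollifiedKernel_add_mul (γ : Measure (Space d)) [SFinite γ] {a b c : ℝ}
    (ha : 0 < a) (hb : 0 < b) (hc : 0 < c) (habc : c ^ 2 = a ^ 2 + b ^ 2) (x : Space d) :
    ∫⁻ h, mollifiedKernel γ a (x + h) * gaussianDensity d b h = mollifiedKernel γ c x := by
  simpa [gaussianConv, add_comm] using
    congrFun (gaussianConv_mollifiedKernel γ ha hb hc habc 0) (-x)

theorem potential_sqrtGaussian (γ : Measure (Space d)) [SFinite γ] {ε s c : ℝ} (hε : 0 < ε)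
    (hs : 0 < s) (hc : 0 < c) (hεsc : c ^ 2 = ε ^ 2 + s ^ 2) (x : Space d) :
    potential (mollifiedCov γ ε) (sqrtGaussian d s) x = mollifiedKernel γ c x := by
  have hmeas := measurable_mollifiedKernel γ ε
  rw [potential, mollifiedCov]
  simp only [enorm_sq_sqrtGaussian]
  rw [lintegral_withDensity_eq_lintegral_mul _ hmeas (by fun_prop),
    ← lintegral_mollifiedKernel_add_mul γ hε hs hc hεsc x, ← lintegral_add_left_eq_self _ x]
  simp only [Pi.mul_apply, sub_add_cancel_left, gaussianDensity_neg]

theorem interaction_sqrtGaussian (γ : Measure (Space d)) [SFinite γ] {ε s : ℝ} (hε : 0 < ε)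
    (hs : 0 < s) : interaction (mollifiedCov γ ε) (sqrtGaussian d s) =
      2⁻¹ * mollifiedKernel γ √(ε ^ 2 + 2 * s ^ 2) 0 := by
  have hsq : √(ε ^ 2 + s ^ 2) ^ 2 = ε ^ 2 + s ^ 2 := Real.sq_sqrt (by positivity)
  have hsq' : √(ε ^ 2 + 2 * s ^ 2) ^ 2 = √(ε ^ 2 + s ^ 2) ^ 2 + s ^ 2 := by
    rw [hsq, Real.sq_sqrt (by positivity)]
    ring
  rw [interaction_eq,
    ← lintegral_mollifiedKernel_add_mul γ (by positivity) hs (by positivity) hsq']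
  simp only [enorm_sq_sqrtGaussian, potential_sqrtGaussian γ hε hs (by positivity) hsq, zero_add,
    mul_comm]

end GaussianTrial

section VariationalConstant

variable {d : ℕ}

theorem MemH1.exists_hasGrad {f : Space d → ℝ} (hf : MemH1 f) :
    ∃ (u : L2 d) (g : VectorL2 d), HasGrad u g ∧ f =ᵐ[volume] u := by
  obtain ⟨hf2, g, hg, hfg⟩ := hf
  exact ⟨hf2.toLp f, hg.toLp g, hfg.hasGrad hf2 hg, hf2.coeFn_toLp.symm⟩

namespace HasGrad

variable {u : L2 d} {g : VectorL2 d} {f : Space d → ℝ}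

theorem memH1 (hu : HasGrad u g) (hf : f =ᵐ[volume] u) : MemH1 f :=
  ⟨(memLp_congr_ae hf).2 (Lp.memLp u), g, Lp.memLp g, IsWeakGradient.congr hf.symm .rfl hu⟩

theorem integral_norm_weakGrad_sq (hu : HasGrad u g) (hf : f =ᵐ[volume] u) :
    ∫ x, ‖weakGrad f x‖ ^ 2 = ‖g‖ ^ 2 := by
  have hgrad : weakGrad f =ᵐ[volume] g :=
    (IsWeakGradient.congr hf.symm .rfl hu).weakGrad_ae_eq
  conv_rhs => rw [← Lp.toLp_coeFn g (Lp.memLp g), norm_toLp_sq_eq_integral]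
  exact integral_congr_ae (hgrad.mono fun x hx => by simp only [hx])

theorem h1Norm_eq (hu : HasGrad u g) (hf : f =ᵐ[volume] u) :
    h1Norm f = √(‖u‖ ^ 2 + ‖g‖ ^ 2) := by
  rw [h1Norm, hu.integral_norm_weakGrad_sq hf]
  conv_rhs => rw [← Lp.toLp_coeFn u (Lp.memLp u), norm_toLp_sq_eq_integral]
  congr 2
  exact integral_congr_ae (hf.mono fun x hx => by simp only [hx, Real.norm_eq_abs, sq_abs])

end HasGrad

theorem eLpNorm_eq_one_iff {α E : Type*} [MeasurableSpace α] {μ : Measure α}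
    [NormedAddCommGroup E] {p : ℝ≥0∞} {u : Lp E p μ} {f : α → E} (hf : f =ᵐ[μ] u) :
    eLpNorm f p μ = 1 ↔ ‖u‖ = 1 := by
  rw [eLpNorm_congr_ae hf, Lp.norm_def, ENNReal.toReal_eq_one_iff]

/-- The energies of the pairs of a normalized function of `H¹` and its gradient. -/
def energySet (κ : ℝ) (μ : Measure (Space d)) : Set ℝ :=
  {e | ∃ (u : L2 d) (g : VectorL2 d), HasGrad u g ∧ ‖u‖ = 1 ∧ e = sobolevEnergy κ μ u g}

/-- The variational constant `varConst κ μ` as a real number; it is meaningful for measures `μ` for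
which the energies are finite and bounded above. -/
def maxEnergy (κ : ℝ) (μ : Measure (Space d)) : ℝ := sSup (energySet κ μ)

theorem energySet_nonempty (κ : ℝ) (μ : Measure (Space d)) : (energySet κ μ).Nonempty :=
  ⟨_, _, _, hasGrad_sqrtGaussian one_pos, norm_toLp_sqrtGaussian one_pos, rfl⟩

theorem maxEnergy_le {κ M : ℝ} {μ : Measure (Space d)}
    (hM : ∀ (u : L2 d) (g : VectorL2 d), HasGrad u g → ‖u‖ = 1 → sobolevEnergy κ μ u g ≤ M) :
    maxEnergy κ μ ≤ M :=
  csSup_le (energySet_nonempty κ μ) fun _ ⟨u, g, hu, hnorm, he⟩ => he ▸ hM u g hu hnorm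

namespace Tame

variable {μ : Measure (Space d)} {κ : ℝ} {u : L2 d} {g : VectorL2 d} {f : Space d → ℝ}

theorem energy_eq [SFinite μ] (hμ : Tame μ) (κ : ℝ) (hu : HasGrad u g) (hf : f =ᵐ[volume] u) :
    energy κ μ f = sobolevEnergy κ μ u g := by
  rw [energy, hu.integral_norm_weakGrad_sq hf, interaction_congr_ae μ hf, sobolevEnergy,
    EReal.coe_sub, EReal.coe_ennreal_toReal (hμ.interaction_ne_top hu)]

theorem bddAbove_energySet (hμ : Tame μ) (hκ : 0 < κ) : BddAbove (energySet κ μ) := by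
  obtain ⟨C, -, hC⟩ := hμ.toReal_interaction_le hκ
  refine ⟨C, ?_⟩
  rintro e ⟨u, g, hu, hnorm, rfl⟩
  have hinteraction := hC u g hu
  rw [hnorm] at hinteraction
  unfold sobolevEnergy
  linarith

theorem sobolevEnergy_le_maxEnergy (hμ : Tame μ) (hκ : 0 < κ) (hu : HasGrad u g)
    (hnorm : ‖u‖ = 1) : sobolevEnergy κ μ u g ≤ maxEnergy κ μ :=
  le_csSup (hμ.bddAbove_energySet hκ) ⟨u, g, hu, hnorm, rfl⟩

theorem varConst_eq_maxEnergy [SFinite μ] (hμ : Tame μ) (hκ : 0 < κ) :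
    varConst κ μ = maxEnergy κ μ := by
  have himage : {e : EReal | ∃ f : Space d → ℝ, MemH1 f ∧ eLpNorm f 2 volume = 1 ∧
      e = energy κ μ f} = (↑) '' energySet κ μ := by
    ext e
    constructor
    · rintro ⟨f, hf, hnorm, rfl⟩
      obtain ⟨u, g, hu, hfu⟩ := hf.exists_hasGrad
      exact ⟨_, ⟨u, g, hu, (eLpNorm_eq_one_iff hfu).1 hnorm, rfl⟩, (hμ.energy_eq κ hu hfu).symm⟩
    · rintro ⟨_, ⟨u, g, hu, hnorm, rfl⟩, rfl⟩
      exact ⟨u, hu.memH1 .rfl, (eLpNorm_eq_one_iff .rfl).2 hnorm, (hμ.energy_eq κ hu .rfl).symm⟩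
  rw [varConst, himage, maxEnergy]
  exact (EReal.coe_strictMono.monotone.map_csSup_of_continuousAt
    continuous_coe_real_ereal.continuousAt (energySet_nonempty κ μ)
    (hμ.bddAbove_energySet hκ)).symm

theorem isMaximizer_iff [SFinite μ] (hμ : Tame μ) (hκ : 0 < κ) (hu : HasGrad u g)
    (hf : f =ᵐ[volume] u) :
    IsMaximizer κ μ f ↔ ‖u‖ = 1 ∧ sobolevEnergy κ μ u g = maxEnergy κ μ := by
  rw [IsMaximizer, hμ.varConst_eq_maxEnergy hκ, hμ.energy_eq κ hu hf, eLpNorm_eq_one_iff hf,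
    EReal.coe_eq_coe_iff]
  exact and_iff_right (hu.memH1 hf)

theorem exists_isMaximizer [SFinite μ] (hμ : Tame μ) (hκ : 0 < κ) (hpos : 0 < maxEnergy κ μ) :
    ∃ f, IsMaximizer κ μ f := by
  obtain ⟨e, -, -, hlim, hmem⟩ :=
    (isLUB_csSup (energySet_nonempty κ μ) (hμ.bddAbove_energySet hκ)).exists_seq_monotone_tendsto
      (energySet_nonempty κ μ)
  choose v h hv hnorm henergy using hmem
  obtain ⟨-, -, u, g, -, hu, hu1, hmax, -, -⟩ := hμ.exists_maximizer_of_maximizing hκ hpos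
    (fun _ _ => hμ.sobolevEnergy_le_maxEnergy hκ) hv hnorm (hlim.congr henergy)
  exact ⟨u, (hμ.isMaximizer_iff hκ hu .rfl).2 ⟨hu1, hmax⟩⟩

end Tame

namespace RegularCov

variable {γ : Measure (Space d)} {w A κ : ℝ}

theorem exists_ofReal_le_interaction_sqrtGaussian [SFinite γ] (hγ : RegularCov γ w A) :
    ∃ b : ℝ, 0 < b ∧ ∀ ε s : ℝ, ε ≤ s → (hs : 0 < s) → ENNReal.ofReal (b * s ^ (-w)) ≤
      interaction (scaledCov γ ε) ((memLp_sqrtGaussian (d := d) hs).toLp _) := by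
  obtain ⟨a, ha, hlower⟩ := hγ.lower
  refine ⟨2⁻¹ * (a * 2 ^ (-w)), by positivity, fun ε s hεs hs => ?_⟩
  have hmollified {ε : ℝ} (hε : 0 < ε) (hεs : ε ≤ s) :
      ENNReal.ofReal (2⁻¹ * (a * 2 ^ (-w)) * s ^ (-w)) ≤
        interaction (mollifiedCov γ ε) ((memLp_sqrtGaussian (d := d) hs).toLp _) := by
    have hscale : √(ε ^ 2 + 2 * s ^ 2) ≤ 2 * s := by
      refine Real.sqrt_le_iff.2 ⟨by positivity, ?_⟩
      nlinarith
    rw [interaction_congr_ae _ (memLp_sqrtGaussian hs).coeFn_toLp, interaction_sqrtGaussian γ hε hs,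
      mul_assoc, mul_assoc, ← Real.mul_rpow zero_le_two hs.le, ENNReal.ofReal_mul (by norm_num),
      ENNReal.ofReal_inv_of_pos two_pos, ENNReal.ofReal_ofNat]
    gcongr
    refine le_trans (ENNReal.ofReal_le_ofReal ?_) (hlower _ (by positivity))
    exact mul_le_mul_of_nonneg_left
      (Real.rpow_le_rpow_of_nonpos (by positivity) hscale (by linarith [hγ.w_pos])) ha.le
  rcases lt_or_ge 0 ε with hε | hε
  · rw [scaledCov_of_pos γ hε]
    exact hmollified hε hεs
  · rw [scaledCov_of_nonpos γ hε]
    refine ge_of_tendsto (hγ.tendsto_interaction (hasGrad_sqrtGaussian hs)) ?_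
    filter_upwards [Ioc_mem_nhdsGT hs] with r hr
    exact hmollified hr.1 hr.2

/-- Spreading the trial function over the scale `s → ∞` costs a gradient energy of order `s⁻²`,
which the interaction, of order `s ^ (-w)`, outweighs because `w < 2`. -/
theorem maxEnergy_scaledCov_pos [SFinite γ] (hγ : RegularCov γ w A) (hκ : 0 < κ) (ε : ℝ) :
    0 < maxEnergy κ (scaledCov γ ε) := by
  obtain ⟨b, hb, hlower⟩ := hγ.exists_ofReal_le_interaction_sqrtGaussian
  obtain ⟨s, hscale, hεs, hs⟩ := (((tendsto_rpow_atTop (sub_pos.2 hγ.w_lt)).eventually_gt_atTop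
    (κ * momentConst d ^ 2 / b)).and
      ((eventually_ge_atTop ε).and (eventually_gt_atTop 0))).exists
  have hgrad := hasGrad_sqrtGaussian (d := d) hs
  have htame := hγ.tame_scaledCov ε
  have hinteraction := (ENNReal.ofReal_le_iff_le_toReal (htame.interaction_ne_top hgrad)).1
    (hlower ε s hεs hs)
  have hgradient : κ * (momentConst d ^ 2 / s ^ 2) < b * s ^ (-w) := by
    rw [div_lt_iff₀ hb, Real.rpow_sub hs, Real.rpow_two] at hscale
    rw [← mul_div_assoc, div_lt_iff₀ (by positivity), Real.rpow_neg hs.le]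
    linarith [show s ^ 2 / s ^ w * b = b * (s ^ w)⁻¹ * s ^ 2 by ring]
  refine lt_of_lt_of_le ?_ (htame.sobolevEnergy_le_maxEnergy hκ hgrad (norm_toLp_sqrtGaussian hs))
  have hle := mul_le_mul_of_nonneg_left (norm_toLp_gradSqrtGaussian_sq_le (d := d) hs) hκ.le
  unfold sobolevEnergy
  linarith

end RegularCov

end VariationalConstant

section PowerConv

variable {E : Type*} [NormedAddCommGroup E] [MeasurableSpace E]

/-- The convolution of `G` with the power singularity `|x|^{-a}`. -/
def powerConv (μ : Measure E) (G : E → ℝ≥0∞) (a : ℝ) (x : E) : ℝ≥0∞ :=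
  ∫⁻ y, G (x - y) * ENNReal.ofReal (‖y‖ ^ (-a)) ∂μ

variable [BorelSpace E] {μ : Measure E} {G : E → ℝ≥0∞} {a : ℝ}

theorem powerConv_pos [μ.IsOpenPosMeasure] [Nontrivial E] (hG : Measurable G)
    (hGpos : ∀ z, 0 < G z) (a : ℝ) (x : E) : 0 < powerConv μ G a x := by
  have : Measurable fun y : E => G (x - y) * ENNReal.ofReal (‖y‖ ^ (-a)) := by fun_prop
  refine (lintegral_pos_iff_support this).2
    ((isOpen_compl_singleton.measure_pos μ (exists_ne (0 : E))).trans_le (measure_mono ?_))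
  intro y hy
  exact mul_ne_zero (hGpos _).ne'
    (ENNReal.ofReal_pos.2 (Real.rpow_pos_of_pos (norm_pos_iff.2 hy) _)).ne'

variable [NormedSpace ℝ E] [FiniteDimensional ℝ E] [μ.IsAddHaarMeasure]

theorem powerConv_le (hG : Measurable G) (ha : 0 ≤ a) {R : ℝ} (hR : 0 < R) {s : ℝ≥0∞} {x : E}
    (hs : ∀ y, ‖y‖ < R → G (x - y) ≤ s) :
    powerConv μ G a x ≤
      s * (∫⁻ y in Metric.ball (0 : E) R, ENNReal.ofReal (‖y‖ ^ (-a)) ∂μ) +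
        (∫⁻ z, G z ∂μ) * ENNReal.ofReal (R ^ (-a)) := by
  have hball : MeasurableSet (Metric.ball (0 : E) R) := Metric.isOpen_ball.measurableSet
  rw [powerConv, ← lintegral_add_compl _ hball]
  gcongr
  · rw [← lintegral_const_mul _ (by fun_prop)]
    refine setLIntegral_mono' hball fun y hy => ?_
    gcongr
    exact hs y (mem_ball_zero_iff.1 hy)
  · calc ∫⁻ y in (Metric.ball (0 : E) R)ᶜ, G (x - y) * ENNReal.ofReal (‖y‖ ^ (-a)) ∂μ
        ≤ ∫⁻ y in (Metric.ball (0 : E) R)ᶜ, G (x - y) * ENNReal.ofReal (R ^ (-a)) ∂μ := by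
          refine setLIntegral_mono' hball.compl fun y hy => ?_
          have hRy : R ≤ ‖y‖ := by simpa using hy
          exact mul_le_mul' le_rfl
            (ENNReal.ofReal_le_ofReal (Real.rpow_le_rpow_of_nonpos hR hRy (neg_nonpos.2 ha)))
      _ ≤ ∫⁻ y, G (x - y) * ENNReal.ofReal (R ^ (-a)) ∂μ := setLIntegral_le_lintegral _ _
      _ = (∫⁻ z, G z ∂μ) * ENNReal.ofReal (R ^ (-a)) := by
          rw [lintegral_mul_const _ (by fun_prop), lintegral_sub_left_eq_self]

variable [Nontrivial E]

theorem setLIntegral_ball_norm_rpow_lt_top (ha : a < Module.finrank ℝ E) {R : ℝ} (hR : 0 < R) :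
    ∫⁻ x in Metric.ball (0 : E) R, ENNReal.ofReal (‖x‖ ^ (-a)) ∂μ < ⊤ := by
  suffices h_int : IntegrableOn (fun x : E => ‖x‖ ^ (-a)) (Metric.ball (0 : E) R) μ from
    h_int.lintegral_lt_top
  refine (integrableOn_fun_norm_addHaar μ (f := fun t : ℝ => t ^ (-a))).2 ?_
  have hradial : IntegrableOn (fun t : ℝ => t ^ ((Module.finrank ℝ E : ℝ) - 1 - a))
      (Set.Ioo 0 R) :=
    (intervalIntegral.integrableOn_Ioo_rpow_iff hR).2 (by linarith)
  refine hradial.congr_fun (fun t ht => ?_) measurableSet_Ioo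
  dsimp only
  rw [smul_eq_mul, ← Real.rpow_natCast, ← Real.rpow_add ht.1, Nat.cast_sub Module.finrank_pos,
    Nat.cast_one, sub_eq_add_neg _ a]

theorem exists_powerConv_le (hG : Measurable G) (ha : 0 ≤ a) (had : a < Module.finrank ℝ E)
    {s : ℝ≥0∞} (hs : s ≠ ⊤) (hGs : ∀ z, G z ≤ s) (hGint : ∫⁻ z, G z ∂μ ≠ ⊤) :
    ∃ C : ℝ≥0∞, C ≠ ⊤ ∧ ∀ x, powerConv μ G a x ≤ C :=
  ⟨_, ENNReal.add_ne_top.2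
    ⟨ENNReal.mul_ne_top hs (setLIntegral_ball_norm_rpow_lt_top had one_pos).ne,
      ENNReal.mul_ne_top hGint ENNReal.ofReal_ne_top⟩,
    fun _ => powerConv_le hG ha one_pos fun _ _ => hGs _⟩

theorem tendsto_powerConv_cocompact (hG : Measurable G) (ha : 0 < a)
    (had : a < Module.finrank ℝ E) (hGint : ∫⁻ z, G z ∂μ ≠ ⊤)
    (hlim : Tendsto G (cocompact E) (𝓝 0)) :
    Tendsto (powerConv μ G a) (cocompact E) (𝓝 0) := by
  refine ENNReal.tendsto_nhds_zero.2 fun η hη => ?_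
  have htail : Tendsto (fun R : ℝ => (∫⁻ z, G z ∂μ) * ENNReal.ofReal (R ^ (-a))) atTop (𝓝 0) := by
    simpa using ENNReal.Tendsto.const_mul
      (ENNReal.tendsto_ofReal (tendsto_rpow_neg_atTop ha)) (.inr hGint)
  obtain ⟨R, hRη, hR⟩ := ((ENNReal.tendsto_nhds_zero.1 htail (η / 2)
    (ENNReal.half_pos hη.ne')).and (eventually_gt_atTop 0)).exists
  set J := ∫⁻ y in Metric.ball (0 : E) R, ENNReal.ofReal (‖y‖ ^ (-a)) ∂μ
  have hJ : J ≠ ⊤ := (setLIntegral_ball_norm_rpow_lt_top had hR).ne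
  rw [← Metric.cobounded_eq_cocompact] at hlim ⊢
  obtain ⟨r, -, hr⟩ := (hasBasis_cobounded_norm.eventually_iff).1
    (ENNReal.tendsto_nhds_zero.1 hlim (η / 2 / J)
      (ENNReal.div_pos (ENNReal.half_pos hη.ne').ne' hJ))
  refine hasBasis_cobounded_norm.eventually_iff.2 ⟨r + R, trivial, fun x hx => ?_⟩
  have hfar : ∀ y, ‖y‖ < R → G (x - y) ≤ η / 2 / J := fun y hy => hr (by
    have := norm_sub_norm_le x y
    simp only [Set.mem_ofPred_eq] at hx ⊢
    linarith)
  calc powerConv μ G a x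
      ≤ η / 2 / J * J + (∫⁻ z, G z ∂μ) * ENNReal.ofReal (R ^ (-a)) :=
        powerConv_le hG ha.le hR hfar
    _ ≤ η / 2 + η / 2 := add_le_add (ENNReal.mul_le_of_le_div le_rfl) hRη
    _ = η := ENNReal.add_halves η

end PowerConv

section Kernels

variable {d : ℕ}

theorem mollifiedKernel_smul (c : ℝ≥0∞) (γ : Measure (Space d)) (ε : ℝ) (x : Space d) :
    mollifiedKernel (c • γ) ε x = c * mollifiedKernel γ ε x :=
  lintegral_smul_measure _ _

theorem RegularCov.smul {γ : Measure (Space d)} {w A c : ℝ} (hγ : RegularCov γ w A) (hc : 0 < c) :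
    RegularCov (ENNReal.ofReal c • γ) w (c * A) where
  w_pos := hγ.w_pos
  w_lt := hγ.w_lt
  A_pos := mul_pos hc hγ.A_pos
  bound ε x hε := by
    rw [mollifiedKernel_smul, mul_assoc, ENNReal.ofReal_mul hc.le]
    gcongr
    exact hγ.bound ε x hε
  decay ε hε := by
    simpa only [funext (mollifiedKernel_smul _ γ ε), mul_zero] using
      ENNReal.Tendsto.const_mul (hγ.decay ε hε) (.inr ENNReal.ofReal_ne_top)
  lower := by
    obtain ⟨a, ha, hlower⟩ := hγ.lower
    refine ⟨c * a, mul_pos hc ha, fun ε hε => ?_⟩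
    rw [mollifiedKernel_smul, mul_assoc, ENNReal.ofReal_mul hc.le]
    gcongr
    exact hlower ε hε

theorem exists_regularCov_of_scaling {γ : Measure (Space d)} {w : ℝ} (hw0 : 0 < w) (hw2 : w < 2)
    (hscale : ∀ ε x, 0 < ε → mollifiedKernel γ ε x =
      ENNReal.ofReal (ε ^ (-w)) * mollifiedKernel γ 1 (ε⁻¹ • x))
    (hbound : ∃ C : ℝ≥0∞, C ≠ ⊤ ∧ ∀ x, mollifiedKernel γ 1 x ≤ C)
    (hdecay : Tendsto (mollifiedKernel γ 1) (cocompact (Space d)) (𝓝 0))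
    (hpos : 0 < mollifiedKernel γ 1 0) : ∃ A, RegularCov γ w A := by
  obtain ⟨C, hC, hle⟩ := hbound
  have hCpos : 0 < C.toReal := ENNReal.toReal_pos (hpos.trans_le (hle 0)).ne' hC
  have htop : mollifiedKernel γ 1 0 ≠ ⊤ := ((hle 0).trans_lt hC.lt_top).ne
  refine ⟨C.toReal, hw0, hw2, hCpos, fun ε x hε => ?_, fun ε hε => ?_,
    (mollifiedKernel γ 1 0).toReal, ENNReal.toReal_pos hpos.ne' htop, fun ε hε => ?_⟩
  · rw [hscale ε x hε, mul_comm C.toReal, ENNReal.ofReal_mul (by positivity),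
      ENNReal.ofReal_toReal hC]
    gcongr
    exact hle _
  · have hdilate : Tendsto (fun x : Space d => ε⁻¹ • x) (cocompact _) (cocompact _) :=
      (Homeomorph.smulOfNeZero ε⁻¹ (inv_ne_zero hε.ne')).isClosedEmbedding.tendsto_cocompact
    simpa only [← hscale ε _ hε, mul_zero, Function.comp_apply] using
      ENNReal.Tendsto.const_mul (hdecay.comp hdilate) (.inr (ENNReal.ofReal_ne_top (r := ε ^ (-w))))
  · rw [hscale ε 0 hε, smul_zero, mul_comm (ENNReal.toReal _), ENNReal.ofReal_mul (by positivity),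
      ENNReal.ofReal_toReal htop]

theorem gaussianDensity_smul {ε : ℝ} (hε : 0 < ε) (x : Space d) :
    gaussianDensity d ε x = ENNReal.ofReal ((ε ^ d)⁻¹) * gaussianDensity d 1 (ε⁻¹ • x) := by
  rw [gaussianDensity, gaussianKernel_smul hε, ENNReal.ofReal_mul (by positivity), gaussianDensity]

theorem exists_regularCov_dirac (hd0 : 0 < (d : ℝ)) (hd2 : (d : ℝ) < 2) :
    ∃ A, RegularCov (Measure.dirac (0 : Space d)) d A := by
  have hkernel (ε : ℝ) (x : Space d) :
      mollifiedKernel (Measure.dirac 0) ε x = gaussianDensity d ε x := by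
    rw [mollifiedKernel_eq, lintegral_dirac, sub_zero]
  refine exists_regularCov_of_scaling hd0 hd2 (fun ε x hε => ?_)
    ⟨1, ENNReal.one_ne_top, fun x => ?_⟩ ?_ ?_
  · rw [hkernel, hkernel, gaussianDensity_smul hε, Real.rpow_neg hε.le, Real.rpow_natCast]
  · rw [hkernel]
    exact gaussianDensity_one_le_one x
  · simpa only [funext (hkernel 1)] using tendsto_gaussianDensity_cocompact one_pos
  · rw [hkernel]
    exact gaussianDensity_pos one_pos 0

theorem mollifiedKernel_withDensity {f : Space d → ℝ≥0∞} (hf : Measurable f) (ε : ℝ) (x : Space d) :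
    mollifiedKernel (volume.withDensity f) ε x = ∫⁻ y, gaussianDensity d ε (x - y) * f y := by
  rw [mollifiedKernel_eq, lintegral_withDensity_eq_lintegral_mul _ hf (by fun_prop)]
  simp only [Pi.mul_apply, mul_comm]

theorem mollifiedKernel_withDensity_of_homogeneous {f : Space d → ℝ≥0∞} (hf : Measurable f) {w : ℝ}
    (hfw : ∀ (ε : ℝ) y, 0 < ε → f (ε • y) = ENNReal.ofReal (ε ^ (-w)) * f y) {ε : ℝ} (hε : 0 < ε)
    (x : Space d) :
    mollifiedKernel (volume.withDensity f) ε x =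
      ENNReal.ofReal (ε ^ (-w)) * mollifiedKernel (volume.withDensity f) 1 (ε⁻¹ • x) := by
  have hjac : ENNReal.ofReal ((ε ^ d)⁻¹) ≠ 0 := (ENNReal.ofReal_pos.2 (by positivity)).ne'
  have hsubst : ENNReal.ofReal ((ε ^ d)⁻¹) * ∫⁻ y, gaussianDensity d ε (x - y) * f y =
      ∫⁻ y, gaussianDensity d ε (x - ε • y) * f (ε • y) := by
    rw [← lintegral_map (f := fun y => gaussianDensity d ε (x - y) * f y) (by fun_prop)
        (measurable_const_smul ε), Measure.map_addHaar_smul _ hε.ne', lintegral_smul_measure,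
      finrank_euclideanSpace, Fintype.card_fin, abs_of_pos (by positivity), smul_eq_mul]
  have hdilate (y : Space d) : gaussianDensity d ε (x - ε • y) * f (ε • y) =
      ENNReal.ofReal ((ε ^ d)⁻¹) *
        (ENNReal.ofReal (ε ^ (-w)) * (gaussianDensity d 1 (ε⁻¹ • x - y) * f y)) := by
    rw [hfw ε y hε, gaussianDensity_smul hε, smul_sub, inv_smul_smul₀ hε.ne']
    ring
  rw [mollifiedKernel_withDensity hf, mollifiedKernel_withDensity hf,
    ← lintegral_const_mul _ (by fun_prop)]
  simp_rw [hdilate] at hsubst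
  rw [lintegral_const_mul _ (by fun_prop)] at hsubst
  exact (ENNReal.mul_right_inj hjac ENNReal.ofReal_ne_top).1 hsubst

theorem exists_regularCov_riesz {a : ℝ} (ha0 : 0 < a) (had : a < d) (ha2 : a < 2) :
    ∃ A, RegularCov (volume.withDensity fun x : Space d => ENNReal.ofReal (‖x‖ ^ (-a))) a A := by
  have : NeZero d := ⟨by rintro rfl; exact absurd (ha0.trans had) (by simp)⟩
  have hrank : a < Module.finrank ℝ (Space d) := by rwa [finrank_euclideanSpace_fin]
  have hmeas : Measurable fun x : Space d => ENNReal.ofReal (‖x‖ ^ (-a)) := by fun_prop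
  have hgint : ∫⁻ x, gaussianDensity d 1 x ≠ ⊤ := by simp [lintegral_gaussianDensity]
  have hkernel : mollifiedKernel (volume.withDensity fun x => ENNReal.ofReal (‖x‖ ^ (-a))) 1 =
      powerConv volume (gaussianDensity d 1) a :=
    funext (mollifiedKernel_withDensity hmeas 1)
  refine exists_regularCov_of_scaling ha0 ha2
    (fun ε x hε => mollifiedKernel_withDensity_of_homogeneous hmeas (fun ε y hε => ?_) hε x)
    ?_ ?_ ?_
  · rw [norm_smul, Real.norm_of_nonneg hε.le, Real.mul_rpow hε.le (norm_nonneg _),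
      ENNReal.ofReal_mul (by positivity)]
  · rw [hkernel]
    exact exists_powerConv_le (measurable_gaussianDensity 1) ha0.le hrank ENNReal.one_ne_top
      gaussianDensity_one_le_one hgint
  · rw [hkernel]
    exact tendsto_powerConv_cocompact (measurable_gaussianDensity 1) ha0 hrank hgint
      (tendsto_gaussianDensity_cocompact one_pos)
  · rw [hkernel]
    exact powerConv_pos (measurable_gaussianDensity 1) (gaussianDensity_pos one_pos) a 0

theorem tendsto_prod_coprodᵢ {ι : Type*} [Fintype ι] {X : ι → Type*} {l : ∀ i, Filter (X i)}
    {f : ∀ i, X i → ℝ≥0∞} {C : ι → ℝ≥0∞} (hC : ∀ i, C i ≠ ⊤) (hfC : ∀ i t, f i t ≤ C i)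
    (hf : ∀ i, Tendsto (f i) (l i) (𝓝 0)) :
    Tendsto (fun x : ∀ i, X i => ∏ i, f i (x i)) (Filter.coprodᵢ l) (𝓝 0) := by
  classical
  refine tendsto_iSup.2 fun i => ?_
  have hfactor : Tendsto (fun x : ∀ i, X i => f i (x i) * ∏ j ∈ Finset.univ.erase i, C j)
      ((l i).comap (Function.eval i)) (𝓝 0) := by
    simpa using ENNReal.Tendsto.mul_const ((hf i).comp tendsto_comap)
      (.inr (ENNReal.prod_ne_top fun j _ => hC j))
  refine tendsto_of_tendsto_of_tendsto_of_le_of_le tendsto_const_nhds hfactor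
    (fun _ => zero_le) fun x => ?_
  dsimp only
  rw [← Finset.mul_prod_erase _ _ (Finset.mem_univ i)]
  gcongr with j
  exact hfC j _

theorem tendsto_prod_cocompact {f : Fin d → ℝ → ℝ≥0∞} {C : Fin d → ℝ≥0∞} (hC : ∀ i, C i ≠ ⊤)
    (hfC : ∀ i t, f i t ≤ C i) (hf : ∀ i, Tendsto (f i) (cocompact ℝ) (𝓝 0)) :
    Tendsto (fun x : Space d => ∏ i, f i (x i)) (cocompact (Space d)) (𝓝 0) := by
  have hprod := tendsto_prod_coprodᵢ hC hfC hf
  rw [Filter.coprodᵢ_cocompact] at hprod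
  exact hprod.comp (PiLp.homeomorph 2 fun _ : Fin d => ℝ).isClosedEmbedding.tendsto_cocompact

theorem lintegral_pi_prod {n : ℕ} {f : Fin n → ℝ → ℝ≥0∞} (hf : ∀ i, Measurable (f i)) :
    ∫⁻ x : Fin n → ℝ, ∏ i, f i (x i) = ∏ i, ∫⁻ t, f i t := by
  induction n with
  | zero => simp [volume_pi, Measure.pi_empty_univ]
  | succ n ih =>
    calc ∫⁻ x : Fin (n + 1) → ℝ, ∏ i, f i (x i)
        = ∫⁻ x : ℝ × (Fin n → ℝ), f 0 x.1 * ∏ i : Fin n, f i.succ (x.2 i) := by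
          rw [← (volume_preserving_piFinSuccAbove (fun _ : Fin (n + 1) => ℝ) 0).symm
            |>.lintegral_comp_emb (MeasurableEquiv.measurableEmbedding _)]
          simp [Fin.prod_univ_succ, MeasurableEquiv.piFinSuccAbove_symm_apply]
      _ = (∫⁻ t, f 0 t) * ∏ i : Fin n, ∫⁻ t, f i.succ t := by
          rw [← ih fun i => hf i.succ]
          have : Measurable fun y : Fin n → ℝ => ∏ i, f i.succ (y i) :=
            Finset.measurable_prod _ fun i _ => (hf i.succ).comp (measurable_pi_apply i)
          exact lintegral_prod_mul (hf 0).aemeasurable this.aemeasurable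
      _ = ∏ i, ∫⁻ t, f i t := (Fin.prod_univ_succ fun i => ∫⁻ t, f i t).symm

theorem lintegral_prod_apply {f : Fin d → ℝ → ℝ≥0∞} (hf : ∀ i, Measurable (f i)) :
    ∫⁻ x : Space d, ∏ i, f i (x i) = ∏ i, ∫⁻ t, f i t := by
  rw [← lintegral_pi_prod hf]
  exact (PiLp.volume_preserving_ofLp (Fin d)).lintegral_comp_emb
    (MeasurableEquiv.toLp 2 (Fin d → ℝ)).symm.measurableEmbedding
    (fun y : Fin d → ℝ => ∏ i, f i (y i))

open ProbabilityTheory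

theorem gaussianDensity_one_eq_prod (x : Space d) :
    gaussianDensity d 1 x = ∏ i, gaussianPDF 0 1 (x i) := by
  have hnorm : (2 * Real.pi * 1 ^ 2) ^ ((d : ℝ) / 2) = ∏ _i : Fin d, √(2 * Real.pi) := by
    rw [Fin.prod_const, one_pow, mul_one, Real.sqrt_eq_rpow,
      ← Real.rpow_mul_natCast (by positivity)]
    ring_nf
  have hexp : -‖x‖ ^ 2 / (2 * 1 ^ 2) = ∑ i, -x i ^ 2 / 2 := by
    rw [EuclideanSpace.real_norm_sq_eq, ← Finset.sum_div, Finset.sum_neg_distrib, one_pow,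
      mul_one]
  simp only [gaussianPDF]
  rw [← ENNReal.ofReal_prod_of_nonneg fun i _ => gaussianPDFReal_nonneg 0 1 _, gaussianDensity,
    gaussianKernel, hnorm, hexp, Real.exp_sum, ← Finset.prod_div_distrib]
  simp [gaussianPDFReal, div_eq_inv_mul]

theorem gaussianPDF_eq_gaussianDensity (t : ℝ) :
    gaussianPDF 0 1 t = gaussianDensity 1 1 (WithLp.toLp 2 fun _ => t) := by
  rw [gaussianDensity_one_eq_prod, Fin.prod_univ_one]

theorem gaussianPDF_le_one (t : ℝ) : gaussianPDF 0 1 t ≤ 1 := by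
  rw [gaussianPDF_eq_gaussianDensity]
  exact gaussianDensity_one_le_one _

theorem tendsto_gaussianPDF_cocompact : Tendsto (gaussianPDF 0 1) (cocompact ℝ) (𝓝 0) := by
  rw [funext gaussianPDF_eq_gaussianDensity]
  have hnorm (t : ℝ) : ‖(WithLp.toLp 2 fun _ => t : Space 1)‖ = ‖t‖ := by
    rw [EuclideanSpace.norm_eq, Fin.sum_univ_one, Real.sqrt_sq (norm_nonneg _)]
  refine (tendsto_gaussianDensity_cocompact one_pos).comp ?_
  rw [← Metric.cobounded_eq_cocompact (α := Space 1), ← tendsto_norm_atTop_iff_cobounded]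
  simp_rw [hnorm]
  exact tendsto_norm_cocompact_atTop

theorem mollifiedKernel_prod {w : Fin d → ℝ} (x : Space d) :
    mollifiedKernel
        (volume.withDensity fun y : Space d => ENNReal.ofReal (∏ i, |y i| ^ (-w i))) 1 x =
      ∏ i, powerConv volume (gaussianPDF 0 1) (w i) (x i) := by
  rw [mollifiedKernel_withDensity (by fun_prop)]
  unfold powerConv
  rw [← lintegral_prod_apply fun i => by fun_prop]
  refine lintegral_congr fun y => ?_
  rw [gaussianDensity_one_eq_prod, Finset.prod_mul_distrib,
    ENNReal.ofReal_prod_of_nonneg fun i _ => by positivity]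
  simp only [PiLp.sub_apply, Real.norm_eq_abs]

theorem exists_regularCov_fractional {w : Fin d → ℝ} (hw : ∀ i, 0 < w i ∧ w i < 1)
    (hw0 : 0 < ∑ i, w i) (hw2 : ∑ i, w i < 2) :
    ∃ A, RegularCov
      (volume.withDensity fun x : Space d => ENNReal.ofReal (∏ i, |x i| ^ (-w i)))
      (∑ i, w i) A := by
  have hmeas := measurable_gaussianPDF 0 1
  have hrank (i : Fin d) : w i < Module.finrank ℝ ℝ := by simpa using (hw i).2
  have hgint : ∫⁻ t, gaussianPDF 0 1 t ≠ ⊤ := by simp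
  choose C hC hle using fun i => exists_powerConv_le (μ := volume) hmeas (hw i).1.le (hrank i)
    ENNReal.one_ne_top gaussianPDF_le_one hgint
  refine exists_regularCov_of_scaling hw0 hw2 (fun ε x hε =>
    mollifiedKernel_withDensity_of_homogeneous (by fun_prop) (fun ε y hε => ?_) hε x)
    ⟨∏ i, C i, ENNReal.prod_ne_top fun i _ => hC i, fun x => ?_⟩ ?_ ?_
  · rw [← ENNReal.ofReal_mul (by positivity), ← Finset.sum_neg_distrib,
      Real.rpow_sum_of_pos hε, ← Finset.prod_mul_distrib]
    simp_rw [PiLp.smul_apply, smul_eq_mul, abs_mul, abs_of_pos hε,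
      Real.mul_rpow hε.le (abs_nonneg _)]
  · rw [mollifiedKernel_prod]
    exact Finset.prod_le_prod' fun i _ => hle i _
  · rw [funext mollifiedKernel_prod]
    exact tendsto_prod_cocompact hC hle fun i =>
      tendsto_powerConv_cocompact hmeas (hw i).1 (hrank i) hgint tendsto_gaussianPDF_cocompact
  · rw [mollifiedKernel_prod]
    exact pos_iff_ne_zero.2 (Finset.prod_ne_zero_iff.2 fun i _ =>
      (powerConv_pos hmeas (gaussianPDF_pos 0 one_ne_zero) _ _).ne')

theorem withDensity_const_mul_ofReal {c : ℝ} (hc : 0 ≤ c) {f : Space d → ℝ} (hf : Measurable f) :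
    volume.withDensity (fun x => ENNReal.ofReal (c * f x)) =
      ENNReal.ofReal c • volume.withDensity fun x => ENNReal.ofReal (f x) := by
  rw [← withDensity_smul _ hf.ennreal_ofReal]
  congr with x
  rw [ENNReal.ofReal_mul hc, Pi.smul_apply, smul_eq_mul]

instance sfinite_cov (σ : ℝ) (k : NoiseKernel d) : SFinite (k.cov σ) := by
  cases k <;> unfold NoiseKernel.cov <;> infer_instance

theorem NoiseKernel.exists_regularCov {σ : ℝ} (hσ : σ ≠ 0) (k : NoiseKernel d) (hk : k.Admissible)
    (hw0 : 0 < k.exponent) (hw2 : k.exponent < 2) : ∃ A, RegularCov (k.cov σ) k.exponent A := by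
  have hσ2 : 0 < σ ^ 2 := by positivity
  cases k with
  | white =>
    obtain ⟨A, hA⟩ := exists_regularCov_dirac hw0 hw2
    exact ⟨_, hA.smul hσ2⟩
  | riesz a =>
    obtain ⟨A, hA⟩ := exists_regularCov_riesz hk.1 hk.2 hw2
    refine ⟨σ ^ 2 * A, ?_⟩
    rw [NoiseKernel.cov, withDensity_const_mul_ofReal hσ2.le (by fun_prop)]
    exact hA.smul hσ2
  | fractional w =>
    obtain ⟨A, hA⟩ := exists_regularCov_fractional hk hw0 hw2
    refine ⟨σ ^ 2 * A, ?_⟩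
    rw [NoiseKernel.cov, withDensity_const_mul_ofReal hσ2.le (by fun_prop)]
    exact hA.smul hσ2

end Kernels

section ScalingLimit

variable {d : ℕ}

theorem sub_ae_eq_translate_sub {u v : L2 d} {f f' : Space d → ℝ} (hf : f =ᵐ[volume] v)
    (hf' : f' =ᵐ[volume] u) (z : Space d) :
    (fun x => f (x - -z) - f' x) =ᵐ[volume] (translate z v - u : L2 d) := by
  have hshift : (fun x => f (x + z)) =ᵐ[volume] fun x => v (x + z) :=
    (measurePreserving_add_right volume z).quasiMeasurePreserving.ae_eq_comp hf
  filter_upwards [hshift, hf', coeFn_translate z v, Lp.coeFn_sub (translate z v) u] with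
    x hfx hf'x hvx hsub
  rw [hsub, Pi.sub_apply, hvx, ← hfx, hf'x, sub_neg_eq_add]

theorem tendsto_h1Norm_sub_of_tendsto_translate {v : ℕ → L2 d} {h : ℕ → VectorL2 d}
    (hv : ∀ n, HasGrad (v n) (h n)) {F : ℕ → Space d → ℝ} (hF : ∀ n, F n =ᵐ[volume] v n)
    {u : L2 d} {g : VectorL2 d} (hu : HasGrad u g) {f : Space d → ℝ} (hf : f =ᵐ[volume] u)
    {z : ℕ → Space d} (hvu : Tendsto (fun n => translate (z n) (v n)) atTop (𝓝 u))
    (hhg : Tendsto (fun n => translate (z n) (h n)) atTop (𝓝 g)) :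
    Tendsto (fun n => h1Norm fun x => F n (x - -z n) - f x) atTop (𝓝 0) := by
  have hnorm (n : ℕ) : h1Norm (fun x => F n (x - -z n) - f x) =
      √(‖translate (z n) (v n) - u‖ ^ 2 + ‖translate (z n) (h n) - g‖ ^ 2) :=
    (((hv n).translate (z n)).sub hu).h1Norm_eq (sub_ae_eq_translate_sub (hF n) hf (z n))
  simp only [hnorm]
  simpa using (((tendsto_iff_norm_sub_tendsto_zero.1 hvu).pow 2).add
    ((tendsto_iff_norm_sub_tendsto_zero.1 hhg).pow 2)).sqrt

theorem maxEnergy_le_add {κ δ : ℝ} {μ ν : Measure (Space d)} (hν : Tame ν) (hκ : 0 < κ)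
    (hpos : 0 < maxEnergy κ ν) (hδ : 0 ≤ δ)
    (h : ∀ (u : L2 d) (g : VectorL2 d), HasGrad u g → ‖u‖ = 1 → 0 ≤ sobolevEnergy κ μ u g →
      sobolevEnergy κ μ u g ≤ sobolevEnergy κ ν u g + δ) :
    maxEnergy κ μ ≤ maxEnergy κ ν + δ := by
  refine maxEnergy_le fun u g hu hnorm => ?_
  rcases le_total 0 (sobolevEnergy κ μ u g) with h0 | h0
  · exact (h u g hu hnorm h0).trans (by gcongr; exact hν.sobolevEnergy_le_maxEnergy hκ hu hnorm)
  · linarith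

namespace RegularCov

variable {γ : Measure (Space d)} [SFinite γ] {w A κ : ℝ}

theorem tame (hγ : RegularCov γ w A) : Tame γ := by
  simpa only [scaledCov_of_nonpos γ le_rfl] using hγ.tame_scaledCov 0

theorem maxEnergy_pos (hγ : RegularCov γ w A) (hκ : 0 < κ) : 0 < maxEnergy κ γ := by
  simpa only [scaledCov_of_nonpos γ le_rfl] using hγ.maxEnergy_scaledCov_pos hκ 0

theorem exists_norm_grad_le (hγ : RegularCov γ w A) (hκ : 0 < κ) :
    ∃ R : ℝ, 0 ≤ R ∧ ∀ (u : L2 d) (g : VectorL2 d), HasGrad u g → ‖u‖ = 1 → ∀ ε,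
      0 ≤ sobolevEnergy κ (scaledCov γ ε) u g → ‖g‖ ≤ R := by
  obtain ⟨C, hC, hle⟩ := hγ.exists_interaction_scaledCov_le (half_pos hκ)
  exact ⟨_, Real.sqrt_nonneg _, fun u g hu hnorm ε => norm_grad_le_of_le_sobolevEnergy hκ hnorm
    (ENNReal.toReal_le_of_le_ofReal (by positivity) (hle u g hu ε))⟩

theorem abs_sobolevEnergy_scaledCov_sub_le (hγ : RegularCov γ w A) {R : ℝ} {u : L2 d}
    {g : VectorL2 d} (hu : HasGrad u g) (huR : ‖u‖ ≤ R) (hgR : ‖g‖ ≤ R) {ε : ℝ} (hε : 0 < ε)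
    (hε1 : ε ≤ 1) :
    |sobolevEnergy κ (scaledCov γ ε) u g - sobolevEnergy κ γ u g| ≤
      oscConst d w A R * ε ^ (1 - w / 2) := by
  have hwithin := (hγ.isWithin_interaction_scaledCov hu huR hgR hε (ε := 0) hε.le hε1).symm
  have hosc := hγ.oscConst_nonneg ((norm_nonneg u).trans huR)
  rw [scaledCov_of_nonpos γ le_rfl, ← scaledCov_of_pos γ hε,
    ← ENNReal.ofReal_toReal (hγ.tame.interaction_ne_top hu),
    ← ENNReal.ofReal_toReal ((hγ.tame_scaledCov ε).interaction_ne_top hu),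
    isWithin_ofReal_iff (by positivity) ENNReal.toReal_nonneg ENNReal.toReal_nonneg] at hwithin
  simpa only [sobolevEnergy, sub_sub_sub_cancel_right] using hwithin

theorem exists_abs_sobolevEnergy_scaledCov_sub_le (hγ : RegularCov γ w A) (hκ : 0 < κ) :
    ∃ C : ℝ, 0 ≤ C ∧ ∀ (u : L2 d) (g : VectorL2 d), HasGrad u g → ‖u‖ = 1 → ∀ ε, 0 < ε → ε ≤ 1 →
      0 ≤ sobolevEnergy κ (scaledCov γ ε) u g ∨ 0 ≤ sobolevEnergy κ γ u g →
      |sobolevEnergy κ (scaledCov γ ε) u g - sobolevEnergy κ γ u g| ≤ C * ε ^ (1 - w / 2) := by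
  obtain ⟨R, hR, hgR⟩ := hγ.exists_norm_grad_le hκ
  refine ⟨_, hγ.oscConst_nonneg (hR.trans (le_max_left R 1)), fun u g hu hnorm ε hε hε1 h0 =>
    hγ.abs_sobolevEnergy_scaledCov_sub_le hu (hnorm.trans_le (le_max_right _ _))
      (le_trans ?_ (le_max_left _ _)) hε hε1⟩
  rcases h0 with h0 | h0
  · exact hgR u g hu hnorm ε h0
  · exact hgR u g hu hnorm 0 (by rwa [scaledCov_of_nonpos γ le_rfl])

theorem tendsto_maxEnergy_scaledCov (hγ : RegularCov γ w A) (hκ : 0 < κ) :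
    Tendsto (fun ε => maxEnergy κ (scaledCov γ ε)) (𝓝[>] 0) (𝓝 (maxEnergy κ γ)) := by
  obtain ⟨C, hC, hle⟩ := hγ.exists_abs_sobolevEnergy_scaledCov_sub_le hκ
  rw [tendsto_iff_norm_sub_tendsto_zero]
  refine squeeze_zero' (.of_forall fun _ => norm_nonneg _) ?_
    (tendsto_const_mul_rpow C (θ := 1 - w / 2) (by linarith [hγ.w_lt]))
  filter_upwards [Ioc_mem_nhdsGT one_pos] with ε ⟨hε, hε1⟩
  have hδ : 0 ≤ C * ε ^ (1 - w / 2) := by positivity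
  have hupper := maxEnergy_le_add hγ.tame hκ (hγ.maxEnergy_pos hκ) hδ fun u g hu hnorm h0 =>
    sub_le_iff_le_add'.1 (abs_sub_le_iff.1 (hle u g hu hnorm ε hε hε1 (.inl h0))).1
  have hlower := maxEnergy_le_add (hγ.tame_scaledCov ε) hκ (hγ.maxEnergy_scaledCov_pos hκ ε) hδ
    fun u g hu hnorm h0 =>
      sub_le_iff_le_add'.1 (abs_sub_le_iff.1 (hle u g hu hnorm ε hε hε1 (.inr h0))).2
  exact abs_sub_le_iff.2 ⟨sub_le_iff_le_add'.2 hupper, sub_le_iff_le_add'.2 hlower⟩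

theorem tendsto_sobolevEnergy_of_eq_maxEnergy (hγ : RegularCov γ w A) (hκ : 0 < κ) {ε : ℕ → ℝ}
    (hε : Tendsto ε atTop (𝓝[>] 0)) {v : ℕ → L2 d} {h : ℕ → VectorL2 d}
    (hv : ∀ n, HasGrad (v n) (h n)) (hnorm : ∀ n, ‖v n‖ = 1)
    (hmax : ∀ n, sobolevEnergy κ (scaledCov γ (ε n)) (v n) (h n) =
      maxEnergy κ (scaledCov γ (ε n))) :
    Tendsto (fun n => sobolevEnergy κ γ (v n) (h n)) atTop (𝓝 (maxEnergy κ γ)) := by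
  obtain ⟨C, -, hle⟩ := hγ.exists_abs_sobolevEnergy_scaledCov_sub_le hκ
  refine ((hγ.tendsto_maxEnergy_scaledCov hκ).comp hε).congr_dist
    (squeeze_zero' (.of_forall fun _ => dist_nonneg) ?_
      ((tendsto_const_mul_rpow C (θ := 1 - w / 2) (by linarith [hγ.w_lt])).comp hε))
  filter_upwards [hε (Ioc_mem_nhdsGT one_pos)] with n ⟨hn, hn1⟩
  have hpos : 0 ≤ sobolevEnergy κ (scaledCov γ (ε n)) (v n) (h n) :=
    (hγ.maxEnergy_scaledCov_pos hκ (ε n)).le.trans_eq (hmax n).symm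
  simpa only [Function.comp_apply, ← hmax, Real.dist_eq] using
    hle _ _ (hv n) (hnorm n) (ε n) hn hn1 (.inl hpos)

theorem exists_tendsto_isMaximizer (hγ : RegularCov γ w A) (hκ : 0 < κ) {ε : ℕ → ℝ}
    (hε : Tendsto ε atTop (𝓝[>] 0)) {F : ℕ → Space d → ℝ}
    (hF : ∀ n, IsMaximizer κ (scaledCov γ (ε n)) (F n)) :
    ∃ φ : ℕ → ℕ, StrictMono φ ∧ ∃ (z : ℕ → Space d) (f : Space d → ℝ), IsMaximizer κ γ f ∧
      Tendsto (fun n => h1Norm fun x => F (φ n) (x - z n) - f x) atTop (𝓝 0) := by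
  choose v h hv hFv using fun n => (hF n).1.exists_hasGrad
  have hmax n := ((hγ.tame_scaledCov (ε n)).isMaximizer_iff hκ (hv n) (hFv n)).1 (hF n)
  have hmaximizing := hγ.tendsto_sobolevEnergy_of_eq_maxEnergy hκ hε hv (fun n => (hmax n).1)
    fun n => (hmax n).2
  obtain ⟨φ, z, u, g, hφ, hu, hnorm, henergy, hvu, hhg⟩ := hγ.tame.exists_maximizer_of_maximizing
    hκ (hγ.maxEnergy_pos hκ) (fun _ _ => hγ.tame.sobolevEnergy_le_maxEnergy hκ) hv
    (fun n => (hmax n).1) hmaximizing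
  exact ⟨φ, hφ, fun n => -z n, u, (hγ.tame.isMaximizer_iff hκ hu .rfl).2 ⟨hnorm, henergy⟩,
    tendsto_h1Norm_sub_of_tendsto_translate (fun n => hv (φ n)) (fun n => hFv (φ n)) hu .rfl
      hvu hhg⟩

theorem tendsto_varConst_scaledCov (hγ : RegularCov γ w A) (hκ : 0 < κ) :
    Tendsto (fun ε => varConst κ (scaledCov γ ε)) (𝓝[>] 0) (𝓝 (varConst κ γ)) := by
  simp only [(hγ.tame_scaledCov _).varConst_eq_maxEnergy hκ, hγ.tame.varConst_eq_maxEnergy hκ]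
  exact (continuous_coe_real_ereal.tendsto _).comp (hγ.tendsto_maxEnergy_scaledCov hκ)

end RegularCov

theorem tendsto_const_mul_nhdsGT_zero {a : ℝ} (ha : 0 < a) :
    Tendsto (fun c : ℝ => a * c) (𝓝[>] 0) (𝓝[>] 0) := by
  simpa only [mul_zero, id_eq] using TendstoNhdsWithinIoi.const_mul (c := 0) ha tendsto_id

theorem covAt_eq_scaledCov (k : NoiseKernel d) (σ : ℝ) {p c : ℝ} (hp : 0 < p) (hc : 0 < c) :
    k.covAt σ p c = scaledCov (k.cov σ) (p ^ (1 / (2 - k.exponent)) * c) :=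
  (scaledCov_of_pos _ (by positivity)).symm

end ScalingLimit

end

end PAM

theorem proposition2p4 (d : ℕ) (κ σ : ℝ) (hκ : 0 < κ) (hσ : 0 < σ)
    (k : PAM.NoiseKernel d) (hk : k.Admissible)
    (hω₀ : 0 < k.exponent) (hω₂ : k.exponent < 2) :
    (∀ p c : ℝ, 0 < p → 0 < c →
      0 < PAM.varConst κ (k.covAt σ p c) ∧
      PAM.varConst κ (k.covAt σ p c) < ⊤ ∧
      ∃ f : PAM.Space d → ℝ, PAM.IsMaximizer κ (k.covAt σ p c) f) ∧
    (∀ p : ℝ, 0 < p →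
      PAM.varConst κ (k.cov σ) < ⊤ ∧
      Tendsto (fun c : ℝ => PAM.varConst κ (k.covAt σ p c)) (𝓝[>] 0)
        (𝓝 (PAM.varConst κ (k.cov σ)))) ∧
    (∀ p : ℝ, 0 < p → ∀ F : ℝ → PAM.Space d → ℝ,
      (∀ c : ℝ, 0 < c → PAM.IsMaximizer κ (k.covAt σ p c) (F c)) →
      ∀ c : ℕ → ℝ, (∀ n, 0 < c n) → Tendsto c atTop (𝓝 0) →
        ∃ φ : ℕ → ℕ, StrictMono φ ∧
          ∃ (z : ℕ → PAM.Space d) (fstar : PAM.Space d → ℝ),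
            PAM.IsMaximizer κ (k.cov σ) fstar ∧
            Tendsto (fun n => PAM.h1Norm fun x => F (c (φ n)) (x - z n) - fstar x)
              atTop (𝓝 0)) := by
  obtain ⟨A, hγ⟩ := PAM.NoiseKernel.exists_regularCov hσ.ne' k hk hω₀ hω₂
  have htame (ε : ℝ) : PAM.Tame (PAM.scaledCov (k.cov σ) ε) := hγ.tame_scaledCov ε
  have hscale {p : ℝ} (hp : 0 < p) :=
    PAM.tendsto_const_mul_nhdsGT_zero (Real.rpow_pos_of_pos hp (1 / (2 - k.exponent)))
  refine ⟨fun p c hp hc => ?_, fun p hp => ⟨?_, ?_⟩, fun p hp F hF c hc hc0 => ?_⟩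
  · have hpos := hγ.maxEnergy_scaledCov_pos hκ (p ^ (1 / (2 - k.exponent)) * c)
    rw [PAM.covAt_eq_scaledCov k σ hp hc, (htame _).varConst_eq_maxEnergy hκ]
    exact ⟨EReal.coe_pos.2 hpos, EReal.coe_lt_top _, (htame _).exists_isMaximizer hκ hpos⟩
  · rw [hγ.tame.varConst_eq_maxEnergy hκ]
    exact EReal.coe_lt_top _
  · refine ((hγ.tendsto_varConst_scaledCov hκ).comp (hscale hp)).congr' ?_
    filter_upwards [self_mem_nhdsWithin] with c hc
    rw [PAM.covAt_eq_scaledCov k σ hp hc, Function.comp_apply]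
  · have hc' : Tendsto c atTop (𝓝[>] 0) := tendsto_nhdsWithin_iff.2 ⟨hc0, .of_forall hc⟩
    exact hγ.exists_tendsto_isMaximizer hκ ((hscale hp).comp hc') (F := fun n => F (c n))
      fun n => PAM.covAt_eq_scaledCov k σ hp (hc n) ▸ hF (c n) (hc n)
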